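/- **Setting.** Let $\Sigma$ be a closed orientable smooth 3-manifold with a fixed volume form $\mathsf{vol}_0$ (which orients $\Sigma$). Indices $i,j,k,\dots\in\{1,2,3\}$ are moved with $\delta_{ij}$ and repeated indices are summed; $\varepsilon_{ijk}$ is the Levi-Civita symbol; $\xi\lrcorner\beta$ is the interior product with $\xi\lrcorner\eta\lrcorner\beta=\xi\lrcorner(\eta\lrcorner\beta)$; $(\beta/\mathsf{vol})$ is the function $f$ with $\beta=f\,\mathsf{vol}$. Let $\mathsf M_0$ be the set of smooth fields $(e_t^i,e^i,A_t^i,A^i,\phi)$ with $e_t^i,A_t^i,\phi\in C^\infty(\Sigma)$, $e^i,A^i\in\Omega^1(\Sigma)$ and $(\mathsf{vol}_e/\mathsf{vol}_0)>0$, $\mathsf{vol}_e=\frac1{3!}\varepsilon_{ijk}e^i\wedge e^j\wedge e^k$. Put $F_i=dA_i+\frac12\varepsilon_{ijk}A^j\wedge A^k$, $D\beta_i=d\beta_i+\varepsilon_{ijk}A^j\wedge\beta^k$, $d\phi=\alpha_ie^i$, $\alpha^2=\alpha_i\alpha^i$, $e_t\cdot\alpha=e_t^i\alpha_i$, $$H_i=\tfrac12\varepsilon_{ijk}e^j\wedge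 e^k+e_i\wedge d\phi,\qquad \pi=-e_i\wedge F^i,\qquad \widetilde H_i=\Big(\frac{\cdot\wedge H_i}{\mathsf{vol}_0}\Big)\in\mathfrak X(\Sigma),\qquad \widetilde\pi=\Big(\frac{\pi}{\mathsf{vol}_0}\Big).$$ The extended Husain–Kuchař model has the Hamiltonian $$\mathcal H=-\int_\Sigma\big(A_t^i\,DH_i+e_t^i(\varepsilon_{ijk}e^j\wedge F^k+F_i\wedge d\phi)\big),$$ and its presymplectic form $\omega$ on $\mathsf M_0$ is the pullback of the canonical symplectic form to the primary constraint submanifold $\mathbf p_A(w)=\int_\Sigma H_i\wedge w^i$, $\mathbf p_\phi(w)=\int_\Sigma w\,\pi$ (other momenta zero), with the convention $\Omega(\mathbb Z,\mathbb Y)=\mathbf Y_{\mathbf p}(Z)-\mathbf Z_{\mathbf p}(Y)$. A tangent vector $\mathbb Z=(Z_{e_t},Z_e,Z_{A_t},Z_A,Z_\phi)$ at $q\in\mathsf M_0$ is called *Hamiltonian* if $\omega_q(\mathbb Z,\cdot)=d\mathcal H_q$. Write $Z_{H}$, $Z_{\widetilde H}$ for the variations of $H$, $\widetilde H$ along $\mathbb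 Z$. The secondary constraints are $$\text{(F)}\ \ \varepsilon_{ijk}e^j\wedge F^k+d\phi\wedge F_i=0,\qquad \text{(T)}\ \ \varepsilon_{ijk}e^j\wedge De^k-d\phi\wedge De_i=0 .$$ Let $h^i=\frac{1}{\sqrt{1+\alpha^2}}(\delta^i_k+\alpha^i\alpha_k+\varepsilon^{ij}{}_k\alpha_j)e^k$, $\mathsf{vol}_h=\frac1{3!}\varepsilon_{ijk}h^i\wedge h^j\wedge h^k$, $\det h=(\mathsf{vol}_h/\mathsf{vol}_0)$, ${}^hF_{ij}=(F_i\wedge h_j/\mathsf{vol}_h)$, ${}^hF={}^hF^i{}_i$, and, given $Z_\phi$, $$\widehat e_{t\,i}=\frac{e_{t\,i}+Z_\phi\alpha_i-\varepsilon_{ijk}e_t^j\alpha^k}{\sqrt{1+\alpha^2}},\qquad \widehat\alpha_t=\frac{Z_\phi-e_t\cdot\alpha}{\sqrt{1+\alpha^2}}.$$ **Theorem.** 1. The map $J:(e_t,e,A_t,A,\phi)\mapsto(e_t,\widetilde H,A_t,A,\phi,\widetilde\pi)$ is an injective map from $\mathsf M_0$ to the space $\widetilde\Gamma$ of smooth such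 tuples, and $\omega=J^*\widetilde\omega$ with the canonical form $$\widetilde\omega(\mathbb Z,\mathbb Y)=\int_\Sigma\big(Y_{\widetilde H i}\lrcorner Z_A^i-Z_{\widetilde H i}\lrcorner Y_A^i+Z_\phi Y_{\widetilde\pi}-Y_\phi Z_{\widetilde\pi}\big)\mathsf{vol}_0 .$$ Moreover $\omega(\mathbb Z,\mathbb Y)=\int_\Sigma\big(Y_e^i\wedge(\varepsilon_{ijk}e^j\wedge Z_A^k+d\phi\wedge Z_{Ai}-F_iZ_\phi)+Y_A^i\wedge(-\varepsilon_{ijk}e^j\wedge Z_e^k+d\phi\wedge Z_{ei}-Z_\phi De_i)+Y_\phi(F_i\wedge Z_e^i+De_i\wedge Z_A^i)\big)$. 2. For $q\in\mathsf M_0$ with $\widetilde H=\widetilde H(q)$ and for $p\in C^\infty(\Sigma)$, the conditions $p=\widetilde\pi(q)$, (F), (T) hold together if and only if $$2p-\big((\det h)^2-(\widetilde H_\ell\lrcorner d\phi)(\widetilde H^\ell\lrcorner d\phi)\big)^{-1/2}\varepsilon^{ijk}\widetilde H_i\lrcorner\widetilde H_j\lrcorner F_k=0,\qquad \widetilde H_i\lrcorner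 F^i-p\,d\phi=0,\qquad \mathrm{div}_0\widetilde H^i+\varepsilon^{ijk}\widetilde H_k\lrcorner A_j=0$$ (scalar, vector and Gauss constraints), where $(\det h)^2=-\frac1{3!}\varepsilon^{ijk}\widetilde H_i\lrcorner\widetilde H_j\lrcorner\widetilde H_k\lrcorner\mathsf{vol}_0$. More precisely: under (F), $p=\widetilde\pi$ is equivalent to the scalar constraint; if $p=\widetilde\pi$, (F) is equivalent to the vector constraint; and (T) is equivalent to the Gauss constraint. 3. On $\mathsf M_0$: $H_i=\frac12\varepsilon_{ijk}h^j\wedge h^k$, $\det h>0$, $(\det h)^2$ is given by the formula in 2, and $h_i=-\frac{1}{2\det h}\varepsilon_{ijk}\widetilde H^j\lrcorner\widetilde H^k\lrcorner\mathsf{vol}_0$. 4. A smooth $\mathbb Z$ is Hamiltonian at $q\in\mathsf M_0$ if and only if (F) and (T) hold at $q$ and $$Z_A^i=DA_t^i-\widehat\alpha_t\,{}^hF^{ij}h_j+{}^hF^i{}_jh_k\varepsilon^{kj\ell}\widehat e_{t\ell}+\widehat\alpha_t\,{}^hF\Big(-\varepsilon^{ijk}\alpha_j+\tfrac12(1-\alpha^2)\delta^{ik}+\alpha^i\alpha^k\Big)h_k,$$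 $$Z_{Hi}=D(\varepsilon_{ijk}\widehat e_t^{\,j}h^k)-D(\widehat\alpha_th_i)-\varepsilon_{ijk}A_t^jH^k .$$ That is, $A$ and $H$ evolve as the Ashtekar connection and the densitized triad of Euclidean general relativity with lapse $\widehat\alpha_t$ and shift $\widehat e_t$, except for the last term of $Z_A$. Whenever (F) and (T) hold, for arbitrary smooth $Z_{e_t},Z_{A_t},Z_\phi$ there is exactly one smooth Hamiltonian $\mathbb Z$ with these components. 5. If $\mathbb Z$ is Hamiltonian, then $Z_{Hi}=Z_{\widetilde Hi}\lrcorner\mathsf{vol}_0$, there is exactly one $\xi\in\mathfrak X(\Sigma)$ with $\xi\lrcorner h^i=\widehat e_t^{\,i}$, and with it $$Z_A^i=\pounds_\xi A^i+D(A_t^i-\xi\lrcorner A^i)-\widehat\alpha_t\,{}^hF^{ij}h_j+\widehat\alpha_t\,{}^hF\Big(-\varepsilon^{ijk}\alpha_j+\tfrac12(1-\alpha^2)\delta^{ik}+\alpha^i\alpha^k\Big)h_k,$$ $$Z_{Hi}=\pounds_\xi H_i-\varepsilon_{ijk}(A_t^j-\xi\lrcorner A^j)H^k-D(\widehat\alpha_th_i).$$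 6. If $\mathbb Z$ is Hamiltonian and $Z_\phi=e_t\cdot\alpha$, then $\widehat\alpha_t=0$; there is exactly one $\xi\in\mathfrak X(\Sigma)$ with $\xi\lrcorner e^i=e_t^i$, this condition is equivalent to $\xi\lrcorner h^i=\widehat e_t^{\,i}$, and the dynamics is exactly that of the standard Husain–Kuchař model, $\phi$ being Lie-dragged along $\xi$: $$Z_A^i=\pounds_\xi A^i+D(A_t^i-\xi\lrcorner A^i),\qquad Z_{H}^i=\pounds_\xi H^i-\varepsilon^{ijk}(A_{tj}-\xi\lrcorner A_j)H_k,$$ $$Z_{\widetilde H}^i=\pounds_\xi\widetilde H^i+(\mathrm{div}_0\xi)\widetilde H^i-\varepsilon^{ijk}(A_{tj}-\xi\lrcorner A_j)\widetilde H_k,\qquad Z_e^i=\pounds_\xi e^i-\varepsilon^{ijk}(A_{tj}-\xi\lrcorner A_j)e_k,\qquad Z_\phi=\xi\lrcorner d\phi=\pounds_\xi\phi .$$ -/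

import Mathlib

open scoped Manifold ContDiff Topology

noncomputable section

namespace HK

/-! # Tensor calculus on a smooth 3-manifold -/

/-- The model space `ℝ³`.  For `x : M`, the tangent space `TangentSpace (𝓡 3) x` is, by definition
in Mathlib, a copy of `E3` (through the preferred chart at `x`). -/
abbrev E3 : Type := EuclideanSpace ℝ (Fin 3)

/-- Fields of alternating `k`-linear forms on the tangent spaces (no smoothness imposed). -/
abbrev Form (M : Type*) (k : ℕ) : Type _ := M → E3 [⋀^Fin k]→L[ℝ] ℝ

/-- Fields of tangent vectors (no smoothness imposed). -/
abbrev VF (M : Type*) : Type _ := M → E3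

/-- The standard basis of `ℝ³`. -/
def stdB : Fin 3 → E3 := fun a => EuclideanSpace.single a (1 : ℝ)

/-- The Levi-Civita symbol, with `ε₀₁₂ = 1`. -/
def eps (i j k : Fin 3) : ℝ :=
  (((j : ℕ) : ℝ) - ((i : ℕ) : ℝ)) * (((k : ℕ) : ℝ) - ((i : ℕ) : ℝ)) *
    (((k : ℕ) : ℝ) - ((j : ℕ) : ℝ)) / 2

/-- The Kronecker delta. -/
def kron (i j : Fin 3) : ℝ := if i = j then 1 else 0

section Pointwise

variable {M : Type*}

/-- Multiplication of a form by a function. -/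
def fmul {k : ℕ} (f : M → ℝ) (b : Form M k) : Form M k := fun x => f x • b x

/-- A 1-form evaluated on a vector field: `ξ ⌟ a`. -/
def ev (ξ : VF M) (a : Form M 1) : M → ℝ := fun x => a x (fun _ => ξ x)

/-- Interior product `ξ ⌟ b`, i.e. `b (ξ, ·, …, ·)`. -/
def inner1 {k : ℕ} (ξ : VF M) (b : Form M (k + 1)) : Form M k :=
  fun x => (b x).curryLeft (ξ x)

/-- Exterior product `a ∧ b` of a 1-form with a `k`-form,
`(a ∧ b)(v₀,…,v_k) = ∑ᵢ (-1)ⁱ a(vᵢ) b(v₀,…,v̂ᵢ,…,v_k)`.  As `b ∧ a = a ∧ b` for a 2-form `b` and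
a 1-form `a`, these are all the products that occur on a 3-manifold. -/
def wedge {k : ℕ} (a : Form M 1) (b : Form M k) : Form M (k + 1) := fun x =>
  ContinuousAlternatingMap.alternatizeUncurryFin
    ((((ContinuousAlternatingMap.ofSubsingleton ℝ E3 ℝ (0 : Fin 1)).symm (a x) :
      E3 →L[ℝ] ℝ)).smulRight (b x))

/-- The function `(β / vol)` with `β = (β / vol) vol`, for top forms `β` and `vol` with `vol`
nowhere zero. -/
def ratio (b vol : Form M 3) : M → ℝ := fun x => b x stdB / vol x stdB

/-- The field of tangent vectors `(· ∧ B / vol)` defined by duality from a 2-form `B`: the one on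
which every 1-form `θ` takes the value `(θ ∧ B / vol)`.  Its components are obtained by inserting
the elements of the dual basis of `stdB` for `θ`. -/
def dualVec (vol : Form M 3) (B : Form M 2) : VF M := fun x =>
  ∑ a : Fin 3,
    ratio (wedge (fun _ => ContinuousAlternatingMap.ofSubsingleton ℝ E3 ℝ (0 : Fin 1)
      (EuclideanSpace.proj a : E3 →L[ℝ] ℝ)) B) vol x • stdB a

end Pointwise

section Calculus

variable {M : Type*} [TopologicalSpace M] [ChartedSpace E3 M]

/-- Derivative of the inverse of the chart at `c`, at the point `y` of the chart domain in `ℝ³`. -/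
def chartInvD (c : M) (y : E3) : E3 →L[ℝ] E3 :=
  (mfderiv 𝓘(ℝ, E3) (𝓡 3) (extChartAt (𝓡 3) c).symm y : _)

/-- Derivative of the chart at `c`, at the point `x` of `M`. -/
def chartD (c x : M) : E3 →L[ℝ] E3 :=
  (mfderiv (𝓡 3) 𝓘(ℝ, E3) (extChartAt (𝓡 3) c) x : _)

/-- The expression of a form in the chart at `c`: its pullback by the inverse of the chart. -/
def chartForm {k : ℕ} (c : M) (b : Form M k) : E3 → E3 [⋀^Fin k]→L[ℝ] ℝ := fun y =>
  (b ((extChartAt (𝓡 3) c).symm y)).compContinuousLinearMap (chartInvD c y)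

/-- The expression of a field of vectors in the chart at `c`. -/
def chartVF (c : M) (ξ : VF M) : E3 → E3 := fun y =>
  chartD c ((extChartAt (𝓡 3) c).symm y) (ξ ((extChartAt (𝓡 3) c).symm y))

/-- Smooth functions. -/
def SmoothFun (f : M → ℝ) : Prop := ContMDiff (𝓡 3) 𝓘(ℝ, ℝ) ∞ f

/-- Smooth differential forms: smooth in every chart of the (preferred) atlas. -/
def SmoothForm {k : ℕ} (b : Form M k) : Prop :=
  ∀ c : M, ContDiffOn ℝ ∞ (chartForm c b) (extChartAt (𝓡 3) c).target

/-- Smooth vector fields: smooth in every chart of the (preferred) atlas. -/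
def SmoothVF (ξ : VF M) : Prop :=
  ∀ c : M, ContDiffOn ℝ ∞ (chartVF c ξ) (extChartAt (𝓡 3) c).target

/-- The differential of a function. -/
def dFun (f : M → ℝ) : Form M 1 := fun x =>
  ContinuousAlternatingMap.ofSubsingleton ℝ E3 ℝ (0 : Fin 1)
    (mfderiv (𝓡 3) 𝓘(ℝ, ℝ) f x : E3 →L[ℝ] ℝ)

/-- The exterior differential of a form, computed at `x` in the chart at `x`. -/
def extD {k : ℕ} (b : Form M k) : Form M (k + 1) := fun x =>
  (extDeriv (chartForm x b) (extChartAt (𝓡 3) x x)).compContinuousLinearMap (chartD x x)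

/-- The Lie derivative of a form along a vector field, computed at `x` in the chart at `x`:
in coordinates it is `d/ds` at `s = 0` of the pullback of the form by `y ↦ y + s ξ(y)`, a map that
agrees to first order in `s` with the flow of `ξ`. -/
def lieForm {k : ℕ} (ξ : VF M) (b : Form M k) : Form M k := fun x =>
  (deriv (fun s : ℝ =>
    (chartForm x b (extChartAt (𝓡 3) x x + s • chartVF x ξ (extChartAt (𝓡 3) x x))
      ).compContinuousLinearMap
        (ContinuousLinearMap.id ℝ E3 + s • fderiv ℝ (chartVF x ξ) (extChartAt (𝓡 3) x x)))
    0).compContinuousLinearMap (chartD x x)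

/-- The Lie derivative of a vector field along a vector field (the Lie bracket `[ξ, X]`). -/
def lieVF (ξ X : VF M) : VF M := fun x =>
  (VectorField.mlieBracket (𝓡 3) ξ X x : _)

/-- The divergence of a vector field with respect to a volume form: `d (X ⌟ vol) = (div X) vol`. -/
def divergence (vol : Form M 3) (X : VF M) : M → ℝ := ratio (extD (inner1 X vol)) vol

end Calculus

section Integral

variable {M : Type*} [TopologicalSpace M] [ChartedSpace E3 M] [T2Space M] [CompactSpace M]
  [IsManifold (𝓡 3) ∞ M]

/-- A smooth partition of unity subordinate to the family of chart domains. -/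
def chartPartition (M : Type*) [TopologicalSpace M] [ChartedSpace E3 M] [T2Space M]
    [CompactSpace M] [IsManifold (𝓡 3) ∞ M] : SmoothPartitionOfUnity M (𝓡 3) M Set.univ :=
  Classical.choose (SmoothPartitionOfUnity.exists_isSubordinate_chartAt_source (𝓡 3) M)

/-- The integral over `M` of a 3-form, for the orientation determined by the volume form `vol`:
`∑_c ∫ ρ_c β`, each term being computed in the chart at `c`, with the sign that tells whether that
chart is positively oriented. -/
def integral (vol b : Form M 3) : ℝ :=
  ∑ᶠ c : M, ∫ y in (extChartAt (𝓡 3) c).target,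
    chartPartition M c ((extChartAt (𝓡 3) c).symm y) *
      ((SignType.sign (chartForm c vol y stdB) : ℝ) * chartForm c b y stdB)

end Integral

section Internal

variable {M : Type*} [TopologicalSpace M] [ChartedSpace E3 M]

/-! ## Fields with an internal `SO(3)` index -/

/-- `F_i = dA_i + ½ ε_{ijk} A^j ∧ A^k`. -/
def curv (A : Fin 3 → Form M 1) (i : Fin 3) : Form M 2 :=
  extD (A i) + (1 / 2 : ℝ) • ∑ j, ∑ k, eps i j k • wedge (A j) (A k)

/-- `DΛ_i = dΛ_i + ε_{ijk} A^j Λ^k` for functions `Λ_i`. -/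
def covFun (A : Fin 3 → Form M 1) (L : Fin 3 → M → ℝ) (i : Fin 3) : Form M 1 :=
  dFun (L i) + ∑ j, ∑ k, eps i j k • fmul (L k) (A j)

/-- `Dβ_i = dβ_i + ε_{ijk} A^j ∧ β^k` for forms `β_i` of positive degree. -/
def cov {n : ℕ} (A : Fin 3 → Form M 1) (b : Fin 3 → Form M n) (i : Fin 3) : Form M (n + 1) :=
  extD (b i) + ∑ j, ∑ k, eps i j k • wedge (A j) (b k)

/-- `½ ε_{ijk} e^j ∧ e^k`. -/
def dual2 (e : Fin 3 → Form M 1) (i : Fin 3) : Form M 2 :=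
  (1 / 2 : ℝ) • ∑ j, ∑ k, eps i j k • wedge (e j) (e k)

/-- `vol_e = (1/3!) ε_{ijk} e^i ∧ e^j ∧ e^k`. -/
def volOf (e : Fin 3 → Form M 1) : Form M 3 :=
  (1 / 6 : ℝ) • ∑ i, ∑ j, ∑ k, eps i j k • wedge (e i) (wedge (e j) (e k))

/-- The matrix `(F_i ∧ e_j / vol_e)` of a triple of 2-forms in a coframe. -/
def matOf (F : Fin 3 → Form M 2) (e : Fin 3 → Form M 1) (i j : Fin 3) : M → ℝ :=
  ratio (wedge (e j) (F i)) (volOf e)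

/-- The trace of the matrix of the curvature of `A` in the coframe `e`. -/
def curvTrace (A e : Fin 3 → Form M 1) : M → ℝ := fun x => ∑ i, matOf (curv A) e i i x

/-! ## The fields of the extended Husain–Kuchař model -/

/-- `H_i = ½ ε_{ijk} e^j ∧ e^k + e_i ∧ dφ`. -/
def HForm (e : Fin 3 → Form M 1) (φ : M → ℝ) (i : Fin 3) : Form M 2 :=
  dual2 e i + wedge (e i) (dFun φ)

/-- `π = - e_i ∧ F^i`. -/
def piForm (e A : Fin 3 → Form M 1) : Form M 3 := - ∑ i, wedge (e i) (curv A i)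

/-- The coefficients `α_i` in `dφ = α_i e^i`, for a coframe `e`. -/
def alpha (e : Fin 3 → Form M 1) (φ : M → ℝ) (i : Fin 3) : M → ℝ :=
  ratio (wedge (dFun φ) (dual2 e i)) (volOf e)

/-- `α² = α_i α^i`. -/
def alphaSq (e : Fin 3 → Form M 1) (φ : M → ℝ) : M → ℝ := fun x => ∑ i, alpha e φ i x ^ 2

/-- The auxiliary triad
`h^i = (1 + α²)^{-1/2} (δ^i_k + α^i α_k + ε^{ij}_k α_j) e^k`. -/
def hTriad (e : Fin 3 → Form M 1) (φ : M → ℝ) (i : Fin 3) : Form M 1 := fun x =>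
  (Real.sqrt (1 + alphaSq e φ x))⁻¹ •
    ∑ k, (kron i k + alpha e φ i x * alpha e φ k x + ∑ j, eps i j k * alpha e φ j x) • e k x

/-- The redefined shift
`ê_i = (e_{t i} + Z_φ α_i - ε_{ijk} e_t^j α^k) / √(1 + α²)`. -/
def shiftHat (et : Fin 3 → M → ℝ) (e : Fin 3 → Form M 1) (φ Zφ : M → ℝ) (i : Fin 3) :
    M → ℝ := fun x =>
  (et i x + Zφ x * alpha e φ i x - ∑ j, ∑ k, eps i j k * et j x * alpha e φ k x) /
    Real.sqrt (1 + alphaSq e φ x)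

/-- `e_t · α`. -/
def etAlpha (et : Fin 3 → M → ℝ) (e : Fin 3 → Form M 1) (φ : M → ℝ) : M → ℝ := fun x =>
  ∑ i, et i x * alpha e φ i x

/-- The redefined lapse `α̂ = (Z_φ - e_t · α) / √(1 + α²)`. -/
def lapseHat (et : Fin 3 → M → ℝ) (e : Fin 3 → Form M 1) (φ Zφ : M → ℝ) : M → ℝ := fun x =>
  (Zφ x - etAlpha et e φ x) / Real.sqrt (1 + alphaSq e φ x)

/-! ## Reference dynamics -/

/-- Evolution of the connection in Euclidean general relativity (Ashtekar formulation), for a triad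
`h`, connection `A`, Lagrange multiplier `At`, lapse `N` and internal components `ν` of the shift:
`DA_t^i - N F^{ij} h_j + F^i_j h_k ε^{kjl} ν_l`, with `F_{ij}` the matrix of the curvature
in the triad `h`. -/
def grConn (h A : Fin 3 → Form M 1) (At : Fin 3 → M → ℝ) (N : M → ℝ) (ν : Fin 3 → M → ℝ)
    (i : Fin 3) : Form M 1 :=
  covFun A At i - (∑ j, fmul (fun x => N x * matOf (curv A) h i j x) (h j))
    + ∑ j, ∑ k, ∑ l, eps k j l • fmul (fun x => matOf (curv A) h i j x * ν l x) (h k)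

/-- Evolution of the densitized triad, as the 2-forms `H_i = ½ ε_{ijk} h^j ∧ h^k`, in Euclidean
general relativity:
`D(ε_{ijk} ν^j h^k) - D(N h_i) - ε_{ijk} A_t^j H^k`. -/
def grFlux (h A : Fin 3 → Form M 1) (At : Fin 3 → M → ℝ) (N : M → ℝ) (ν : Fin 3 → M → ℝ)
    (i : Fin 3) : Form M 2 :=
  cov A (fun i => ∑ j, ∑ k, eps i j k • fmul (ν j) (h k)) i - cov A (fun i => fmul N (h i)) i
    - ∑ j, ∑ k, eps i j k • fmul (At j) (dual2 h k)

/-- The term by which the evolution of the connection in the extended model differs from that of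
Euclidean general relativity:
`N ᶠF (-ε^{ijk} α_j + ½ (1 - α²) δ^{ik} + α^i α^k) h_k`, `ᶠF` the trace of the curvature matrix. -/
def extraConn (e A : Fin 3 → Form M 1) (φ N : M → ℝ) (i : Fin 3) : Form M 1 := fun x =>
  ∑ k, (N x * curvTrace A (hTriad e φ) x *
    (-(∑ j, eps i j k * alpha e φ j x) + (1 / 2) * (1 - alphaSq e φ x) * kron i k
      + alpha e φ i x * alpha e φ k x)) • hTriad e φ k x

/-- `A_t^i - ξ ⌟ A^i`. -/
def gaugePar (ξ : VF M) (A : Fin 3 → Form M 1) (At : Fin 3 → M → ℝ) (i : Fin 3) : M → ℝ :=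
  fun x => At i x - ev ξ (A i) x

/-- Evolution of the connection in the standard Husain–Kuchař model:
`£_ξ A^i + D(A_t^i - ξ ⌟ A^i)`. -/
def hkConn (ξ : VF M) (A : Fin 3 → Form M 1) (At : Fin 3 → M → ℝ) (i : Fin 3) : Form M 1 :=
  lieForm ξ (A i) + covFun A (gaugePar ξ A At) i

/-- Evolution in the standard Husain–Kuchař model of a triple of forms (the triad `e^i`, or the
2-forms `½ ε_{ijk} e^j ∧ e^k`):
`£_ξ B_i - ε_{ijk} (A_t^j - ξ ⌟ A^j) B^k`. -/
def hkForm {n : ℕ} (ξ : VF M) (A : Fin 3 → Form M 1) (At : Fin 3 → M → ℝ)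
    (B : Fin 3 → Form M n) (i : Fin 3) : Form M n :=
  lieForm ξ (B i) - ∑ j, ∑ k, eps i j k • fmul (gaugePar ξ A At j) (B k)

/-- Evolution in the standard Husain–Kuchař model of the vector fields dual to those 2-forms:
`£_ξ X_i + (div₀ ξ) X_i - ε_{ijk} (A_t^j - ξ ⌟ A^j) X^k`. -/
def hkVec (vol : Form M 3) (ξ : VF M) (A : Fin 3 → Form M 1) (At : Fin 3 → M → ℝ)
    (X : Fin 3 → VF M) (i : Fin 3) : VF M := fun x =>
  lieVF ξ (X i) x + divergence vol ξ x • X i x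
    - ∑ j, ∑ k, (eps i j k * gaugePar ξ A At j x) • X k x

end Internal

/-! # The presymplectic description -/

/-- The fields `(e_t, e, A_t, A, φ)`; also the components of tangent vectors
`(Y_{e_t}, Y_e, Y_{A_t}, Y_A, Y_φ)`. -/
structure Fields (M : Type*) where
  et : Fin 3 → M → ℝ
  e : Fin 3 → Form M 1
  At : Fin 3 → M → ℝ
  A : Fin 3 → Form M 1
  φ : M → ℝ

/-- The fields `(e_t, H̃, A_t, A, φ, π̃)`; also the components of tangent vectors. -/
structure CanFields (M : Type*) where
  et : Fin 3 → M → ℝ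
  Ht : Fin 3 → VF M
  At : Fin 3 → M → ℝ
  A : Fin 3 → Form M 1
  φ : M → ℝ
  pit : M → ℝ

/-- The point `q + s Y`. -/
def Fields.move {M : Type*} (q Y : Fields M) (s : ℝ) : Fields M where
  et := fun i x => q.et i x + s * Y.et i x
  e := fun i x => q.e i x + s • Y.e i x
  At := fun i x => q.At i x + s * Y.At i x
  A := fun i x => q.A i x + s • Y.A i x
  φ := fun x => q.φ x + s * Y.φ x

/-- The variation at `q` along `Y` of an object built from the fields: the derivative at `s = 0` of
its values on `q + s Y`. -/
def vary {M V : Type*} [NormedAddCommGroup V] [NormedSpace ℝ V] (G : Fields M → M → V)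
    (q Y : Fields M) : M → V := fun x => deriv (fun s : ℝ => G (q.move Y s) x) 0

section Presymplectic

variable {M : Type*} [TopologicalSpace M] [ChartedSpace E3 M]

/-- Smooth tuples of fields: the tangent vectors to the space of fields. -/
structure Fields.Smooth (q : Fields M) : Prop where
  et : ∀ i, SmoothFun (q.et i)
  e : ∀ i, SmoothForm (q.e i)
  At : ∀ i, SmoothFun (q.At i)
  A : ∀ i, SmoothForm (q.A i)
  φ : SmoothFun q.φ

/-- The space `Γ̃` of smooth `(e_t, H̃, A_t, A, φ, π̃)`. -/
structure CanFields.Smooth (c : CanFields M) : Prop where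
  et : ∀ i, SmoothFun (c.et i)
  Ht : ∀ i, SmoothVF (c.Ht i)
  At : ∀ i, SmoothFun (c.At i)
  A : ∀ i, SmoothForm (c.A i)
  φ : SmoothFun c.φ
  pit : SmoothFun c.pit

/-- The space `M₀` of smooth fields with `det e = (vol_e / vol₀) > 0`
(so that `e` is a coframe). -/
def M0 (vol0 : Form M 3) : Set (Fields M) :=
  {q | q.Smooth ∧ ∀ x, 0 < ratio (volOf q.e) vol0 x}

/-- The secondary constraint `ε_{ijk} e^j ∧ F^k + dφ ∧ F_i = 0`. -/
def SecondaryF (q : Fields M) : Prop :=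
  ∀ i, (∑ j, ∑ k, eps i j k • wedge (q.e j) (curv q.A k)) + wedge (dFun q.φ) (curv q.A i) = 0

/-- The secondary constraint `ε_{ijk} e^j ∧ De^k - dφ ∧ De_i = 0`. -/
def SecondaryT (q : Fields M) : Prop :=
  ∀ i, (∑ j, ∑ k, eps i j k • wedge (q.e j) (cov q.A q.e k))
    - wedge (dFun q.φ) (cov q.A q.e i) = 0

/-- The vector fields `H̃_i = (· ∧ H_i / vol₀)`. -/
def HTilde (vol0 : Form M 3) (i : Fin 3) (q : Fields M) : VF M := dualVec vol0 (HForm q.e q.φ i)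

/-- The function `π̃ = (π / vol₀)`. -/
def piTilde (vol0 : Form M 3) (q : Fields M) : M → ℝ := ratio (piForm q.e q.A) vol0

/-- The map `J : (e_t, e, A_t, A, φ) ↦ (e_t, H̃, A_t, A, φ, π̃)`. -/
def J (vol0 : Form M 3) (q : Fields M) : CanFields M where
  et := q.et
  Ht := fun i => HTilde vol0 i q
  At := q.At
  A := q.A
  φ := q.φ
  pit := piTilde vol0 q

/-- The tangent map of `J` at `q`. -/
def TJ (vol0 : Form M 3) (q Y : Fields M) : CanFields M where
  et := fun i => vary (fun p => (J vol0 p).et i) q Y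
  Ht := fun i => vary (fun p => (J vol0 p).Ht i) q Y
  At := fun i => vary (fun p => (J vol0 p).At i) q Y
  A := fun i => vary (fun p => (J vol0 p).A i) q Y
  φ := vary (fun p => (J vol0 p).φ) q Y
  pit := vary (fun p => (J vol0 p).pit) q Y

/-! ## The constraints in the variables of `Γ̃` -/

/-- `(det h)² = -(1/3!) ε^{ijk} H̃_i ⌟ H̃_j ⌟ H̃_k ⌟ vol₀`. -/
def detHSq (vol0 : Form M 3) (X : Fin 3 → VF M) : M → ℝ := fun x =>
  -((1 / 6) * ∑ i, ∑ j, ∑ k, eps i j k * ev (X i) (inner1 (X j) (inner1 (X k) vol0)) x)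

/-- The triad written in terms of `H̃`:
`h_i = -(1 / (2 det h)) ε_{ijk} H̃^j ⌟ H̃^k ⌟ vol₀`. -/
def triadOfHt (vol0 : Form M 3) (X : Fin 3 → VF M) (i : Fin 3) : Form M 1 := fun x =>
  (-(1 / (2 * Real.sqrt (detHSq vol0 X x)))) •
    ∑ j, ∑ k, eps i j k • inner1 (X j) (inner1 (X k) vol0) x

/-- Scalar constraint:
`2 π̃ - ((det h)² - (H̃_l ⌟ dφ)(H̃^l ⌟ dφ))^{-1/2} ε^{ijk} H̃_i ⌟ H̃_j ⌟ F_k = 0`. -/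
def ScalarConstraint (vol0 : Form M 3) (c : CanFields M) : Prop :=
  ∀ x, 2 * c.pit x
    - (Real.sqrt (detHSq vol0 c.Ht x - ∑ l, ev (c.Ht l) (dFun c.φ) x ^ 2))⁻¹ *
      (∑ i, ∑ j, ∑ k, eps i j k * ev (c.Ht i) (inner1 (c.Ht j) (curv c.A k)) x) = 0

/-- Vector constraint: `H̃_i ⌟ F^i - π̃ dφ = 0`. -/
def VectorConstraint (c : CanFields M) : Prop :=
  (∑ i, inner1 (c.Ht i) (curv c.A i)) - fmul c.pit (dFun c.φ) = 0

/-- Gauss constraint: `div₀ H̃^i + ε^{ijk} H̃_k ⌟ A_j = 0`. -/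
def GaussConstraint (vol0 : Form M 3) (c : CanFields M) : Prop :=
  ∀ i x, divergence vol0 (c.Ht i) x + ∑ j, ∑ k, eps i j k * ev (c.Ht k) (c.A j) x = 0

/-! ## Presymplectic forms and Hamiltonian vectors -/

variable [T2Space M] [CompactSpace M] [IsManifold (𝓡 3) ∞ M]

/-- The momenta `(p_A, p_φ)` of the points of the primary constraint submanifold, as a linear form
in the velocities: `p(W) = ∫ (H_i ∧ W_A^i - (e_i ∧ F^i) W_φ)`. -/
def momentum (vol0 : Form M 3) (q W : Fields M) : ℝ :=
  integral vol0 ((∑ i, wedge (W.A i) (HForm q.e q.φ i)) + fmul W.φ (piForm q.e q.A))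

/-- The presymplectic form `ω` on `M₀`: the pullback of the canonical symplectic form
`Ω(Z, Y) = Y_p(Z) - Z_p(Y)`, where `Y_p` is the variation of the momenta along `Y`. -/
def omega (vol0 : Form M 3) (q Z Y : Fields M) : ℝ :=
  deriv (fun s : ℝ => momentum vol0 (q.move Y s) Z) 0
    - deriv (fun s : ℝ => momentum vol0 (q.move Z s) Y) 0

/-- The Hamiltonian
`- ∫ (A_t^i D(½ ε_{ijk} e^j ∧ e^k + e_i ∧ dφ) + e_t^i (ε_{ijk} e^j ∧ F^k + F_i ∧ dφ))`. -/
def hamiltonian (vol0 : Form M 3) (q : Fields M) : ℝ :=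
  - integral vol0 (∑ i, (fmul (q.At i) (cov q.A (HForm q.e q.φ) i)
      + fmul (q.et i) ((∑ j, ∑ k, eps i j k • wedge (q.e j) (curv q.A k))
          + wedge (dFun q.φ) (curv q.A i))))

/-- `Z` solves the Hamilton (Gotay–Nester–Hinds) equation `ι_Z ω = dH` at `q`. -/
def IsHamiltonianAt (vol0 : Form M 3) (q Z : Fields M) : Prop :=
  ∀ Y : Fields M, Y.Smooth →
    omega vol0 q Z Y = deriv (fun s : ℝ => hamiltonian vol0 (q.move Y s)) 0

/-- The canonical form `∫ (dA^i ∧ dH̃_i + dφ ∧ dπ̃) vol₀` on `Γ̃`, evaluated on two tangent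
vectors. -/
def omegaCan (vol0 : Form M 3) (Z Y : CanFields M) : ℝ :=
  integral vol0 (fmul (fun x =>
    (∑ i, (ev (Y.Ht i) (Z.A i) x - ev (Z.Ht i) (Y.A i) x))
      + (Z.φ x * Y.pit x - Y.φ x * Z.pit x)) vol0)

/-- The expression
`∫ (Y_e^i ∧ (ε_{ijk} e^j ∧ Z_A^k + dφ ∧ Z_{A i} - F_i Z_φ)
  + Y_A^i ∧ (-ε_{ijk} e^j ∧ Z_e^k + dφ ∧ Z_{e i} - Z_φ De_i)
  + Y_φ (F_i ∧ Z_e^i + De_i ∧ Z_A^i))`. -/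
def omegaExpanded (vol0 : Form M 3) (q Z Y : Fields M) : ℝ :=
  integral vol0
    ((∑ i, wedge (Y.e i) ((∑ j, ∑ k, eps i j k • wedge (q.e j) (Z.A k))
        + wedge (dFun q.φ) (Z.A i) - fmul Z.φ (curv q.A i)))
      + (∑ i, wedge (Y.A i) (-(∑ j, ∑ k, eps i j k • wedge (q.e j) (Z.e k))
        + wedge (dFun q.φ) (Z.e i) - fmul Z.φ (cov q.A q.e i)))
      + fmul Y.φ (∑ i, (wedge (Z.e i) (curv q.A i) + wedge (Z.A i) (cov q.A q.e i))))

end Presymplectic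

end HK

end

open HK

set_option linter.unusedSectionVars false
set_option linter.unusedSimpArgs false

noncomputable section

namespace HK

/-! ### Components of forms and vectors in a frame -/

section

/-! At each point the problem is linear algebra in the frame dual to the coframe `e`, with one
parameter, the vector a of components of dφ. There H has the matrix δ_{im} + ε_{ijm} a_j
(`fluxMat`), whose determinant is 1 + a² and whose cofactor matrix is `triadMat`. The triad h is
`triadMat` divided by √(1 + a²), and its own cofactors give H back (`HForm_eq_dual2`). Hence h and
det h are functions of H̃. The coefficients of dφ in h are a/√(1 + a²), so h and dφ together recover
e (`coframe_eq`); this is why J is injective.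

The canonical form of ω is a pointwise identity of integrands (`omega_eq_omegaCan`). The expanded
form differs from it by an exact form (`varMom_sub`), which Stokes' theorem (`integral_extD`)
removes.

Write C_i for the 3-forms of (F). The vector constraint reads C_m/vol₀ + (π̃ - p) a_m = 0 and the
scalar constraint p - π̃ + a_i C_i/vol₀ = 0, so contracting the former with a and using the latter
leaves (p - π̃)(1 + a²) = 0. The Gauss constraint is (T) because DH is minus the 3-form of (T)
(`cov2_HForm`).

The Hamilton equation is governed by the pointwise operators w ↦ ε_{ijk} e^j ∧ w^k + s w_i ∧ dφ with
s = ±1 (`opL`), which have an explicit inverse with denominator 2(1 + a²). Testing against vectors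
with Y_φ = 0 built from the residuals of the equations gives an integral of squares, hence (F), (T)
and two algebraic equations, for Z_A and Z_e. The equation conjugate to Y_φ is then automatic: for
each function l there is a vector with φ-component l (`kernelVec`) in the kernel of ω, along which
dH vanishes on the constraint surface. Subtracting it from Y reduces everything to Y_φ = 0.
Existence and uniqueness follow from the invertibility of `opL`.

To reach the gravitational form, write F = opL(-1) w. Then (F) says that the matrix of w is
symmetric, and for symmetric w the source Z_φ F + e_t × F can be inverted in closed form
(`opMat_lapseMat`, `opMat_shift`). For H a single identity, `crossFun_shiftHat_sub`, suffices. The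
formulas with ξ are covariant versions of Cartan's formula. -/

abbrev Frame : Type := Module.Basis (Fin 3) ℝ E3

/-- Components of a 1-form in a frame. -/
def comp1 (v : Frame) (a : E3 [⋀^Fin 1]→L[ℝ] ℝ) (i : Fin 3) : ℝ := a (fun _ => v i)

/-- Components of a 2-form in a frame, labelled by the index missing from the pair. -/
def comp2 (v : Frame) (b : E3 [⋀^Fin 2]→L[ℝ] ℝ) (i : Fin 3) : ℝ := b ![v (i + 1), v (i + 2)]

/-- The component of a 3-form in a frame. -/
def comp3 (v : Frame) (b : E3 [⋀^Fin 3]→L[ℝ] ℝ) : ℝ := b v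

/-- The standard frame. -/
def stdFrame : Frame := (EuclideanSpace.basisFun (Fin 3) ℝ).toBasis

theorem stdFrame_apply (i : Fin 3) : stdFrame i = stdB i := by
  simp [stdFrame, stdB]

theorem coe_stdFrame : (stdFrame : Fin 3 → E3) = stdB := funext stdFrame_apply

section Linear
variable (v : Frame) (i : Fin 3)

@[simp] theorem comp1_add (a b : E3 [⋀^Fin 1]→L[ℝ] ℝ) :
    comp1 v (a + b) i = comp1 v a i + comp1 v b i := rfl
@[simp] theorem comp1_sub (a b : E3 [⋀^Fin 1]→L[ℝ] ℝ) :
    comp1 v (a - b) i = comp1 v a i - comp1 v b i := rfl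
@[simp] theorem comp1_zero : comp1 v 0 i = 0 := rfl
@[simp] theorem comp1_smul (c : ℝ) (a : E3 [⋀^Fin 1]→L[ℝ] ℝ) :
    comp1 v (c • a) i = c * comp1 v a i := rfl
@[simp] theorem comp1_sum {ι : Type*} (s : Finset ι) (a : ι → E3 [⋀^Fin 1]→L[ℝ] ℝ) :
    comp1 v (∑ k ∈ s, a k) i = ∑ k ∈ s, comp1 v (a k) i := by
  simp [comp1, ContinuousAlternatingMap.sum_apply]
@[simp] theorem comp2_add (a b : E3 [⋀^Fin 2]→L[ℝ] ℝ) :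
    comp2 v (a + b) i = comp2 v a i + comp2 v b i := rfl
@[simp] theorem comp2_sub (a b : E3 [⋀^Fin 2]→L[ℝ] ℝ) :
    comp2 v (a - b) i = comp2 v a i - comp2 v b i := rfl
@[simp] theorem comp2_neg (a : E3 [⋀^Fin 2]→L[ℝ] ℝ) : comp2 v (-a) i = -comp2 v a i := rfl
@[simp] theorem comp2_zero : comp2 v 0 i = 0 := rfl
@[simp] theorem comp2_smul (c : ℝ) (a : E3 [⋀^Fin 2]→L[ℝ] ℝ) :
    comp2 v (c • a) i = c * comp2 v a i := rfl
@[simp] theorem comp2_sum {ι : Type*} (s : Finset ι) (a : ι → E3 [⋀^Fin 2]→L[ℝ] ℝ) :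
    comp2 v (∑ k ∈ s, a k) i = ∑ k ∈ s, comp2 v (a k) i := by
  simp [comp2, ContinuousAlternatingMap.sum_apply]
@[simp] theorem comp3_add (a b : E3 [⋀^Fin 3]→L[ℝ] ℝ) :
    comp3 v (a + b) = comp3 v a + comp3 v b := rfl
@[simp] theorem comp3_sub (a b : E3 [⋀^Fin 3]→L[ℝ] ℝ) :
    comp3 v (a - b) = comp3 v a - comp3 v b := rfl
@[simp] theorem comp3_neg (a : E3 [⋀^Fin 3]→L[ℝ] ℝ) : comp3 v (-a) = -comp3 v a := rfl
@[simp] theorem comp3_zero : comp3 v 0 = 0 := rfl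
@[simp] theorem comp3_smul (c : ℝ) (a : E3 [⋀^Fin 3]→L[ℝ] ℝ) :
    comp3 v (c • a) = c * comp3 v a := rfl
@[simp] theorem comp3_sum {ι : Type*} (s : Finset ι) (a : ι → E3 [⋀^Fin 3]→L[ℝ] ℝ) :
    comp3 v (∑ k ∈ s, a k) = ∑ k ∈ s, comp3 v (a k) := by
  simp [comp3, ContinuousAlternatingMap.sum_apply]

end Linear

theorem form_apply_eq_comp1 (v : Frame) (a : E3 [⋀^Fin 1]→L[ℝ] ℝ) (w : Fin 1 → E3) :
    a w = ∑ i, v.repr (w 0) i * comp1 v a i := by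
  have h : ∀ u : E3, a (fun _ => u) =
      (ContinuousAlternatingMap.ofSubsingleton ℝ E3 ℝ (0 : Fin 1)).symm a u := fun u => by
    simp [ContinuousAlternatingMap.ofSubsingleton]
  have hw : w = fun _ => w 0 := by ext j; fin_cases j; rfl
  rw [hw]
  simp only [comp1]
  rw [h]
  simp_rw [h (v _)]
  conv_lhs => rw [← v.sum_repr (w 0)]
  simp only [map_sum, map_smul, smul_eq_mul]

theorem ext_comp1 (v : Frame) {a b : E3 [⋀^Fin 1]→L[ℝ] ℝ} (h : ∀ i, comp1 v a i = comp1 v b i) :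
    a = b := by
  ext w
  rw [form_apply_eq_comp1 v, form_apply_eq_comp1 v]
  simp [h]

theorem comp2_antisymm (v : Frame) (b : E3 [⋀^Fin 2]→L[ℝ] ℝ) (i j : Fin 3) :
    b ![v i, v j] = -b ![v j, v i] := by
  have := b.toAlternatingMap.map_swap ![v j, v i] (i := 0) (j := 1) (by decide)
  rw [← ContinuousAlternatingMap.coe_toAlternatingMap, ← this]
  congr 1
  ext k; fin_cases k <;> simp

theorem ext_comp2 (v : Frame) {a b : E3 [⋀^Fin 2]→L[ℝ] ℝ} (h : ∀ i, comp2 v a i = comp2 v b i) :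
    a = b := by
  apply ContinuousAlternatingMap.toAlternatingMap_injective
  apply Module.Basis.ext_alternating v
  intro w hw
  have key : ∀ i j : Fin 3, i ≠ j → a ![v i, v j] = b ![v i, v j] := by
    have h0 := h 0
    have h1 := h 1
    have h2 := h 2
    simp only [comp2, Fin.isValue, Fin.reduceAdd] at h0 h1 h2
    intro i j hij
    fin_cases i <;> fin_cases j <;> simp at hij ⊢
    · exact h2
    · rw [comp2_antisymm v a, comp2_antisymm v b]; exact congrArg _ h1
    · rw [comp2_antisymm v a, comp2_antisymm v b]; exact congrArg _ h2
    · exact h0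
    · exact h1
    · rw [comp2_antisymm v a, comp2_antisymm v b]; exact congrArg _ h0
  have hne : w 0 ≠ w 1 := fun e => by simpa using hw e
  have e : (fun i => v (w i)) = ![v (w 0), v (w 1)] := by ext k; fin_cases k <;> rfl
  simpa [e] using key _ _ hne

theorem form3_apply (v : Frame) (b : E3 [⋀^Fin 3]→L[ℝ] ℝ) (w : Fin 3 → E3) :
    b w = comp3 v b * v.det w := by
  have := AlternatingMap.eq_smul_basis_det v b.toAlternatingMap
  have h := congrArg (fun f => f w) this
  simpa [comp3] using h

theorem ext_comp3 (v : Frame) {a b : E3 [⋀^Fin 3]→L[ℝ] ℝ} (h : comp3 v a = comp3 v b) : a = b := by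
  ext w
  rw [form3_apply v a, form3_apply v b, h]

theorem comp3_ne_zero (v : Frame) {b : E3 [⋀^Fin 3]→L[ℝ] ℝ} (h : b ≠ 0) : comp3 v b ≠ 0 :=
  fun h0 => h (ext_comp3 v h0)

section Fields
variable {M : Type*} (v : Frame) (x : M)

/-- Changing the frame multiplies all 3-forms by the same determinant, so a quotient of top forms
can be computed in whichever frame suits, most often the one dual to `e`. -/
theorem ratio_eq (b vol : Form M 3) : ratio b vol x = comp3 v (b x) / comp3 v (vol x) := by
  have hd : v.det stdB ≠ 0 := by
    rw [← coe_stdFrame]; exact (v.isUnit_det stdFrame).ne_zero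
  rw [ratio, form3_apply v, form3_apply v (vol x), mul_div_mul_right _ _ hd]

theorem comp1_fmul (f : M → ℝ) (b : Form M 1) (i : Fin 3) :
    comp1 v (fmul f b x) i = f x * comp1 v (b x) i := rfl
theorem comp2_fmul (f : M → ℝ) (b : Form M 2) (i : Fin 3) :
    comp2 v (fmul f b x) i = f x * comp2 v (b x) i := rfl
theorem comp3_fmul (f : M → ℝ) (b : Form M 3) :
    comp3 v (fmul f b x) = f x * comp3 v (b x) := rfl

theorem wedge_apply {k : ℕ} (a : Form M 1) (b : Form M k) (w : Fin (k + 1) → E3) :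
    wedge a b x w = ∑ i : Fin (k + 1), (-1) ^ (i : ℕ) * (a x (fun _ => w i) * b x (i.removeNth w)) := by
  simp only [wedge, ContinuousAlternatingMap.alternatizeUncurryFin_apply]
  refine Finset.sum_congr rfl fun i _ => ?_
  have : (ContinuousAlternatingMap.ofSubsingleton ℝ E3 ℝ (0 : Fin 1)).symm (a x) (w i)
      = a x (fun _ => w i) := by
    simp [ContinuousAlternatingMap.ofSubsingleton]
  simp [this]

/-- Indices live in `Fin 3`, so `i + 1` and `i + 2` are taken mod 3. With 2-forms labelled by the
missing index, the product of two 1-forms is a cross product of components and that of a 1-form with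
a 2-form is a dot product, with no signs to track. -/
theorem comp2_wedge (a b : Form M 1) (i : Fin 3) :
    comp2 v (wedge a b x) i = comp1 v (a x) (i + 1) * comp1 v (b x) (i + 2)
      - comp1 v (a x) (i + 2) * comp1 v (b x) (i + 1) := by
  rw [comp2, wedge_apply, Fin.sum_univ_two]
  have e0 : (Fin.removeNth (0 : Fin 2) ![v (i + 1), v (i + 2)]) = fun _ => v (i + 2) := by
    ext k; fin_cases k; rfl
  have e1 : (Fin.removeNth (1 : Fin 2) ![v (i + 1), v (i + 2)]) = fun _ => v (i + 1) := by
    ext k; fin_cases k; rfl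
  rw [e0, e1]
  simp [comp1]
  ring

theorem comp3_wedge (a : Form M 1) (b : Form M 2) :
    comp3 v (wedge a b x) = ∑ i, comp1 v (a x) i * comp2 v (b x) i := by
  rw [comp3, wedge_apply, Fin.sum_univ_three, Fin.sum_univ_three]
  have e0 : (Fin.removeNth (0 : Fin 3) (v : Fin 3 → E3)) = ![v 1, v 2] := by
    ext k; fin_cases k <;> rfl
  have e1 : (Fin.removeNth (1 : Fin 3) (v : Fin 3 → E3)) = ![v 0, v 2] := by
    ext k; fin_cases k <;> rfl
  have e2 : (Fin.removeNth (2 : Fin 3) (v : Fin 3 → E3)) = ![v 0, v 1] := by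
    ext k; fin_cases k <;> rfl
  rw [e0, e1, e2, comp2_antisymm v _ 0 2]
  simp [comp1, comp2]

theorem ev_eq (ξ : VF M) (a : Form M 1) : ev ξ a x = ∑ i, v.repr (ξ x) i * comp1 v (a x) i :=
  form_apply_eq_comp1 v _ _

theorem inner1_apply {k : ℕ} (ξ : VF M) (b : Form M (k + 1)) (w : Fin k → E3) :
    inner1 ξ b x w = b x (Matrix.vecCons (ξ x) w) := rfl

theorem inner1_expand {k : ℕ} (ξ : VF M) (b : Form M (k + 1)) :
    inner1 ξ b x = ∑ i, v.repr (ξ x) i • (b x).curryLeft (v i) := by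
  have : inner1 ξ b x = ContinuousAlternatingMap.curryLeft (b x) (ξ x) := rfl
  rw [this]
  conv_lhs => rw [← v.sum_repr (ξ x)]
  rw [map_sum]
  simp only [map_smul]

theorem comp1_inner1 (ξ : VF M) (b : Form M 2) (i : Fin 3) :
    comp1 v (inner1 ξ b x) i = v.repr (ξ x) (i + 2) * comp2 v (b x) (i + 1)
      - v.repr (ξ x) (i + 1) * comp2 v (b x) (i + 2) := by
  rw [inner1_expand v, comp1_sum]
  have e : ∀ j, comp1 v ((b x).curryLeft (v j)) i = b x ![v j, v i] := fun j => by
    simp only [comp1, ContinuousAlternatingMap.curryLeft_apply_apply]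
    congr 1; ext k; fin_cases k <;> rfl
  have e0 : ∀ j, b x ![v j, v j] = 0 := fun j => by
    have := comp2_antisymm v (b x) j j; linarith
  simp only [comp1_smul, e, Fin.sum_univ_three]
  fin_cases i <;> simp [comp2, e0]
  · rw [comp2_antisymm v _ 1 0]; ring
  · rw [comp2_antisymm v _ 2 1]; ring
  · rw [comp2_antisymm v _ 0 2]; ring

theorem comp2_inner1 (ξ : VF M) (b : Form M 3) (i : Fin 3) :
    comp2 v (inner1 ξ b x) i = v.repr (ξ x) i * comp3 v (b x) := by
  rw [inner1_expand v, comp2_sum]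
  have e : ∀ j, comp2 v ((b x).curryLeft (v j)) i
      = comp3 v (b x) * v.det ![v j, v (i + 1), v (i + 2)] := fun j => by
    rw [← form3_apply v (b x)]; rfl
  have e' : ∀ j, v.det ![v j, v (i + 1), v (i + 2)] = if j = i then 1 else 0 := fun j => by
    have e0 : v.det ![v 0, v 1, v 2] = 1 := by
      have := v.det_self
      rwa [show (v : Fin 3 → E3) = ![v 0, v 1, v 2] by ext k; fin_cases k <;> rfl] at this
    have hz : ∀ (w : Fin 3 → E3) (p q : Fin 3), p ≠ q → w p = w q → v.det w = 0 :=
      fun w p q hpq hw => v.det.map_eq_zero_of_eq w hw hpq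
    -- A cyclic permutation is a product of two swaps, so it preserves the determinant.
    have hc : ∀ a b c : E3, v.det ![a, b, c] = v.det ![c, a, b] := fun a b c => by
      have h1 := v.det.map_swap ![a, b, c] (i := 0) (j := 1) (by decide)
      have h2 := v.det.map_swap (![a, b, c] ∘ Equiv.swap 0 1) (i := 0) (j := 2) (by decide)
      rw [h1, neg_neg] at h2
      rw [← h2]; congr 1; ext k; fin_cases k <;> rfl
    by_cases h : j = i
    · subst h
      rw [if_pos rfl]
      fin_cases j <;> simp only [Fin.zero_eta, Fin.mk_one, Fin.reduceFinMk, Fin.isValue, Fin.reduceAdd]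
      · exact e0
      · rw [hc]; exact e0
      · rw [hc, hc]; exact e0
    · rw [if_neg h]
      have : j = i + 1 ∨ j = i + 2 := by
        revert h; fin_cases i <;> fin_cases j <;> decide
      rcases this with rfl | rfl
      · exact hz _ 0 1 (by decide) rfl
      · exact hz _ 0 2 (by decide) rfl
  simp [e, e', comp2_smul]

/-- The definition refers to the standard frame. Expanding `v j` in it shows that the same quotient
gives the components in every frame. -/
theorem repr_dualVec (vol : Form M 3) (B : Form M 2) (i : Fin 3) :
    v.repr (dualVec vol B x) i = comp2 v (B x) i / comp3 v (vol x) := by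
  have hc : ∀ a j : Fin 3, comp1 v (ContinuousAlternatingMap.ofSubsingleton ℝ E3 ℝ (0 : Fin 1)
      (EuclideanSpace.proj a : E3 →L[ℝ] ℝ)) j = v j a := fun a j => by
    rfl
  have hs : ∀ u : E3, ∑ a, u a • stdB a = u := fun u => by
    have := stdFrame.sum_repr u
    simpa [stdB, stdFrame] using this
  have : dualVec vol B x = ∑ j, (comp2 v (B x) j / comp3 v (vol x)) • v j := by
    simp only [dualVec, ratio_eq v, comp3_wedge, hc]
    simp_rw [Finset.sum_div, Finset.sum_smul]
    rw [Finset.sum_comm]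
    refine Finset.sum_congr rfl fun j _ => ?_
    conv_rhs => rw [← hs (v j), Finset.smul_sum]
    refine Finset.sum_congr rfl fun a _ => ?_
    rw [smul_smul]; congr 1; ring
  rw [this]
  simp [Finsupp.single_apply]

end Fields

/-- For fixed i only the two orderings of the other indices survive. Nearly every ε-sum is opened in
this cyclic form, which treats the three values of i alike. -/
theorem eps_sum {V : Type*} [AddCommGroup V] [Module ℝ V] (i : Fin 3) (f : Fin 3 → Fin 3 → V) :
    ∑ j, ∑ k, eps i j k • f j k = f (i + 1) (i + 2) - f (i + 2) (i + 1) := by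
  simp only [Fin.sum_univ_three]
  fin_cases i <;> simp [eps] <;> norm_num <;> abel

theorem eps_sum_mul (i : Fin 3) (f : Fin 3 → Fin 3 → ℝ) :
    ∑ j, ∑ k, eps i j k * f j k = f (i + 1) (i + 2) - f (i + 2) (i + 1) := eps_sum i f

end

/-! ### Charts, transition maps and coordinate expressions -/

section

theorem two_le_infty : (2 : WithTop ℕ∞) ≤ ∞ := by
  have : ((2 : ℕ∞) : WithTop ℕ∞) ≤ ((⊤ : ℕ∞) : WithTop ℕ∞) := WithTop.coe_le_coe.2 le_top
  exact this

section Charts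

variable {M : Type*} [TopologicalSpace M] [ChartedSpace E3 M] [IsManifold (𝓡 3) ∞ M]

theorem isManifold_one : IsManifold (𝓡 3) 1 M :=
  IsManifold.of_le (n := ∞) (by exact_mod_cast le_top)

omit [IsManifold (𝓡 3) ∞ M] in
theorem chartInvD_eq_within (c : M) (y : E3) :
    chartInvD c y = (mfderivWithin 𝓘(ℝ, E3) (𝓡 3) (extChartAt (𝓡 3) c).symm (Set.range (𝓡 3)) y : _) := by
  have : Set.range (𝓡 3) = Set.univ := by simp
  rw [this, mfderivWithin_univ]; rfl

theorem chartD_comp_chartInvD {c : M} {y : E3} (hy : y ∈ (extChartAt (𝓡 3) c).target) :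
    chartD c ((extChartAt (𝓡 3) c).symm y) ∘L chartInvD c y = ContinuousLinearMap.id ℝ E3 := by
  have := isManifold_one (M := M)
  rw [chartInvD_eq_within]
  exact mfderiv_extChartAt_comp_mfderivWithin_extChartAt_symm hy

theorem chartInvD_comp_chartD {c : M} {y : E3} (hy : y ∈ (extChartAt (𝓡 3) c).target) :
    chartInvD c y ∘L chartD c ((extChartAt (𝓡 3) c).symm y) = ContinuousLinearMap.id ℝ E3 := by
  have := isManifold_one (M := M)
  rw [chartInvD_eq_within]
  exact mfderivWithin_extChartAt_symm_comp_mfderiv_extChartAt hy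

theorem chartInvD_comp_chartD' {c p : M} (hp : p ∈ (extChartAt (𝓡 3) c).source) :
    chartInvD c (extChartAt (𝓡 3) c p) ∘L chartD c p = ContinuousLinearMap.id ℝ E3 := by
  have := chartInvD_comp_chartD (c := c) ((extChartAt (𝓡 3) c).map_source hp)
  rwa [(extChartAt (𝓡 3) c).left_inv hp] at this

/-- The tangent space at `x` is identified with `E3` through the chart at `x` itself. Values at the
centre of a chart therefore coincide with values on the manifold. -/
theorem chartD_self (x : M) : chartD x x = ContinuousLinearMap.id ℝ E3 := by
  have := isManifold_one (M := M)
  exact mfderiv_extChartAt_self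

theorem chartInvD_self (x : M) :
    chartInvD x (extChartAt (𝓡 3) x x) = ContinuousLinearMap.id ℝ E3 := by
  have := chartInvD_comp_chartD' (mem_extChartAt_source (I := 𝓡 3) x)
  rwa [chartD_self, ContinuousLinearMap.comp_id] at this

theorem chartForm_self {k : ℕ} (b : Form M k) (x : M) :
    chartForm x b (extChartAt (𝓡 3) x x) = b x := by
  rw [chartForm, chartInvD_self, extChartAt_to_inv]; rfl

theorem chartVF_self (ξ : VF M) (x : M) : chartVF x ξ (extChartAt (𝓡 3) x x) = ξ x := by
  rw [chartVF, extChartAt_to_inv, chartD_self]; rfl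

omit [IsManifold (𝓡 3) ∞ M] in
theorem target_mem_nhds {c : M} {y : E3} (hy : y ∈ (extChartAt (𝓡 3) c).target) :
    (extChartAt (𝓡 3) c).target ∈ 𝓝 y :=
  (isOpen_extChartAt_target c).mem_nhds hy

theorem mdifferentiableAt_chart_symm {c : M} {y : E3} (hy : y ∈ (extChartAt (𝓡 3) c).target) :
    MDifferentiableAt 𝓘(ℝ, E3) (𝓡 3) (extChartAt (𝓡 3) c).symm y := by
  have := isManifold_one (M := M)
  have := mdifferentiableWithinAt_extChartAt_symm (I := 𝓡 3) hy
  rwa [show Set.range (𝓡 3) = Set.univ by simp, mdifferentiableWithinAt_univ] at this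

theorem mdifferentiableAt_chart {c p : M} (hp : p ∈ (extChartAt (𝓡 3) c).source) :
    MDifferentiableAt (𝓡 3) 𝓘(ℝ, E3) (extChartAt (𝓡 3) c) p := by
  have := isManifold_one (M := M)
  exact mdifferentiableAt_extChartAt (by simpa using hp)

/-- The transition map from the chart at `c'` to the chart at `c`. -/
def transition (c c' : M) : E3 → E3 := fun z => extChartAt (𝓡 3) c ((extChartAt (𝓡 3) c').symm z)

theorem fderiv_transition {c c' : M} {z : E3} (hz : z ∈ (extChartAt (𝓡 3) c').target)
    (hc : (extChartAt (𝓡 3) c').symm z ∈ (extChartAt (𝓡 3) c).source) :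
    fderiv ℝ (transition c c') z = chartD c ((extChartAt (𝓡 3) c').symm z) ∘L chartInvD c' z := by
  rw [← mfderiv_eq_fderiv]
  exact mfderiv_comp z (mdifferentiableAt_chart hc) (mdifferentiableAt_chart_symm hz)

theorem contDiffAt_transition {c c' : M} {z : E3} (hz : z ∈ (extChartAt (𝓡 3) c').target)
    (hc : (extChartAt (𝓡 3) c').symm z ∈ (extChartAt (𝓡 3) c).source) :
    ContDiffAt ℝ ∞ (transition c c') z := by
  rw [← contMDiffAt_iff_contDiffAt]
  refine ContMDiffAt.comp (I' := 𝓡 3) z (contMDiffAt_extChartAt' (by simpa using hc)) ?_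
  exact (contMDiffOn_extChartAt_symm (I := 𝓡 3) c').contMDiffAt (target_mem_nhds hz)

theorem chartForm_transition {k : ℕ} (b : Form M k) {c c' : M} {z : E3}
    (hz : z ∈ (extChartAt (𝓡 3) c').target)
    (hc : (extChartAt (𝓡 3) c').symm z ∈ (extChartAt (𝓡 3) c).source) :
    chartForm c' b z
      = (chartForm c b (transition c c' z)).compContinuousLinearMap (fderiv ℝ (transition c c') z) := by
  have h := chartInvD_comp_chartD' hc
  rw [fderiv_transition hz hc]
  unfold chartForm transition
  rw [(extChartAt (𝓡 3) c).left_inv hc]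
  ext w
  simp only [ContinuousAlternatingMap.compContinuousLinearMap_apply]
  congr 1
  ext1 i
  have := congrArg (fun L : E3 →L[ℝ] E3 => L (chartInvD c' z (w i))) h
  simpa using this.symm

omit [IsManifold (𝓡 3) ∞ M] in
theorem eventually_transition (c c' : M) {z : E3} (hz : z ∈ (extChartAt (𝓡 3) c').target)
    (hc : (extChartAt (𝓡 3) c').symm z ∈ (extChartAt (𝓡 3) c).source) :
    ∀ᶠ w in 𝓝 z, w ∈ (extChartAt (𝓡 3) c').target ∧
      (extChartAt (𝓡 3) c').symm w ∈ (extChartAt (𝓡 3) c).source := by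
  filter_upwards [target_mem_nhds hz, (continuousAt_extChartAt_symm'' hz).preimage_mem_nhds
    ((isOpen_extChartAt_source c).mem_nhds hc)] with w h1 h2 using ⟨h1, h2⟩

omit [IsManifold (𝓡 3) ∞ M] in
theorem SmoothForm.contDiffAt {k : ℕ} {b : Form M k} (hb : SmoothForm b) {c : M} {y : E3}
    (hy : y ∈ (extChartAt (𝓡 3) c).target) : ContDiffAt ℝ ∞ (chartForm c b) y :=
  (hb c).contDiffAt (target_mem_nhds hy)

/-- The exterior differential is computed by the same formula in every chart. -/
theorem chartForm_extD {k : ℕ} {b : Form M k} (hb : SmoothForm b) {c : M} {y : E3}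
    (hy : y ∈ (extChartAt (𝓡 3) c).target) :
    chartForm c (extD b) y = extDeriv (chartForm c b) y := by
  set p := (extChartAt (𝓡 3) c).symm y with hp
  have hpt : extChartAt (𝓡 3) p p ∈ (extChartAt (𝓡 3) p).target := mem_extChartAt_target p
  have hpc : (extChartAt (𝓡 3) p).symm (extChartAt (𝓡 3) p p) ∈ (extChartAt (𝓡 3) c).source := by
    rw [extChartAt_to_inv]; exact (extChartAt (𝓡 3) c).map_target hy
  have hτ : transition c p (extChartAt (𝓡 3) p p) = y := by
    rw [transition, extChartAt_to_inv, hp, (extChartAt (𝓡 3) c).right_inv hy]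
  -- Near the centre of the chart at `p`, the two coordinate expressions are related by pullback
  -- along the transition map, and the exterior derivative commutes with pullbacks.
  have hev : chartForm p b =ᶠ[𝓝 (extChartAt (𝓡 3) p p)] fun z =>
      (chartForm c b (transition c p z)).compContinuousLinearMap (fderiv ℝ (transition c p) z) := by
    filter_upwards [eventually_transition c p hpt hpc] with z hz
    exact chartForm_transition b hz.1 hz.2
  have hd : extDeriv (chartForm p b) (extChartAt (𝓡 3) p p)
      = (extDeriv (chartForm c b) y).compContinuousLinearMap (chartD c p) := by
    rw [hev.extDeriv_eq, extDeriv_pullback (r := ∞) (hτ ▸ (hb.contDiffAt hy).differentiableAt (by simp))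
      (contDiffAt_transition hpt hpc) (by simpa using two_le_infty), hτ, fderiv_transition hpt hpc, extChartAt_to_inv,
      chartInvD_self, ContinuousLinearMap.comp_id]
  have h := chartD_comp_chartInvD hy
  rw [← hp] at h
  rw [chartForm, ← hp, extD, hd, chartD_self]
  ext w
  simp only [ContinuousAlternatingMap.compContinuousLinearMap_apply]
  congr 1
  ext1 i
  exact congrArg (fun L : E3 →L[ℝ] E3 => L (w i)) h

theorem extD_apply {k : ℕ} (b : Form M k) (x : M) :
    extD b x = extDeriv (chartForm x b) (extChartAt (𝓡 3) x x) := by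
  rw [extD, chartD_self]; rfl

/-! ### Pointwise operations in a chart -/

omit [IsManifold (𝓡 3) ∞ M] in
theorem chartForm_wedge {k : ℕ} (c : M) (a : Form M 1) (b : Form M k) :
    chartForm c (wedge a b) = wedge (chartForm c a) (chartForm c b) := by
  ext y w
  simp only [chartForm, ContinuousAlternatingMap.compContinuousLinearMap_apply, wedge_apply]
  rfl

omit [IsManifold (𝓡 3) ∞ M] in
theorem chartForm_add {k : ℕ} (c : M) (a b : Form M k) :
    chartForm c (a + b) = chartForm c a + chartForm c b := rfl

omit [IsManifold (𝓡 3) ∞ M] in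
theorem chartForm_fmul {k : ℕ} (c : M) (f : M → ℝ) (b : Form M k) :
    chartForm c (fmul f b) = fmul (fun y => f ((extChartAt (𝓡 3) c).symm y)) (chartForm c b) := rfl

theorem chartForm_inner1 {k : ℕ} {c : M} (ξ : VF M) (b : Form M (k + 1)) {y : E3}
    (hy : y ∈ (extChartAt (𝓡 3) c).target) :
    chartForm c (inner1 ξ b) y = inner1 (chartVF c ξ) (chartForm c b) y := by
  ext w
  have h := chartInvD_comp_chartD hy
  simp only [chartForm, ContinuousAlternatingMap.compContinuousLinearMap_apply, inner1_apply]
  congr 1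
  ext1 i
  refine Fin.cases ?_ (fun j => ?_) i
  · have := congrArg (fun L : E3 →L[ℝ] E3 => L (ξ ((extChartAt (𝓡 3) c).symm y))) h
    simpa [chartVF] using this.symm
  · simp

theorem ev_chart {c : M} (ξ : VF M) (a : Form M 1) {y : E3}
    (hy : y ∈ (extChartAt (𝓡 3) c).target) :
    ev ξ a ((extChartAt (𝓡 3) c).symm y) = ev (chartVF c ξ) (chartForm c a) y := by
  have h := chartInvD_comp_chartD hy
  simp only [ev, chartForm, ContinuousAlternatingMap.compContinuousLinearMap_apply]
  congr 1
  ext1 i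
  have := congrArg (fun L : E3 →L[ℝ] E3 => L (ξ ((extChartAt (𝓡 3) c).symm y))) h
  simpa [chartVF] using this.symm

end Charts

end

/-! ### Smoothness of forms, vector fields and functions -/

section

/-! ### Components of forms on open subsets of `ℝ³` -/

section Euclidean

theorem contDiffOn_apply {k : ℕ} {b : Form E3 k} {s : Set E3} (hb : ContDiffOn ℝ ∞ b s)
    (w : Fin k → E3) : ContDiffOn ℝ ∞ (fun y => b y w) s :=
  (ContinuousAlternatingMap.apply ℝ E3 ℝ w).contDiff.comp_contDiffOn hb

/-- The coordinate 1-forms. -/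
def dx (i : Fin 3) : Form E3 1 := fun _ =>
  ContinuousAlternatingMap.ofSubsingleton ℝ E3 ℝ (0 : Fin 1) (EuclideanSpace.proj i : E3 →L[ℝ] ℝ)

theorem comp1_dx (i j : Fin 3) (y : E3) : comp1 stdFrame (dx i y) j = if i = j then 1 else 0 := by
  change (stdFrame j : E3) i = _
  simp [stdFrame_apply, stdB]

theorem contDiffOn_comp1_iff {b : Form E3 1} {s : Set E3} :
    ContDiffOn ℝ ∞ b s ↔ ∀ i, ContDiffOn ℝ ∞ (fun y => comp1 stdFrame (b y) i) s := by
  refine ⟨fun h i => contDiffOn_apply h _, fun h => ?_⟩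
  have e : b = fun y => ∑ i, comp1 stdFrame (b y) i • dx i 0 := by
    funext y
    refine ext_comp1 stdFrame fun j => ?_
    simp [comp1_dx]
  rw [e]
  exact ContDiffOn.sum fun i _ => (h i).smul contDiffOn_const

/-- The coordinate 2-forms. -/
def dx2 (i : Fin 3) : E3 [⋀^Fin 2]→L[ℝ] ℝ := wedge (dx (i + 1)) (dx (i + 2)) 0

theorem comp2_dx2 (i j : Fin 3) : comp2 stdFrame (dx2 i) j = if i = j then 1 else 0 := by
  rw [dx2, comp2_wedge]
  simp only [comp1_dx]
  revert i j
  simp [Fin.forall_fin_succ]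

theorem contDiffOn_comp2_iff {b : Form E3 2} {s : Set E3} :
    ContDiffOn ℝ ∞ b s ↔ ∀ i, ContDiffOn ℝ ∞ (fun y => comp2 stdFrame (b y) i) s := by
  refine ⟨fun h i => contDiffOn_apply h _, fun h => ?_⟩
  have e : b = fun y => ∑ i, comp2 stdFrame (b y) i • dx2 i := by
    funext y
    refine ext_comp2 stdFrame fun j => ?_
    simp [comp2_dx2]
  rw [e]
  exact ContDiffOn.sum fun i _ => (h i).smul contDiffOn_const

theorem contDiffOn_comp3_iff {b : Form E3 3} {s : Set E3} :
    ContDiffOn ℝ ∞ b s ↔ ContDiffOn ℝ ∞ (fun y => comp3 stdFrame (b y)) s := by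
  refine ⟨fun h => contDiffOn_apply h _, fun h => ?_⟩
  have e : b = fun y => comp3 stdFrame (b y) • wedge (dx 0) (wedge (dx 1) (dx 2)) 0 := by
    funext y
    refine ext_comp3 stdFrame ?_
    simp [comp3_wedge, comp2_wedge, comp1_dx]
  rw [e]
  exact h.smul contDiffOn_const

theorem contDiffOn_repr_iff {ξ : E3 → E3} {s : Set E3} :
    ContDiffOn ℝ ∞ ξ s ↔ ∀ i, ContDiffOn ℝ ∞ (fun y => stdFrame.repr (ξ y) i) s := by
  rw [contDiffOn_euclidean]
  simp [stdFrame]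

theorem comp2_extDeriv {a : Form E3 1} {y : E3} (ha : DifferentiableAt ℝ a y) (i : Fin 3) :
    comp2 stdFrame (extDeriv a y) i
      = fderiv ℝ (fun z => comp1 stdFrame (a z) (i + 2)) y (stdB (i + 1))
        - fderiv ℝ (fun z => comp1 stdFrame (a z) (i + 1)) y (stdB (i + 2)) := by
  rw [comp2, extDeriv_apply ha, Fin.sum_univ_two]
  have e0 : (Fin.removeNth (0 : Fin 2) ![stdFrame (i + 1), stdFrame (i + 2)])
      = fun _ => stdFrame (i + 2) := by
    ext1 k; fin_cases k; rfl
  have e1 : (Fin.removeNth (1 : Fin 2) ![stdFrame (i + 1), stdFrame (i + 2)])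
      = fun _ => stdFrame (i + 1) := by
    ext1 k; fin_cases k; rfl
  rw [e0, e1]
  simp [comp1, stdFrame_apply]
  ring

theorem comp3_extDeriv {b : Form E3 2} {y : E3} (hb : DifferentiableAt ℝ b y) :
    comp3 stdFrame (extDeriv b y)
      = ∑ i, fderiv ℝ (fun z => comp2 stdFrame (b z) i) y (stdB i) := by
  rw [comp3, extDeriv_apply hb, Fin.sum_univ_three, Fin.sum_univ_three]
  have e0 : (Fin.removeNth (0 : Fin 3) (stdFrame : Fin 3 → E3)) = ![stdFrame 1, stdFrame 2] := by
    ext1 k; fin_cases k <;> rfl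
  have e1 : (Fin.removeNth (1 : Fin 3) (stdFrame : Fin 3 → E3)) = ![stdFrame 0, stdFrame 2] := by
    ext1 k; fin_cases k <;> rfl
  have e2 : (Fin.removeNth (2 : Fin 3) (stdFrame : Fin 3 → E3)) = ![stdFrame 0, stdFrame 1] := by
    ext1 k; fin_cases k <;> rfl
  rw [e0, e1, e2]
  have h1 : (fun z => (b z) ![stdFrame 0, stdFrame 2]) = fun z => - comp2 stdFrame (b z) 1 :=
    funext fun z => comp2_antisymm _ _ _ _
  rw [h1, fderiv_fun_neg]
  simp [comp2, stdFrame_apply]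

theorem ContDiffOn.fderiv_apply_const {f : E3 → ℝ} {s : Set E3} (hs : IsOpen s)
    (hf : ContDiffOn ℝ ∞ f s) (w : E3) : ContDiffOn ℝ ∞ (fun y => fderiv ℝ f y w) s :=
  (hf.fderiv_of_isOpen hs (m := ∞) (by simp)).clm_apply contDiffOn_const

end Euclidean

theorem inner1_dualVec {M : Type*} {vol : Form M 3} (hv : ∀ x, vol x ≠ 0) (B : Form M 2) :
    inner1 (dualVec vol B) vol = B := by
  funext x
  refine ext_comp2 stdFrame fun i => ?_
  rw [comp2_inner1, repr_dualVec, div_mul_cancel₀ _ (comp3_ne_zero _ (hv x))]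

section Smooth

variable {M : Type*} [TopologicalSpace M] [ChartedSpace E3 M]

theorem smoothForm1_iff {a : Form M 1} : SmoothForm a ↔ ∀ (c : M) (i : Fin 3),
    ContDiffOn ℝ ∞ (fun y => comp1 stdFrame (chartForm c a y) i) (extChartAt (𝓡 3) c).target :=
  forall_congr' fun _ => contDiffOn_comp1_iff

theorem smoothForm2_iff {a : Form M 2} : SmoothForm a ↔ ∀ (c : M) (i : Fin 3),
    ContDiffOn ℝ ∞ (fun y => comp2 stdFrame (chartForm c a y) i) (extChartAt (𝓡 3) c).target :=
  forall_congr' fun _ => contDiffOn_comp2_iff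

theorem smoothForm3_iff {a : Form M 3} : SmoothForm a ↔ ∀ (c : M),
    ContDiffOn ℝ ∞ (fun y => comp3 stdFrame (chartForm c a y)) (extChartAt (𝓡 3) c).target :=
  forall_congr' fun _ => contDiffOn_comp3_iff

theorem smoothVF_iff {ξ : VF M} : SmoothVF ξ ↔ ∀ (c : M) (i : Fin 3),
    ContDiffOn ℝ ∞ (fun y => stdFrame.repr (chartVF c ξ y) i) (extChartAt (𝓡 3) c).target :=
  forall_congr' fun _ => contDiffOn_repr_iff

theorem smoothFun_iff [IsManifold (𝓡 3) ∞ M] {f : M → ℝ} : SmoothFun f ↔ ∀ c : M,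
    ContDiffOn ℝ ∞ (fun y => f ((extChartAt (𝓡 3) c).symm y)) (extChartAt (𝓡 3) c).target := by
  constructor
  · intro hf c
    rw [← contMDiffOn_iff_contDiffOn]
    exact ContMDiff.comp_contMDiffOn hf (contMDiffOn_extChartAt_symm c)
  · intro h x
    have h1 := (h x).contDiffAt (target_mem_nhds (mem_extChartAt_target x))
    rw [← contMDiffAt_iff_contDiffAt] at h1
    have h2 : ContMDiffAt (𝓡 3) 𝓘(ℝ, ℝ) ∞
        ((fun y => f ((extChartAt (𝓡 3) x).symm y)) ∘ extChartAt (𝓡 3) x) x :=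
      ContMDiffAt.comp x h1 contMDiffAt_extChartAt
    refine h2.congr_of_eventuallyEq ?_
    filter_upwards [extChartAt_source_mem_nhds (I := 𝓡 3) x] with p hp
    exact congrArg f ((extChartAt (𝓡 3) x).left_inv hp).symm

variable {k : ℕ}

theorem SmoothForm.add {a b : Form M k} (ha : SmoothForm a) (hb : SmoothForm b) :
    SmoothForm (a + b) := fun c => (ha c).add (hb c)

theorem SmoothForm.smul (r : ℝ) {a : Form M k} (ha : SmoothForm a) : SmoothForm (r • a) :=
  fun c => (ha c).const_smul r

theorem SmoothForm.neg {a : Form M k} (ha : SmoothForm a) : SmoothForm (-a) := by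
  rw [← neg_one_smul ℝ a]; exact ha.smul _

theorem SmoothForm.sub {a b : Form M k} (ha : SmoothForm a) (hb : SmoothForm b) :
    SmoothForm (a - b) := by
  rw [sub_eq_add_neg]; exact ha.add hb.neg

theorem SmoothForm.zero : SmoothForm (0 : Form M k) := fun _ => contDiffOn_const (c := 0)

theorem SmoothForm.sum {ι : Type*} {s : Finset ι} {a : ι → Form M k}
    (h : ∀ i ∈ s, SmoothForm (a i)) : SmoothForm (∑ i ∈ s, a i) := by
  classical
  induction s using Finset.induction_on with
  | empty => simpa using SmoothForm.zero
  | insert i s hi ih =>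
    rw [Finset.sum_insert hi]
    exact (h i (Finset.mem_insert_self i s)).add
      (ih fun j hj => h j (Finset.mem_insert_of_mem hj))

theorem SmoothForm.wedge11 {a b : Form M 1} (ha : SmoothForm a) (hb : SmoothForm b) :
    SmoothForm (wedge a b) := by
  rw [smoothForm1_iff] at ha hb
  refine smoothForm2_iff.2 fun c i => ?_
  simp only [chartForm_wedge, comp2_wedge]
  exact ((ha c _).mul (hb c _)).sub ((ha c _).mul (hb c _))

theorem SmoothForm.wedge12 {a : Form M 1} {b : Form M 2} (ha : SmoothForm a) (hb : SmoothForm b) :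
    SmoothForm (wedge a b) := by
  rw [smoothForm1_iff] at ha
  rw [smoothForm2_iff] at hb
  refine smoothForm3_iff.2 fun c => ?_
  simp only [chartForm_wedge, comp3_wedge]
  exact ContDiffOn.sum fun i _ => (ha c _).mul (hb c _)

variable [IsManifold (𝓡 3) ∞ M]

theorem SmoothForm.fmul {f : M → ℝ} {a : Form M k} (hf : SmoothFun f) (ha : SmoothForm a) :
    SmoothForm (fmul f a) := fun c => (smoothFun_iff.1 hf c).smul (ha c)

theorem SmoothForm.inner2 {ξ : VF M} {b : Form M 2} (hξ : SmoothVF ξ) (hb : SmoothForm b) :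
    SmoothForm (inner1 ξ b) := by
  rw [smoothVF_iff] at hξ
  rw [smoothForm2_iff] at hb
  refine smoothForm1_iff.2 fun c i => ?_
  refine ContDiffOn.congr (((hξ c (i + 2)).mul (hb c (i + 1))).sub
    ((hξ c (i + 1)).mul (hb c (i + 2)))) fun y hy => ?_
  rw [chartForm_inner1 ξ b hy, comp1_inner1]

theorem SmoothForm.inner3 {ξ : VF M} {b : Form M 3} (hξ : SmoothVF ξ) (hb : SmoothForm b) :
    SmoothForm (inner1 ξ b) := by
  rw [smoothVF_iff] at hξ
  rw [smoothForm3_iff] at hb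
  refine smoothForm2_iff.2 fun c i => ?_
  refine ContDiffOn.congr ((hξ c i).mul (hb c)) fun y hy => ?_
  rw [chartForm_inner1 ξ b hy, comp2_inner1]

theorem SmoothFun.ev {ξ : VF M} {a : Form M 1} (hξ : SmoothVF ξ) (ha : SmoothForm a) :
    SmoothFun (ev ξ a) := by
  rw [smoothVF_iff] at hξ
  rw [smoothForm1_iff] at ha
  refine smoothFun_iff.2 fun c => ?_
  refine ContDiffOn.congr (ContDiffOn.sum (s := Finset.univ) fun i _ => (hξ c i).mul (ha c i))
    fun y hy => ?_
  rw [ev_chart ξ a hy, ev_eq stdFrame]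

theorem SmoothForm.extD {a : Form M k} (ha : SmoothForm a) : SmoothForm (extD a) := by
  intro c
  refine ContDiffOn.congr (f := fun y => extDeriv (chartForm c a) y) ?_ fun y hy => chartForm_extD ha hy
  have := (ha c).fderiv_of_isOpen (isOpen_extChartAt_target c) (m := ∞) (by simp)
  exact (ContinuousAlternatingMap.alternatizeUncurryFinCLM ℝ E3 ℝ).contDiff.comp_contDiffOn this

theorem chartForm_dFun {f : M → ℝ} (hf : SmoothFun f) {c : M} {y : E3}
    (hy : y ∈ (extChartAt (𝓡 3) c).target) (i : Fin 3) :
    comp1 stdFrame (chartForm c (dFun f) y) i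
      = fderiv ℝ (fun z => f ((extChartAt (𝓡 3) c).symm z)) y (stdB i) := by
  have h : fderiv ℝ (f ∘ (extChartAt (𝓡 3) c).symm) y
      = (mfderiv (𝓡 3) 𝓘(ℝ, ℝ) f ((extChartAt (𝓡 3) c).symm y) : E3 →L[ℝ] ℝ) ∘L chartInvD c y := by
    rw [← mfderiv_eq_fderiv]
    exact mfderiv_comp y (hf.mdifferentiableAt (by simp)) (mdifferentiableAt_chart_symm hy)
  change _ = fderiv ℝ (f ∘ (extChartAt (𝓡 3) c).symm) y (stdB i)
  rw [h, ← stdFrame_apply]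
  rfl

theorem SmoothForm.dFun {f : M → ℝ} (hf : SmoothFun f) : SmoothForm (dFun f) := by
  refine smoothForm1_iff.2 fun c i => ?_
  refine ContDiffOn.congr (ContDiffOn.fderiv_apply_const (isOpen_extChartAt_target c)
    (smoothFun_iff.1 hf c) (stdB i)) fun y hy => chartForm_dFun hf hy i

omit [IsManifold (𝓡 3) ∞ M] in
theorem comp3_chartForm (c : M) (b : Form M 3) (y : E3) :
    comp3 stdFrame (chartForm c b y)
      = comp3 stdFrame (b ((extChartAt (𝓡 3) c).symm y)) * stdFrame.det (fun i => chartInvD c y (stdFrame i)) := by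
  rw [← form3_apply]; rfl

theorem det_chartInvD_ne_zero {c : M} {y : E3} (hy : y ∈ (extChartAt (𝓡 3) c).target) :
    stdFrame.det (fun i => chartInvD c y (stdFrame i)) ≠ 0 := by
  have h := chartD_comp_chartInvD hy
  intro h0
  have h1 : LinearMap.det (chartInvD c y : E3 →ₗ[ℝ] E3) = 0 := by
    have := stdFrame.det_comp (chartInvD c y : E3 →ₗ[ℝ] E3) stdFrame
    rw [stdFrame.det_self, mul_one] at this
    rw [← h0, ← this]
    rfl
  have h2 : LinearMap.det ((chartD c ((extChartAt (𝓡 3) c).symm y) ∘L chartInvD c y : E3 →L[ℝ] E3) :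
      E3 →ₗ[ℝ] E3) = 1 := by
    rw [h]; exact LinearMap.det_id
  rw [ContinuousLinearMap.toLinearMap_comp, LinearMap.det_comp, h1, mul_zero] at h2
  exact zero_ne_one h2

theorem ratio_chart {c : M} (b vol : Form M 3) {y : E3} (hy : y ∈ (extChartAt (𝓡 3) c).target) :
    ratio b vol ((extChartAt (𝓡 3) c).symm y)
      = comp3 stdFrame (chartForm c b y) / comp3 stdFrame (chartForm c vol y) := by
  rw [ratio_eq stdFrame, comp3_chartForm, comp3_chartForm,
    mul_div_mul_right _ _ (det_chartInvD_ne_zero hy)]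

theorem comp3_chartForm_ne_zero {c : M} {vol : Form M 3} (hv : ∀ x, vol x ≠ 0) {y : E3}
    (hy : y ∈ (extChartAt (𝓡 3) c).target) : comp3 stdFrame (chartForm c vol y) ≠ 0 := by
  rw [comp3_chartForm]
  exact mul_ne_zero (comp3_ne_zero _ (hv _)) (det_chartInvD_ne_zero hy)

theorem SmoothFun.ratio {b vol : Form M 3} (hb : SmoothForm b) (hvol : SmoothForm vol)
    (hv : ∀ x, vol x ≠ 0) : SmoothFun (ratio b vol) := by
  refine smoothFun_iff.2 fun c => ?_
  refine ContDiffOn.congr ((smoothForm3_iff.1 hb c).div (smoothForm3_iff.1 hvol c)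
    fun y hy => comp3_chartForm_ne_zero hv hy) fun y hy => ratio_chart b vol hy

theorem SmoothVF.dualVec {vol : Form M 3} {B : Form M 2} (hvol : SmoothForm vol)
    (hv : ∀ x, vol x ≠ 0) (hB : SmoothForm B) : SmoothVF (dualVec vol B) := by
  refine smoothVF_iff.2 fun c i => ?_
  refine ContDiffOn.congr ((smoothForm2_iff.1 hB c i).div (smoothForm3_iff.1 hvol c)
    fun y hy => comp3_chartForm_ne_zero hv hy) fun y hy => ?_
  -- The components are read off from `inner1 (dualVec vol B) vol = B`, an identity that passes to
  -- charts.
  rw [Pi.div_apply, eq_div_iff (comp3_chartForm_ne_zero hv hy), ← comp2_inner1, ← chartForm_inner1 _ _ hy,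
    inner1_dualVec hv]

/-! Smooth functions -/

omit [IsManifold (𝓡 3) ∞ M] in
theorem SmoothFun.add {f g : M → ℝ} (hf : SmoothFun f) (hg : SmoothFun g) :
    SmoothFun (fun x => f x + g x) := ContMDiff.add hf hg
omit [IsManifold (𝓡 3) ∞ M] in
theorem SmoothFun.mul {f g : M → ℝ} (hf : SmoothFun f) (hg : SmoothFun g) :
    SmoothFun (fun x => f x * g x) := ContMDiff.mul hf hg
omit [IsManifold (𝓡 3) ∞ M] in
theorem SmoothFun.const (r : ℝ) : SmoothFun (fun _ : M => r) := contMDiff_const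
omit [IsManifold (𝓡 3) ∞ M] in
theorem SmoothFun.sub {f g : M → ℝ} (hf : SmoothFun f) (hg : SmoothFun g) :
    SmoothFun (fun x => f x - g x) := ContMDiff.sub hf hg
omit [IsManifold (𝓡 3) ∞ M] in
theorem SmoothFun.sum {ι : Type*} {s : Finset ι} {f : ι → M → ℝ}
    (h : ∀ i ∈ s, SmoothFun (f i)) : SmoothFun (fun x => ∑ i ∈ s, f i x) := by
  classical
  induction s using Finset.induction_on with
  | empty => simpa using SmoothFun.const 0
  | insert i s hi ih =>
    simp_rw [Finset.sum_insert hi]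
    exact (h i (Finset.mem_insert_self i s)).add
      (ih fun j hj => h j (Finset.mem_insert_of_mem hj))
theorem SmoothFun.div {f g : M → ℝ} (hf : SmoothFun f) (hg : SmoothFun g) (h0 : ∀ x, g x ≠ 0) :
    SmoothFun (fun x => f x / g x) :=
  smoothFun_iff.2 fun c => (smoothFun_iff.1 hf c).div (smoothFun_iff.1 hg c) fun _ _ => h0 _
theorem SmoothFun.inv {g : M → ℝ} (hg : SmoothFun g) (h0 : ∀ x, g x ≠ 0) :
    SmoothFun (fun x => (g x)⁻¹) :=
  smoothFun_iff.2 fun c => (smoothFun_iff.1 hg c).inv fun _ _ => h0 _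
theorem SmoothFun.sqrt {g : M → ℝ} (hg : SmoothFun g) (h0 : ∀ x, 0 < g x) :
    SmoothFun (fun x => Real.sqrt (g x)) :=
  smoothFun_iff.2 fun c => (smoothFun_iff.1 hg c).sqrt fun _ _ => (h0 _).ne'

end Smooth

end

/-! ### Linearity and product rules for the exterior differential -/

section

section Leibniz

variable {M : Type*} [TopologicalSpace M] [ChartedSpace E3 M] [IsManifold (𝓡 3) ∞ M]

/-- Partial derivatives at `x`, in the chart at `x`, of a function defined on that chart. -/
def pd (x : M) (g : E3 → ℝ) (j : Fin 3) : ℝ := fderiv ℝ g (extChartAt (𝓡 3) x x) (stdB j)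

theorem SmoothForm.diffAt {k : ℕ} {b : Form M k} (hb : SmoothForm b) (x : M) :
    DifferentiableAt ℝ (chartForm x b) (extChartAt (𝓡 3) x x) :=
  (hb.contDiffAt (mem_extChartAt_target x)).differentiableAt (by simp)

theorem SmoothForm.diffAt_apply {k : ℕ} {b : Form M k} (hb : SmoothForm b) (x : M) (w : Fin k → E3) :
    DifferentiableAt ℝ (fun y => chartForm x b y w) (extChartAt (𝓡 3) x x) :=
  (ContinuousAlternatingMap.apply ℝ E3 ℝ w).differentiableAt.comp _ (hb.diffAt x)

theorem SmoothForm.diffAt_comp1 {b : Form M 1} (hb : SmoothForm b) (x : M) (i : Fin 3) :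
    DifferentiableAt ℝ (fun y => comp1 stdFrame (chartForm x b y) i) (extChartAt (𝓡 3) x x) :=
  hb.diffAt_apply x _

theorem SmoothForm.diffAt_comp2 {b : Form M 2} (hb : SmoothForm b) (x : M) (i : Fin 3) :
    DifferentiableAt ℝ (fun y => comp2 stdFrame (chartForm x b y) i) (extChartAt (𝓡 3) x x) :=
  hb.diffAt_apply x _

theorem SmoothForm.diffAt_comp3 {b : Form M 3} (hb : SmoothForm b) (x : M) :
    DifferentiableAt ℝ (fun y => comp3 stdFrame (chartForm x b y)) (extChartAt (𝓡 3) x x) :=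
  hb.diffAt_apply x _

theorem SmoothFun.diffAt {f : M → ℝ} (hf : SmoothFun f) (x : M) :
    DifferentiableAt ℝ (fun y => f ((extChartAt (𝓡 3) x).symm y)) (extChartAt (𝓡 3) x x) :=
  ((smoothFun_iff.1 hf x).contDiffAt (target_mem_nhds (mem_extChartAt_target x))).differentiableAt
    (by simp)

theorem SmoothVF.diffAt {ξ : VF M} (hξ : SmoothVF ξ) (x : M) :
    DifferentiableAt ℝ (chartVF x ξ) (extChartAt (𝓡 3) x x) :=
  ((hξ x).contDiffAt (target_mem_nhds (mem_extChartAt_target x))).differentiableAt (by simp)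

theorem SmoothVF.diffAt_repr {ξ : VF M} (hξ : SmoothVF ξ) (x : M) (i : Fin 3) :
    DifferentiableAt ℝ (fun y => stdFrame.repr (chartVF x ξ y) i) (extChartAt (𝓡 3) x x) :=
  ((smoothVF_iff.1 hξ x i).contDiffAt
    (target_mem_nhds (mem_extChartAt_target x))).differentiableAt (by simp)

theorem comp2_extD {a : Form M 1} (ha : SmoothForm a) (x : M) (i : Fin 3) :
    comp2 stdFrame (extD a x) i
      = pd x (fun y => comp1 stdFrame (chartForm x a y) (i + 2)) (i + 1)
        - pd x (fun y => comp1 stdFrame (chartForm x a y) (i + 1)) (i + 2) := by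
  rw [extD_apply, comp2_extDeriv (ha.diffAt x)]; rfl

theorem comp3_extD {b : Form M 2} (hb : SmoothForm b) (x : M) :
    comp3 stdFrame (extD b x)
      = ∑ i, pd x (fun y => comp2 stdFrame (chartForm x b y) i) i := by
  rw [extD_apply, comp3_extDeriv (hb.diffAt x)]; rfl

theorem comp1_dFun {f : M → ℝ} (hf : SmoothFun f) (x : M) (i : Fin 3) :
    comp1 stdFrame (dFun f x) i = pd x (fun y => f ((extChartAt (𝓡 3) x).symm y)) i := by
  rw [← chartForm_self (dFun f) x, chartForm_dFun hf (mem_extChartAt_target x)]; rfl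

theorem pd_add {x : M} {f g : E3 → ℝ} (hf : DifferentiableAt ℝ f (extChartAt (𝓡 3) x x))
    (hg : DifferentiableAt ℝ g (extChartAt (𝓡 3) x x)) (j : Fin 3) :
    pd x (fun y => f y + g y) j = pd x f j + pd x g j := by
  simp only [pd]; rw [fderiv_fun_add hf hg]; rfl

theorem pd_sub {x : M} {f g : E3 → ℝ} (hf : DifferentiableAt ℝ f (extChartAt (𝓡 3) x x))
    (hg : DifferentiableAt ℝ g (extChartAt (𝓡 3) x x)) (j : Fin 3) :
    pd x (fun y => f y - g y) j = pd x f j - pd x g j := by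
  simp only [pd]; rw [fderiv_fun_sub hf hg]; rfl

theorem pd_mul {x : M} {f g : E3 → ℝ} (hf : DifferentiableAt ℝ f (extChartAt (𝓡 3) x x))
    (hg : DifferentiableAt ℝ g (extChartAt (𝓡 3) x x)) (j : Fin 3) :
    pd x (fun y => f y * g y) j
      = f (extChartAt (𝓡 3) x x) * pd x g j + g (extChartAt (𝓡 3) x x) * pd x f j := by
  simp only [pd]; rw [fderiv_fun_mul hf hg]; simp

/-- Coordinate formulas for contractions hold only on the chart target, a neighbourhood of the
centre; that is enough for derivatives there. -/
theorem pd_congr {x : M} {f g : E3 → ℝ}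
    (h : ∀ y ∈ (extChartAt (𝓡 3) x).target, f y = g y) (j : Fin 3) : pd x f j = pd x g j := by
  have : f =ᶠ[𝓝 (extChartAt (𝓡 3) x x)] g := by
    filter_upwards [target_mem_nhds (mem_extChartAt_target x)] with y hy using h y hy
  rw [pd, pd, this.fderiv_eq]

theorem fderiv_eq_sum_pd (x : M) (g : E3 → ℝ) (u : E3) :
    fderiv ℝ g (extChartAt (𝓡 3) x x) u = ∑ j, stdFrame.repr u j * pd x g j := by
  conv_lhs => rw [← stdFrame.sum_repr u]
  simp [pd, stdFrame_apply]

/-! Linearity of the exterior differential -/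

theorem extD_add {k : ℕ} {a b : Form M k} (ha : SmoothForm a) (hb : SmoothForm b) :
    extD (a + b) = extD a + extD b := by
  funext x
  simp only [Pi.add_apply, extD_apply, chartForm_add]
  exact extDeriv_add (ha.diffAt x) (hb.diffAt x)

theorem extD_smul {k : ℕ} (r : ℝ) (a : Form M k) : extD (r • a) = r • extD a := by
  funext x
  simp only [Pi.smul_apply, extD_apply]
  exact extDeriv_smul r (chartForm x a)

theorem extD_neg {k : ℕ} (a : Form M k) : extD (-a) = -extD a := by
  rw [← neg_one_smul ℝ a, extD_smul]
  funext x
  ext w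
  exact neg_one_mul _

theorem extD_sub {k : ℕ} {a b : Form M k} (ha : SmoothForm a) (hb : SmoothForm b) :
    extD (a - b) = extD a - extD b := by
  rw [sub_eq_add_neg, extD_add ha hb.neg, extD_neg, ← sub_eq_add_neg]

theorem extD_zero {k : ℕ} : extD (0 : Form M k) = 0 := by
  simpa using extD_smul (0 : ℝ) (0 : Form M k)

theorem extD_sum {k : ℕ} {ι : Type*} {s : Finset ι} {a : ι → Form M k}
    (h : ∀ i ∈ s, SmoothForm (a i)) : extD (∑ i ∈ s, a i) = ∑ i ∈ s, extD (a i) := by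
  classical
  induction s using Finset.induction_on with
  | empty => simpa using extD_zero
  | insert i s hi ih =>
    rw [Finset.sum_insert hi, Finset.sum_insert hi,
      extD_add (h i (Finset.mem_insert_self i s))
        (SmoothForm.sum fun j hj => h j (Finset.mem_insert_of_mem hj)),
      ih fun j hj => h j (Finset.mem_insert_of_mem hj)]

theorem dFun_add {f g : M → ℝ} (hf : SmoothFun f) (hg : SmoothFun g) :
    dFun (fun x => f x + g x) = dFun f + dFun g := by
  funext x
  refine ext_comp1 stdFrame fun i => ?_
  rw [Pi.add_apply, comp1_add, comp1_dFun (hf.add hg), comp1_dFun hf, comp1_dFun hg,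
    pd_add (hf.diffAt x) (hg.diffAt x)]

theorem dFun_mul {f g : M → ℝ} (hf : SmoothFun f) (hg : SmoothFun g) :
    dFun (fun x => f x * g x) = fmul f (dFun g) + fmul g (dFun f) := by
  funext x
  refine ext_comp1 stdFrame fun i => ?_
  rw [Pi.add_apply, comp1_add, comp1_fmul, comp1_fmul, comp1_dFun (hf.mul hg), comp1_dFun hf,
    comp1_dFun hg, pd_mul (hf.diffAt x) (hg.diffAt x), extChartAt_to_inv]

omit [IsManifold (𝓡 3) ∞ M] in
theorem dFun_const (r : ℝ) : dFun (fun _ : M => r) = 0 := by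
  funext x
  refine ext_comp1 stdFrame fun i => ?_
  simp only [dFun, mfderiv_const]
  rfl

theorem dFun_smul (r : ℝ) {f : M → ℝ} (hf : SmoothFun f) :
    dFun (fun x => r * f x) = r • dFun f := by
  rw [dFun_mul (SmoothFun.const r) hf, dFun_const]
  funext x
  simp [fmul]

theorem dFun_sub {f g : M → ℝ} (hf : SmoothFun f) (hg : SmoothFun g) :
    dFun (fun x => f x - g x) = dFun f - dFun g := by
  funext x
  refine ext_comp1 stdFrame fun i => ?_
  rw [Pi.sub_apply, comp1_sub, comp1_dFun (hf.sub hg), comp1_dFun hf, comp1_dFun hg,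
    pd_sub (hf.diffAt x) (hg.diffAt x)]

/-! Product rules -/

theorem extD_fmul1 {f : M → ℝ} {a : Form M 1} (hf : SmoothFun f) (ha : SmoothForm a) :
    extD (fmul f a) = wedge (dFun f) a + fmul f (extD a) := by
  funext x
  refine ext_comp2 stdFrame fun i => ?_
  rw [Pi.add_apply, comp2_add, comp2_fmul, comp2_wedge, comp2_extD ha,
    comp2_extD (SmoothForm.fmul hf ha)]
  simp only [chartForm_fmul, comp1_fmul, comp1_dFun hf]
  rw [pd_mul (hf.diffAt x) (ha.diffAt_comp1 x _), pd_mul (hf.diffAt x) (ha.diffAt_comp1 x _)]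
  simp only [chartForm_self, extChartAt_to_inv]
  ring

theorem extD_fmul2 {f : M → ℝ} {b : Form M 2} (hf : SmoothFun f) (hb : SmoothForm b) :
    extD (fmul f b) = wedge (dFun f) b + fmul f (extD b) := by
  funext x
  refine ext_comp3 stdFrame ?_
  rw [Pi.add_apply, comp3_add, comp3_fmul, comp3_wedge, comp3_extD hb,
    comp3_extD (SmoothForm.fmul hf hb)]
  simp only [chartForm_fmul, comp2_fmul, comp1_dFun hf]
  simp only [pd_mul (hf.diffAt x) (hb.diffAt_comp2 x _)]
  simp only [chartForm_self, extChartAt_to_inv, Fin.sum_univ_three]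
  ring

/-- This is da ∧ b - a ∧ db. As `wedge` takes the 1-form on the left, da ∧ b appears as b ∧ da,
which is equal to it. -/
theorem extD_wedge {a b : Form M 1} (ha : SmoothForm a) (hb : SmoothForm b) :
    extD (wedge a b) = wedge b (extD a) - wedge a (extD b) := by
  funext x
  refine ext_comp3 stdFrame ?_
  rw [Pi.sub_apply, comp3_sub, comp3_wedge, comp3_wedge, comp3_extD (ha.wedge11 hb)]
  simp only [chartForm_wedge, comp2_wedge, comp2_extD ha, comp2_extD hb]
  have h : ∀ i j, DifferentiableAt ℝ (fun y => comp1 stdFrame (chartForm x a y) i *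
      comp1 stdFrame (chartForm x b y) j) (extChartAt (𝓡 3) x x) := fun i j =>
    (ha.diffAt_comp1 x i).mul (hb.diffAt_comp1 x j)
  simp only [pd_sub (h _ _) (h _ _), pd_mul (ha.diffAt_comp1 x _) (hb.diffAt_comp1 x _)]
  simp only [chartForm_self, Fin.sum_univ_three, Fin.isValue, Fin.reduceAdd]
  ring

theorem extD_extD {a : Form M 1} (ha : SmoothForm a) : extD (extD a) = 0 := by
  funext x
  rw [extD_apply]
  have : chartForm x (extD a) =ᶠ[𝓝 (extChartAt (𝓡 3) x x)] extDeriv (chartForm x a) := by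
    filter_upwards [target_mem_nhds (mem_extChartAt_target x)] with y hy using chartForm_extD ha hy
  rw [this.extDeriv_eq]
  exact extDeriv_extDeriv_apply (r := ∞) (ha.contDiffAt (mem_extChartAt_target x))
    (by simpa using two_le_infty)

theorem extD_dFun {f : M → ℝ} (hf : SmoothFun f) : extD (dFun f) = 0 := by
  funext x
  refine ext_comp2 stdFrame fun i => ?_
  rw [comp2_extD (SmoothForm.dFun hf)]
  have h : ∀ i j, pd x (fun y => comp1 stdFrame (chartForm x (dFun f) y) i) j =
      fderiv ℝ (fderiv ℝ fun z => f ((extChartAt (𝓡 3) x).symm z)) (extChartAt (𝓡 3) x x)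
        (stdB j) (stdB i) := fun i j => by
    have hc := (smoothFun_iff.1 hf x).contDiffAt (target_mem_nhds (mem_extChartAt_target x))
    have hd : DifferentiableAt ℝ (fderiv ℝ fun z => f ((extChartAt (𝓡 3) x).symm z))
        (extChartAt (𝓡 3) x x) :=
      (hc.fderiv_right (m := 1) two_le_infty).differentiableAt (by simp)
    rw [pd_congr (g := fun y => fderiv ℝ (fun z => f ((extChartAt (𝓡 3) x).symm z)) y (stdB i))
      fun y hy => chartForm_dFun hf hy i, pd, fderiv_clm_apply hd (differentiableAt_const _)]
    simp
  have hs : IsSymmSndFDerivAt ℝ (fun z => f ((extChartAt (𝓡 3) x).symm z)) (extChartAt (𝓡 3) x x) :=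
    ((smoothFun_iff.1 hf x).contDiffAt (target_mem_nhds (mem_extChartAt_target x))).isSymmSndFDerivAt
      (by simpa using two_le_infty)
  rw [h, h, hs.eq]
  simp

end Leibniz

end

/-! ### Lie derivatives and Cartan's formula -/

section

section Lie

variable {M : Type*} [TopologicalSpace M] [ChartedSpace E3 M] [IsManifold (𝓡 3) ∞ M]

theorem SmoothForm.lie_diffAt {k : ℕ} {ξ : VF M} {b : Form M k} (hb : SmoothForm b) (x : M) :
    DifferentiableAt ℝ (fun s : ℝ =>
      (chartForm x b (extChartAt (𝓡 3) x x + s • chartVF x ξ (extChartAt (𝓡 3) x x))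
        ).compContinuousLinearMap
        (ContinuousLinearMap.id ℝ E3 + s • fderiv ℝ (chartVF x ξ) (extChartAt (𝓡 3) x x))) 0 := by
  refine DifferentiableAt.continuousAlternatingMapCompContinuousLinearMap ?_ ?_
  · have h : DifferentiableAt ℝ (chartForm x b)
        (extChartAt (𝓡 3) x x + (0 : ℝ) • chartVF x ξ (extChartAt (𝓡 3) x x)) := by
      simpa using hb.diffAt x
    exact h.comp (0 : ℝ) (f := fun s : ℝ =>
      extChartAt (𝓡 3) x x + s • chartVF x ξ (extChartAt (𝓡 3) x x)) (by fun_prop)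
  · fun_prop

/-- Evaluation on fixed vectors is linear and continuous, so it commutes with the derivative in s
and only real functions remain to be differentiated. -/
theorem lieForm_apply {k : ℕ} {ξ : VF M} {b : Form M k} (hb : SmoothForm b) (x : M)
    (w : Fin k → E3) :
    lieForm ξ b x w = deriv (fun s : ℝ =>
      chartForm x b (extChartAt (𝓡 3) x x + s • ξ x)
        (fun i => w i + s • fderiv ℝ (chartVF x ξ) (extChartAt (𝓡 3) x x) (w i))) 0 := by
  have h := (SmoothForm.lie_diffAt (ξ := ξ) hb x).hasDerivAt
  have h2 := (ContinuousAlternatingMap.apply ℝ E3 ℝ w).hasFDerivAt.comp_hasDerivAt (0 : ℝ) h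
  have h3 := h2.deriv
  rw [chartVF_self] at h3
  rw [lieForm, chartD_self, chartVF_self]
  exact h3.symm

theorem hasDerivAt_chart {x : M} {g : E3 → ℝ} (hg : DifferentiableAt ℝ g (extChartAt (𝓡 3) x x))
    (u : E3) : HasDerivAt (fun s : ℝ => g (extChartAt (𝓡 3) x x + s • u))
      (∑ j, stdFrame.repr u j * pd x g j) 0 := by
  rw [← fderiv_eq_sum_pd]
  have h : HasFDerivAt g (fderiv ℝ g (extChartAt (𝓡 3) x x))
      (extChartAt (𝓡 3) x x + (0 : ℝ) • u) := by simpa using hg.hasFDerivAt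
  have h2 : HasDerivAt (fun s : ℝ => extChartAt (𝓡 3) x x + s • u) u 0 := by
    simpa using ((hasDerivAt_id (0 : ℝ)).smul_const u).const_add (extChartAt (𝓡 3) x x)
  exact h.comp_hasDerivAt (0 : ℝ) h2

theorem repr_fderiv_chartVF {ξ : VF M} (hξ : SmoothVF ξ) (x : M) (i j : Fin 3) :
    stdFrame.repr (fderiv ℝ (chartVF x ξ) (extChartAt (𝓡 3) x x) (stdFrame i)) j
      = pd x (fun y => stdFrame.repr (chartVF x ξ y) j) i := by
  have h : HasFDerivAt (chartVF x ξ) _ _ := (hξ.diffAt x).hasFDerivAt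
  have h2 := ((EuclideanSpace.proj j : E3 →L[ℝ] ℝ).hasFDerivAt.comp _ h).fderiv
  have e : (fun y => stdFrame.repr (chartVF x ξ y) j)
      = (EuclideanSpace.proj j : E3 →L[ℝ] ℝ) ∘ chartVF x ξ := by
    funext y; simp [stdFrame]
  rw [pd, e, h2, ← stdFrame_apply]
  simp [stdFrame]

theorem repr_frame_add_smul {ξ : VF M} (hξ : SmoothVF ξ) (x : M) (s : ℝ) (i j : Fin 3) :
    stdFrame.repr (stdFrame i + s • fderiv ℝ (chartVF x ξ) (extChartAt (𝓡 3) x x) (stdFrame i)) j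
      = (if i = j then 1 else 0) + s * pd x (fun y => stdFrame.repr (chartVF x ξ y) j) i := by
  rw [map_add, map_smul, Finsupp.add_apply, Finsupp.smul_apply, repr_fderiv_chartVF hξ]
  simp [Finsupp.single_apply]

theorem comp1_lieForm {ξ : VF M} {a : Form M 1} (hξ : SmoothVF ξ) (ha : SmoothForm a) (x : M)
    (i : Fin 3) :
    comp1 stdFrame (lieForm ξ a x) i
      = ∑ j, (stdFrame.repr (ξ x) j * pd x (fun y => comp1 stdFrame (chartForm x a y) i) j
        + pd x (fun y => stdFrame.repr (chartVF x ξ y) j) i * comp1 stdFrame (a x) j) := by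
  rw [comp1, lieForm_apply ha]
  have e : (fun s : ℝ => chartForm x a (extChartAt (𝓡 3) x x + s • ξ x)
        (fun _ => stdFrame i + s • fderiv ℝ (chartVF x ξ) (extChartAt (𝓡 3) x x) (stdFrame i)))
      = fun s => ∑ j, ((if i = j then 1 else 0)
          + s * pd x (fun y => stdFrame.repr (chartVF x ξ y) j) i)
        * comp1 stdFrame (chartForm x a (extChartAt (𝓡 3) x x + s • ξ x)) j := by
    funext s
    rw [form_apply_eq_comp1 stdFrame]
    exact Finset.sum_congr rfl fun j _ => by rw [repr_frame_add_smul hξ]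
  rw [e]
  have hc : ∀ j, HasDerivAt (fun s : ℝ => (if i = j then (1 : ℝ) else 0)
      + s * pd x (fun y => stdFrame.repr (chartVF x ξ y) j) i)
      (pd x (fun y => stdFrame.repr (chartVF x ξ y) j) i) 0 := fun j => by
    simpa using ((hasDerivAt_id (0 : ℝ)).mul_const
      (pd x (fun y => stdFrame.repr (chartVF x ξ y) j) i)).const_add (if i = j then (1 : ℝ) else 0)
  have := (HasDerivAt.fun_sum (u := Finset.univ) fun j _ =>
    (hc j).mul (hasDerivAt_chart (ha.diffAt_comp1 x j) (ξ x))).deriv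
  refine this.trans ?_
  simp only [zero_smul, add_zero, zero_mul, chartForm_self, Finset.sum_add_distrib]
  simp
  ring

theorem form2_apply (v : Frame) (b : E3 [⋀^Fin 2]→L[ℝ] ℝ) (u w : E3) :
    b ![u, w] = ∑ i, comp2 v b i *
      (v.repr u (i + 1) * v.repr w (i + 2) - v.repr u (i + 2) * v.repr w (i + 1)) := by
  have h1 : b ![u, w] = inner1 (fun _ : Unit => u) (fun _ => b) () (fun _ => w) := by
    rw [inner1_apply]; congr 1; ext k; fin_cases k <;> rfl
  rw [h1, form_apply_eq_comp1 v]
  simp only [comp1_inner1, Fin.sum_univ_three, Fin.isValue, Fin.reduceAdd]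
  ring

theorem comp2_lieForm {ξ : VF M} {b : Form M 2} (hξ : SmoothVF ξ) (hb : SmoothForm b) (x : M)
    (i : Fin 3) :
    comp2 stdFrame (lieForm ξ b x) i
      = ∑ j, (stdFrame.repr (ξ x) j * pd x (fun y => comp2 stdFrame (chartForm x b y) i) j
        - pd x (fun y => stdFrame.repr (chartVF x ξ y) i) j * comp2 stdFrame (b x) j
        + pd x (fun y => stdFrame.repr (chartVF x ξ y) j) j * comp2 stdFrame (b x) i) := by
  rw [comp2, lieForm_apply hb]
  set D : Fin 3 → Fin 3 → ℝ := fun i j => pd x (fun y => stdFrame.repr (chartVF x ξ y) j) i with hD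
  set U : Fin 3 → Fin 3 → ℝ → ℝ := fun i j s => (if i = j then 1 else 0) + s * D i j with hU
  set c : Fin 3 → ℝ → ℝ := fun j s =>
    comp2 stdFrame (chartForm x b (extChartAt (𝓡 3) x x + s • ξ x)) j with hc
  have e : (fun s : ℝ => chartForm x b (extChartAt (𝓡 3) x x + s • ξ x)
        (fun k => ![stdFrame (i + 1), stdFrame (i + 2)] k
          + s • fderiv ℝ (chartVF x ξ) (extChartAt (𝓡 3) x x)
            (![stdFrame (i + 1), stdFrame (i + 2)] k)))
      = fun s => ∑ j, c j s * (U (i + 1) (j + 1) s * U (i + 2) (j + 2) s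
        - U (i + 1) (j + 2) s * U (i + 2) (j + 1) s) := by
    funext s
    have : (fun k => ![stdFrame (i + 1), stdFrame (i + 2)] k
          + s • fderiv ℝ (chartVF x ξ) (extChartAt (𝓡 3) x x)
            (![stdFrame (i + 1), stdFrame (i + 2)] k))
        = ![stdFrame (i + 1) + s • fderiv ℝ (chartVF x ξ) (extChartAt (𝓡 3) x x) (stdFrame (i + 1)),
          stdFrame (i + 2) + s • fderiv ℝ (chartVF x ξ) (extChartAt (𝓡 3) x x) (stdFrame (i + 2))] := by
      funext k; fin_cases k <;> rfl
    rw [this, form2_apply stdFrame]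
    refine Finset.sum_congr rfl fun j _ => ?_
    have hr : ∀ k l, stdFrame.repr (stdFrame k + s • fderiv ℝ (chartVF x ξ)
        (extChartAt (𝓡 3) x x) (stdFrame k)) l = U k l s := fun k l =>
      repr_frame_add_smul hξ x s k l
    rw [hr, hr, hr, hr]
  rw [e]
  have hUd : ∀ k l, HasDerivAt (U k l) (D k l) 0 := fun k l => by
    simpa [hU] using
      ((hasDerivAt_id (0 : ℝ)).mul_const (D k l)).const_add (if k = l then (1 : ℝ) else 0)
  have := (HasDerivAt.fun_sum (u := Finset.univ) fun j _ =>
    (hasDerivAt_chart (hb.diffAt_comp2 x j) (ξ x)).mul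
      (((hUd (i + 1) (j + 1)).mul (hUd (i + 2) (j + 2))).sub
        ((hUd (i + 1) (j + 2)).mul (hUd (i + 2) (j + 1))))).deriv
  refine this.trans ?_
  -- At s = 0 the transported frame is the standard one, so the undifferentiated factors become
  -- Kronecker deltas.
  have hU0 : ∀ k l, U k l 0 = if k = l then 1 else 0 := fun k l => by simp [hU]
  simp only [Pi.sub_apply, Pi.mul_apply, hU0, zero_smul, add_zero, chartForm_self,
    Fin.sum_univ_three]
  fin_cases i <;> simp <;> ring

theorem chart_ev {ξ : VF M} {a : Form M 1} (x : M) (j : Fin 3) :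
    pd x (fun y => ev ξ a ((extChartAt (𝓡 3) x).symm y)) j
      = pd x (fun y => ∑ i, stdFrame.repr (chartVF x ξ y) i * comp1 stdFrame (chartForm x a y) i) j :=
  pd_congr (fun y hy => by rw [ev_chart ξ a hy, ev_eq stdFrame]) j

/-- Cartan's formula for 1-forms. -/
theorem lieForm1 {ξ : VF M} {a : Form M 1} (hξ : SmoothVF ξ) (ha : SmoothForm a) :
    lieForm ξ a = dFun (ev ξ a) + inner1 ξ (extD a) := by
  funext x
  refine ext_comp1 stdFrame fun i => ?_
  have hp : ∀ i, DifferentiableAt ℝ (fun y => stdFrame.repr (chartVF x ξ y) i *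
      comp1 stdFrame (chartForm x a y) i) (extChartAt (𝓡 3) x x) := fun i =>
    (hξ.diffAt_repr x i).mul (ha.diffAt_comp1 x i)
  rw [comp1_lieForm hξ ha, Pi.add_apply, comp1_add, comp1_dFun (SmoothFun.ev hξ ha), chart_ev,
    comp1_inner1, comp2_extD ha, comp2_extD ha]
  simp only [Fin.sum_univ_three]
  rw [pd_add ((hp _).fun_add (hp _)) (hp _), pd_add (hp _) (hp _), pd_mul (hξ.diffAt_repr x _)
    (ha.diffAt_comp1 x _), pd_mul (hξ.diffAt_repr x _)
    (ha.diffAt_comp1 x _), pd_mul (hξ.diffAt_repr x _) (ha.diffAt_comp1 x _)]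
  simp only [chartForm_self, chartVF_self]
  fin_cases i <;> simp <;> ring

/-- Cartan's formula for 2-forms. -/
theorem lieForm2 {ξ : VF M} {b : Form M 2} (hξ : SmoothVF ξ) (hb : SmoothForm b) :
    lieForm ξ b = extD (inner1 ξ b) + inner1 ξ (extD b) := by
  funext x
  refine ext_comp2 stdFrame fun i => ?_
  have hp : ∀ i j, DifferentiableAt ℝ (fun y => stdFrame.repr (chartVF x ξ y) i *
      comp2 stdFrame (chartForm x b y) j) (extChartAt (𝓡 3) x x) := fun i j =>
    (hξ.diffAt_repr x i).mul (hb.diffAt_comp2 x j)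
  have hin : ∀ i j, pd x (fun y => comp1 stdFrame (chartForm x (inner1 ξ b) y) i) j
      = pd x (fun y => stdFrame.repr (chartVF x ξ y) (i + 2) * comp2 stdFrame (chartForm x b y) (i + 1)
      - stdFrame.repr (chartVF x ξ y) (i + 1) * comp2 stdFrame (chartForm x b y) (i + 2)) j :=
    fun i j => pd_congr (fun y hy => by rw [chartForm_inner1 ξ b hy, comp1_inner1]) j
  rw [comp2_lieForm hξ hb, Pi.add_apply, comp2_add, comp2_extD (SmoothForm.inner2 hξ hb),
    comp2_inner1, comp3_extD hb, hin, hin, pd_sub (hp _ _) (hp _ _), pd_sub (hp _ _) (hp _ _)]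
  simp only [pd_mul (hξ.diffAt_repr x _) (hb.diffAt_comp2 x _), chartForm_self, chartVF_self,
    Fin.sum_univ_three]
  fin_cases i <;> simp <;> ring

theorem chartD_eq_inverse {c : M} {y : E3} (hy : y ∈ (extChartAt (𝓡 3) c).target) :
    (chartInvD c y).inverse = chartD c ((extChartAt (𝓡 3) c).symm y) :=
  ContinuousLinearMap.inverse_eq (chartInvD_comp_chartD hy) (chartD_comp_chartInvD hy)

/-- The bracket on the manifold is that of the pullbacks by the inverse chart. These agree with
`chartVF` on the chart target because the inverse of `chartInvD` is `chartD`, and at the centre the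
chart has identity derivative. -/
theorem lieVF_eq (ξ X : VF M) (x : M) :
    lieVF ξ X x
      = VectorField.lieBracket ℝ (chartVF x ξ) (chartVF x X) (extChartAt (𝓡 3) x x) := by
  have hr : Set.range (𝓡 3) = Set.univ := by simp
  obtain ⟨P, hP⟩ : ∃ P : VF M → E3 → E3, P = fun Y => VectorField.mpullbackWithin 𝓘(ℝ, E3) (𝓡 3)
      (extChartAt (𝓡 3) x).symm Y (Set.range (𝓡 3)) := ⟨_, rfl⟩
  have hp : ∀ Y : VF M, P Y =ᶠ[𝓝 (extChartAt (𝓡 3) x x)] chartVF x Y := fun Y => by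
    filter_upwards [target_mem_nhds (mem_extChartAt_target x)] with y hy
    have := chartD_eq_inverse hy
    rw [chartInvD_eq_within] at this
    rw [hP]
    exact congrArg (fun L : E3 →L[ℝ] E3 => L (Y ((extChartAt (𝓡 3) x).symm y))) this
  have h1 : lieVF ξ X x = (chartD x x).inverse
      (VectorField.lieBracketWithin ℝ (P ξ) (P X)
      ((extChartAt (𝓡 3) x).symm ⁻¹' Set.univ ∩ Set.range (𝓡 3)) (extChartAt (𝓡 3) x x)) := by
    rw [hP]; rfl
  rw [h1, chartD_self, ContinuousLinearMap.inverse_id, Set.preimage_univ, Set.univ_inter, hr,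
    VectorField.lieBracketWithin_univ]
  exact (hp ξ).lieBracket_vectorField_eq (hp X)

theorem repr_lieVF {ξ X : VF M} (hξ : SmoothVF ξ) (hX : SmoothVF X) (x : M) (i : Fin 3) :
    stdFrame.repr (lieVF ξ X x) i
      = ∑ j, (stdFrame.repr (ξ x) j * pd x (fun y => stdFrame.repr (chartVF x X y) i) j
        - stdFrame.repr (X x) j * pd x (fun y => stdFrame.repr (chartVF x ξ y) i) j) := by
  rw [lieVF_eq, VectorField.lieBracket, map_sub, Finsupp.sub_apply, chartVF_self, chartVF_self]
  have h : ∀ {Y : VF M} (hY : SmoothVF Y) (u : E3), stdFrame.repr (fderiv ℝ (chartVF x Y)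
      (extChartAt (𝓡 3) x x) u) i
        = ∑ j, stdFrame.repr u j * pd x (fun y => stdFrame.repr (chartVF x Y y) i) j := by
    intro Y hY u
    conv_lhs => rw [← stdFrame.sum_repr u]
    rw [map_sum, map_sum, Finsupp.finsetSum_apply]
    simp only [map_smul, Finsupp.smul_apply, smul_eq_mul, repr_fderiv_chartVF hY]
  rw [h hX, h hξ, Finset.sum_sub_distrib]

/-- The Lie derivative of `X ⌟ vol`. -/
theorem lieForm_inner1_vol {ξ X : VF M} {vol : Form M 3} (hξ : SmoothVF ξ) (hX : SmoothVF X)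
    (hvol : SmoothForm vol) (hv : ∀ x, vol x ≠ 0) :
    lieForm ξ (inner1 X vol)
      = inner1 (fun x => lieVF ξ X x + divergence vol ξ x • X x) vol := by
  funext x
  refine ext_comp2 stdFrame fun i => ?_
  have hin : ∀ (Y : VF M) i j, pd x (fun y => comp2 stdFrame (chartForm x (inner1 Y vol) y) i) j
      = pd x (fun y => stdFrame.repr (chartVF x Y y) i * comp3 stdFrame (chartForm x vol y)) j :=
    fun Y i j => pd_congr (fun y hy => by rw [chartForm_inner1 Y vol hy, comp2_inner1]) j
  have h0 := comp3_ne_zero stdFrame (hv x)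
  rw [comp2_lieForm hξ (SmoothForm.inner3 hX hvol), comp2_inner1]
  simp only [map_add, map_smul, Finsupp.add_apply, Finsupp.smul_apply, smul_eq_mul,
    repr_lieVF hξ hX, divergence, ratio_eq stdFrame, comp3_extD (SmoothForm.inner3 hξ hvol), hin,
    comp2_inner1,
    pd_mul (hξ.diffAt_repr x _) (hvol.diffAt_comp3 x),
    pd_mul (hX.diffAt_repr x _) (hvol.diffAt_comp3 x), chartForm_self, chartVF_self,
    Fin.sum_univ_three]
  field_simp
  ring

end Lie

end

/-! ### Integration on the closed manifold and Stokes' theorem -/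

section

open MeasureTheory

/-! ### Functions with compact support in an open subset of `ℝ³` -/

section CompactSupport

variable {U K : Set E3} {g σ : E3 → ℝ}

theorem eventually_indicator_zero (hK : IsCompact K) (h0 : ∀ y ∈ U, y ∉ K → g y = 0) {y : E3}
    (hy : y ∉ K) : U.indicator (fun z => σ z * g z) =ᶠ[𝓝 y] fun _ => 0 := by
  filter_upwards [hK.isClosed.isOpen_compl.mem_nhds hy] with z hz
  by_cases hzU : z ∈ U
  · simp [hzU, h0 z hzU hz]
  · simp [hzU]

theorem eventually_indicator_mul (hU : IsOpen U) (hσ : ∀ y ∈ U, ∀ᶠ z in 𝓝 y, σ z = σ y) {y : E3}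
    (hy : y ∈ U) : U.indicator (fun z => σ z * g z) =ᶠ[𝓝 y] fun z => σ y * g z := by
  filter_upwards [hU.mem_nhds hy, hσ y hy] with z hz hs
  simp [hz, hs]

/-- `σ` is to be the orientation sign of a chart. Near a point of `K` it is constant and the
function is a constant multiple of `g`. Near any other point, including those outside `U`, the
function is identically zero because `K` is closed. -/
theorem contDiff_indicator (hU : IsOpen U) (hK : IsCompact K) (hKU : K ⊆ U)
    (hg : ContDiffOn ℝ ∞ g U) (h0 : ∀ y ∈ U, y ∉ K → g y = 0)
    (hσ : ∀ y ∈ U, ∀ᶠ z in 𝓝 y, σ z = σ y) :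
    ContDiff ℝ ∞ (U.indicator fun z => σ z * g z) := by
  rw [contDiff_iff_contDiffAt]
  intro y
  by_cases hy : y ∈ K
  · exact (contDiffAt_const.mul (hg.contDiffAt (hU.mem_nhds (hKU hy)))).congr_of_eventuallyEq
      (eventually_indicator_mul hU hσ (hKU hy))
  · exact contDiffAt_const.congr_of_eventuallyEq (eventually_indicator_zero hK h0 hy)

theorem hasCompactSupport_indicator (hK : IsCompact K) (h0 : ∀ y ∈ U, y ∉ K → g y = 0) :
    HasCompactSupport (U.indicator fun z => σ z * g z) :=
  HasCompactSupport.intro hK fun _ hy => (eventually_indicator_zero hK h0 hy).self_of_nhds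

theorem integrableOn_of_compact (hU : IsOpen U) (hK : IsCompact K) (hKU : K ⊆ U)
    (hg : ContDiffOn ℝ ∞ g U) (h0 : ∀ y ∈ U, y ∉ K → g y = 0)
    (hσ : ∀ y ∈ U, ∀ᶠ z in 𝓝 y, σ z = σ y) : IntegrableOn (fun z => σ z * g z) U := by
  rw [← integrable_indicator_iff hU.measurableSet]
  exact (contDiff_indicator hU hK hKU hg h0 hσ).continuous.integrable_of_hasCompactSupport
    (hasCompactSupport_indicator hK h0)

/-- Integration by parts against the constant function 1. -/
theorem integral_fderiv_eq_zero {G : E3 → ℝ} (hG : ContDiff ℝ ∞ G) (hc : HasCompactSupport G)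
    (w : E3) : ∫ y, fderiv ℝ G y w = 0 := by
  have hi : Integrable fun y => fderiv ℝ G y w :=
    ((hG.continuous_fderiv (by simp)).clm_apply continuous_const).integrable_of_hasCompactSupport
      (hc.fderiv_apply (𝕜 := ℝ) w)
  have := integral_mul_fderiv_eq_neg_fderiv_mul_of_integrable (f := fun _ : E3 => (1 : ℝ)) (g := G)
    (v := w) (μ := volume) (by simp) (by simpa using hi)
    (by simpa using hG.continuous.integrable_of_hasCompactSupport hc)
    (fun _ _ => differentiableAt_const _) (fun y _ => (hG.differentiable (by simp)) y)
  simpa using this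

theorem setIntegral_fderiv_eq_zero (hU : IsOpen U) (hK : IsCompact K) (hKU : K ⊆ U)
    (hg : ContDiffOn ℝ ∞ g U) (h0 : ∀ y ∈ U, y ∉ K → g y = 0)
    (hσ : ∀ y ∈ U, ∀ᶠ z in 𝓝 y, σ z = σ y) (w : E3) :
    ∫ y in U, σ y * fderiv ℝ g y w = 0 := by
  rw [← integral_indicator hU.measurableSet, ← integral_fderiv_eq_zero
    (contDiff_indicator hU hK hKU hg h0 hσ) (hasCompactSupport_indicator hK h0) w]
  congr 1
  funext y
  by_cases hy : y ∈ U
  · rw [(eventually_indicator_mul hU hσ hy).fderiv_eq, Set.indicator_of_mem hy,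
      fderiv_const_mul ((hg.contDiffAt (hU.mem_nhds hy)).differentiableAt (by simp))]
    simp
  · rw [(eventually_indicator_zero hK h0 fun h => hy (hKU h)).fderiv_eq,
      Set.indicator_of_notMem hy]
    simp

theorem fderiv_eq_zero_of_notMem (hU : IsOpen U) (hK : IsCompact K)
    (h0 : ∀ y ∈ U, y ∉ K → g y = 0) (w : E3) : ∀ y ∈ U, y ∉ K → fderiv ℝ g y w = 0 := by
  intro y hy hyK
  have : g =ᶠ[𝓝 y] fun _ => 0 := by
    filter_upwards [hU.mem_nhds hy, hK.isClosed.isOpen_compl.mem_nhds hyK] with z h1 h2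
      using h0 z h1 h2
  rw [this.fderiv_eq]
  simp

theorem eq_zero_of_setIntegral_eq_zero (hU : IsOpen U) (hK : IsCompact K) (hKU : K ⊆ U)
    (hg : ContDiffOn ℝ ∞ g U) (h0 : ∀ y ∈ U, y ∉ K → g y = 0)
    (hσ : ∀ y ∈ U, ∀ᶠ z in 𝓝 y, σ z = σ y) (hpos : ∀ y ∈ U, 0 ≤ σ y * g y)
    (hint : ∫ y in U, σ y * g y = 0) : ∀ y ∈ U, σ y * g y = 0 := by
  intro y hy
  by_contra hne
  rw [← integral_indicator hU.measurableSet] at hint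
  have := (contDiff_indicator hU hK hKU hg h0 hσ).continuous.integral_pos_of_hasCompactSupport_nonneg_nonzero
    (μ := volume) (x := y) (hasCompactSupport_indicator hK h0) (Set.indicator_nonneg hpos)
    (by simpa [hy] using hne)
  exact this.ne' hint

end CompactSupport

section Integral

variable {M : Type*} [TopologicalSpace M] [ChartedSpace E3 M] [IsManifold (𝓡 3) ∞ M]

/-- The integral of a 3-form over a chart domain. -/
def chartIntegral (vol : Form M 3) (c : M) (b : Form M 3) : ℝ :=
  ∫ y in (extChartAt (𝓡 3) c).target,
    (SignType.sign (comp3 stdFrame (chartForm c vol y)) : ℝ) * comp3 stdFrame (chartForm c b y)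

/-- A form which vanishes outside of a compact subset of the chart domain at `c`. -/
def SupportedIn {k : ℕ} (c : M) (b : Form M k) : Prop :=
  ∃ K : Set E3, IsCompact K ∧ K ⊆ (extChartAt (𝓡 3) c).target ∧
    ∀ y ∈ (extChartAt (𝓡 3) c).target, y ∉ K → b ((extChartAt (𝓡 3) c).symm y) = 0

theorem chartForm_eq_zero {k : ℕ} {c : M} {b : Form M k} {y : E3}
    (h : b ((extChartAt (𝓡 3) c).symm y) = 0) : chartForm c b y = 0 := by
  rw [chartForm, h]; rfl

/-- Away from zero the sign is continuous, and its values form a discrete set. -/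
theorem sign_locally_constant {vol : Form M 3} (hvol : SmoothForm vol) (hv : ∀ x, vol x ≠ 0)
    (c : M) : ∀ y ∈ (extChartAt (𝓡 3) c).target,
      ∀ᶠ z in 𝓝 y, (SignType.sign (comp3 stdFrame (chartForm c vol z)) : ℝ)
        = (SignType.sign (comp3 stdFrame (chartForm c vol y)) : ℝ) := by
  intro y hy
  have h1 : ContinuousAt (fun z => comp3 stdFrame (chartForm c vol z)) y :=
    ((smoothForm3_iff.1 hvol c).contDiffAt (target_mem_nhds hy)).continuousAt
  have h2 := (continuousAt_sign_of_ne_zero (comp3_chartForm_ne_zero hv hy)).comp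
    (f := fun z => comp3 stdFrame (chartForm c vol z)) h1
  have h3 : ∀ᶠ z in 𝓝 y, SignType.sign (comp3 stdFrame (chartForm c vol z))
      ∈ ({SignType.sign (comp3 stdFrame (chartForm c vol y))} : Set SignType) :=
    h2.eventually_mem ((isOpen_discrete _).mem_nhds rfl)
  filter_upwards [h3] with z hz
  rw [show SignType.sign (comp3 stdFrame (chartForm c vol z)) = _ from hz]

variable {vol : Form M 3}

theorem chartIntegrable (hvol : SmoothForm vol) (hv : ∀ x, vol x ≠ 0) {c : M} {b : Form M 3}
    (hb : SmoothForm b) (hs : SupportedIn c b) :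
    IntegrableOn (fun y => (SignType.sign (comp3 stdFrame (chartForm c vol y)) : ℝ) *
      comp3 stdFrame (chartForm c b y)) (extChartAt (𝓡 3) c).target := by
  obtain ⟨K, hK, hKU, h0⟩ := hs
  exact integrableOn_of_compact (isOpen_extChartAt_target c) hK hKU (smoothForm3_iff.1 hb c)
    (fun y hy hyK => by rw [chartForm_eq_zero (h0 y hy hyK)]; rfl) (sign_locally_constant hvol hv c)

theorem chartIntegral_add (hvol : SmoothForm vol) (hv : ∀ x, vol x ≠ 0) {c : M} {a b : Form M 3}
    (ha : SmoothForm a) (hsa : SupportedIn c a) (hb : SmoothForm b) (hsb : SupportedIn c b) :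
    chartIntegral vol c (a + b) = chartIntegral vol c a + chartIntegral vol c b := by
  rw [chartIntegral, chartIntegral, chartIntegral,
    ← integral_add (chartIntegrable hvol hv ha hsa) (chartIntegrable hvol hv hb hsb)]
  congr 1
  funext y
  rw [chartForm_add, Pi.add_apply, comp3_add, mul_add]

theorem chartIntegral_smul (r : ℝ) {c : M} (b : Form M 3) :
    chartIntegral vol c (r • b) = r * chartIntegral vol c b := by
  rw [chartIntegral, chartIntegral, ← integral_const_mul]
  congr 1
  funext y
  change _ * (r * comp3 stdFrame (chartForm c b y)) = _
  ring

theorem chartIntegral_zero (c : M) : chartIntegral vol c 0 = 0 := by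
  simpa using chartIntegral_smul (vol := vol) (c := c) 0 0

theorem SupportedIn.add {k : ℕ} {c : M} {a b : Form M k} (ha : SupportedIn c a)
    (hb : SupportedIn c b) : SupportedIn c (a + b) := by
  obtain ⟨K, hK, hKU, h0⟩ := ha
  obtain ⟨L, hL, hLU, h1⟩ := hb
  refine ⟨K ∪ L, hK.union hL, Set.union_subset hKU hLU, fun y hy hn => ?_⟩
  rw [Pi.add_apply, h0 y hy fun h => hn (Or.inl h), h1 y hy fun h => hn (Or.inr h), add_zero]

theorem SupportedIn.sum {k : ℕ} {ι : Type*} {s : Finset ι} {c : M} {a : ι → Form M k}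
    (h : ∀ i ∈ s, SupportedIn c (a i)) : SupportedIn c (∑ i ∈ s, a i) := by
  classical
  induction s using Finset.induction_on with
  | empty => exact ⟨∅, isCompact_empty, Set.empty_subset _, fun _ _ _ => by simp⟩
  | insert i s hi ih =>
    rw [Finset.sum_insert hi]
    exact (h i (Finset.mem_insert_self i s)).add
      (ih fun j hj => h j (Finset.mem_insert_of_mem hj))

theorem SupportedIn.fmul {k : ℕ} {c : M} {a : Form M k} (f : M → ℝ) (ha : SupportedIn c a) :
    SupportedIn c (fmul f a) := by
  obtain ⟨K, hK, hKU, h0⟩ := ha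
  exact ⟨K, hK, hKU, fun y hy hn => by rw [HK.fmul, h0 y hy hn, smul_zero]⟩

theorem chartIntegral_sum (hvol : SmoothForm vol) (hv : ∀ x, vol x ≠ 0) {ι : Type*} {s : Finset ι}
    {c : M} {a : ι → Form M 3} (ha : ∀ i ∈ s, SmoothForm (a i))
    (hs : ∀ i ∈ s, SupportedIn c (a i)) :
    chartIntegral vol c (∑ i ∈ s, a i) = ∑ i ∈ s, chartIntegral vol c (a i) := by
  classical
  induction s using Finset.induction_on with
  | empty => simpa using chartIntegral_zero c
  | insert i s hi ih =>
    rw [Finset.sum_insert hi, Finset.sum_insert hi, chartIntegral_add hvol hv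
      (ha i (Finset.mem_insert_self i s)) (hs i (Finset.mem_insert_self i s))
      (SmoothForm.sum fun j hj => ha j (Finset.mem_insert_of_mem hj))
      (SupportedIn.sum fun j hj => hs j (Finset.mem_insert_of_mem hj)),
      ih (fun j hj => ha j (Finset.mem_insert_of_mem hj))
        (fun j hj => hs j (Finset.mem_insert_of_mem hj))]

/-- Stokes' theorem for a form supported in a chart domain. -/
theorem chartIntegral_extD (hvol : SmoothForm vol) (hv : ∀ x, vol x ≠ 0) {c : M} {b : Form M 2}
    (hb : SmoothForm b) (hs : SupportedIn c b) : chartIntegral vol c (extD b) = 0 := by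
  obtain ⟨K, hK, hKU, h0⟩ := hs
  have hU := isOpen_extChartAt_target (I := 𝓡 3) c
  have h0' : ∀ i, ∀ y ∈ (extChartAt (𝓡 3) c).target, y ∉ K →
      comp2 stdFrame (chartForm c b y) i = 0 := fun i y hy hyK => by
    rw [chartForm_eq_zero (h0 y hy hyK)]; rfl
  have hσ := sign_locally_constant hvol hv c
  have h1 : chartIntegral vol c (extD b) = ∫ y in (extChartAt (𝓡 3) c).target,
      ∑ i, (SignType.sign (comp3 stdFrame (chartForm c vol y)) : ℝ) *
        fderiv ℝ (fun z => comp2 stdFrame (chartForm c b z) i) y (stdB i) := by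
    refine setIntegral_congr_fun hU.measurableSet fun y hy => ?_
    beta_reduce
    rw [chartForm_extD hb hy, comp3_extDeriv ((hb.contDiffAt hy).differentiableAt (by simp)),
      Finset.mul_sum]
  rw [h1, integral_finsetSum]
  · exact Finset.sum_eq_zero fun i _ => setIntegral_fderiv_eq_zero hU hK hKU
      (smoothForm2_iff.1 hb c i) (h0' i) hσ (stdB i)
  · exact fun i _ => integrableOn_of_compact hU hK hKU
      (ContDiffOn.fderiv_apply_const hU (smoothForm2_iff.1 hb c i) (stdB i))
      (fderiv_eq_zero_of_notMem hU hK (h0' i) (stdB i)) hσ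

theorem SupportedIn.extD {c : M} {k : ℕ} {b : Form M k} (hb : SmoothForm b) (hs : SupportedIn c b) :
    SupportedIn c (extD b) := by
  obtain ⟨K, hK, hKU, h0⟩ := hs
  refine ⟨K, hK, hKU, fun y hy hyK => ?_⟩
  have h1 : chartForm c (HK.extD b) y = 0 := by
    rw [chartForm_extD hb hy]
    have : chartForm c b =ᶠ[𝓝 y] 0 := by
      filter_upwards [target_mem_nhds hy, hK.isClosed.isOpen_compl.mem_nhds hyK] with z h1 h2
        using chartForm_eq_zero (h0 z h1 h2)
    rw [this.extDeriv_eq]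
    ext w
    simp [extDeriv, ContinuousAlternatingMap.alternatizeUncurryFin_apply]
  ext w
  have h2 := congrArg (fun B => B fun i => chartD c ((extChartAt (𝓡 3) c).symm y) (w i)) h1
  have h := chartInvD_comp_chartD hy
  simp only [chartForm, ContinuousAlternatingMap.compContinuousLinearMap_apply] at h2
  refine Eq.trans ?_ h2
  congr 1
  funext i
  exact (congrArg (fun L : E3 →L[ℝ] E3 => L (w i)) h).symm

theorem comp3_compContinuousLinearMap (b : E3 [⋀^Fin 3]→L[ℝ] ℝ) (L : E3 →L[ℝ] E3) :
    comp3 stdFrame (b.compContinuousLinearMap L) = comp3 stdFrame b * L.det := by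
  have := stdFrame.det_comp (L : E3 →ₗ[ℝ] E3) stdFrame
  rw [stdFrame.det_self, mul_one] at this
  rw [ContinuousLinearMap.det, ← this, ← form3_apply]
  rfl

/-- The integrals of a form over two chart domains agree if it vanishes outside of both. -/
theorem chartIntegral_eq {c c' : M} {b : Form M 3}
    (h : ∀ x, x ∉ (extChartAt (𝓡 3) c).source → b x = 0)
    (h' : ∀ x, x ∉ (extChartAt (𝓡 3) c').source → b x = 0) :
    chartIntegral vol c b = chartIntegral vol c' b := by
  set S : M → M → Set E3 := fun c c' =>
    (extChartAt (𝓡 3) c).target ∩ (extChartAt (𝓡 3) c).symm ⁻¹' (extChartAt (𝓡 3) c').source with hS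
  have hopen : ∀ c c', IsOpen (S c c') := fun c c' =>
    (continuousOn_extChartAt_symm c).isOpen_inter_preimage (isOpen_extChartAt_target c)
      (isOpen_extChartAt_source c')
  have hres : ∀ c c' : M, (∀ x, x ∉ (extChartAt (𝓡 3) c').source → b x = 0) →
      chartIntegral vol c b = ∫ y in S c c',
        (SignType.sign (comp3 stdFrame (chartForm c vol y)) : ℝ) *
          comp3 stdFrame (chartForm c b y) := fun c c' h => by
    have ht : IsOpen (extChartAt (𝓡 3) c).target := isOpen_extChartAt_target c
    refine setIntegral_eq_of_subset_of_forall_sdiff_eq_zero ht.measurableSet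
      Set.inter_subset_left fun y hy => ?_
    have : (extChartAt (𝓡 3) c).symm y ∉ (extChartAt (𝓡 3) c').source := fun hy' =>
      hy.2 ⟨hy.1, hy'⟩
    rw [chartForm_eq_zero (h _ this), comp3_zero, mul_zero]
  rw [hres c c' h', hres c' c h]
  -- Only the overlap of the two chart domains contributes, and the transition map carries its copy
  -- in one chart onto its copy in the other, so the change of variables formula applies.
  have himg : transition c c' '' S c' c = S c c' := by
    ext y
    constructor
    · rintro ⟨z, ⟨hz, hz'⟩, rfl⟩
      refine ⟨(extChartAt (𝓡 3) c).map_source hz', ?_⟩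
      rw [Set.mem_preimage, transition, (extChartAt (𝓡 3) c).left_inv hz']
      exact (extChartAt (𝓡 3) c').map_target hz
    · rintro ⟨hy, hy'⟩
      refine ⟨transition c' c y, ⟨(extChartAt (𝓡 3) c').map_source hy', ?_⟩, ?_⟩
      · rw [Set.mem_preimage, transition, (extChartAt (𝓡 3) c').left_inv hy']
        exact (extChartAt (𝓡 3) c).map_target hy
      · rw [transition, transition, (extChartAt (𝓡 3) c').left_inv hy',
          (extChartAt (𝓡 3) c).right_inv hy]
  have hinj : Set.InjOn (transition c c') (S c' c) := by
    intro y hy z hz hyz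
    have := (extChartAt (𝓡 3) c).injOn hy.2 hz.2 hyz
    exact (extChartAt (𝓡 3) c').symm.injOn hy.1 hz.1 this
  have hder : ∀ z ∈ S c' c, HasFDerivWithinAt (transition c c')
      (fderiv ℝ (transition c c') z) (S c' c) z := fun z hz =>
    ((contDiffAt_transition hz.1 hz.2).differentiableAt (by simp)).hasFDerivAt.hasFDerivWithinAt
  rw [← himg, integral_image_eq_integral_abs_det_fderiv_smul volume (hopen c' c).measurableSet
    hder hinj]
  refine setIntegral_congr_fun (hopen c' c).measurableSet fun z hz => ?_
  simp only [smul_eq_mul]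
  -- The volume form and `b` both pick up the determinant of the transition map. The sign of that
  -- determinant times the determinant is its absolute value, which is the Jacobian.
  rw [chartForm_transition vol hz.1 hz.2, chartForm_transition b hz.1 hz.2,
    comp3_compContinuousLinearMap, comp3_compContinuousLinearMap, sign_mul, ← sign_mul_self]
  push_cast
  ring

variable [T2Space M] [CompactSpace M]

theorem chartPartition_subordinate :
    (chartPartition M).IsSubordinate (fun x => (chartAt E3 x).source) :=
  Classical.choose_spec (SmoothPartitionOfUnity.exists_isSubordinate_chartAt_source (𝓡 3) M)

/-- The indices of the non-zero functions of the partition of unity. -/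
def partIdx (M : Type*) [TopologicalSpace M] [ChartedSpace E3 M] [T2Space M]
    [CompactSpace M] [IsManifold (𝓡 3) ∞ M] : Finset M :=
  ((chartPartition M).locallyFinite.finite_nonempty_of_compact).toFinset

theorem chartPartition_eq_zero {c : M} (hc : c ∉ partIdx M) (x : M) : chartPartition M c x = 0 := by
  by_contra h
  exact hc ((Set.Finite.mem_toFinset _).2 ⟨x, h⟩)

theorem chartPartition_smooth (c : M) : SmoothFun (chartPartition M c) :=
  (chartPartition M c).contMDiff

theorem sum_chartPartition (x : M) : ∑ c ∈ partIdx M, chartPartition M c x = 1 := by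
  rw [← (chartPartition M).sum_eq_one (Set.mem_univ x)]
  refine (finsum_eq_sum_of_support_subset _ fun c hc => ?_).symm
  by_contra h
  exact hc (chartPartition_eq_zero h x)

/-- On a compact manifold the closed support of a partition function is compact, and subordination
places it inside the chart domain. -/
theorem supportedIn_chartPartition {k : ℕ} (c : M) (b : Form M k) :
    SupportedIn c (fmul (chartPartition M c) b) := by
  have hsub : tsupport (chartPartition M c) ⊆ (extChartAt (𝓡 3) c).source := by
    simpa using chartPartition_subordinate (M := M) c
  refine ⟨extChartAt (𝓡 3) c '' tsupport (chartPartition M c), ?_, ?_, fun y hy hn => ?_⟩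
  · exact (isClosed_tsupport _).isCompact.image_of_continuousOn
      ((continuousOn_extChartAt c).mono hsub)
  · rintro _ ⟨x, hx, rfl⟩
    exact (extChartAt (𝓡 3) c).map_source (hsub hx)
  · have : (extChartAt (𝓡 3) c).symm y ∉ tsupport (chartPartition M c) := fun h =>
      hn ⟨_, h, (extChartAt (𝓡 3) c).right_inv hy⟩
    rw [HK.fmul, image_eq_zero_of_notMem_tsupport this, zero_smul]

theorem fmul_chartPartition_eq_zero {k : ℕ} (c : M) (b : Form M k) (x : M)
    (hx : x ∉ (extChartAt (𝓡 3) c).source) : fmul (chartPartition M c) b x = 0 := by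
  have hsub : tsupport (chartPartition M c) ⊆ (extChartAt (𝓡 3) c).source := by
    simpa using chartPartition_subordinate (M := M) c
  rw [HK.fmul, image_eq_zero_of_notMem_tsupport fun h => hx (hsub h), zero_smul]

theorem extD_fmul_chartPartition_eq_zero {k : ℕ} (c : M) (b : Form M k) (x : M)
    (hx : x ∉ (extChartAt (𝓡 3) c).source) : extD (fmul (chartPartition M c) b) x = 0 := by
  have hsub : tsupport (chartPartition M c) ⊆ (extChartAt (𝓡 3) c).source := by
    simpa using chartPartition_subordinate (M := M) c
  rw [extD_apply]
  have : chartForm x (fmul (chartPartition M c) b) =ᶠ[𝓝 (extChartAt (𝓡 3) x x)] 0 := by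
    have hn : ∀ᶠ p in 𝓝 x, p ∉ tsupport (chartPartition M c) :=
      (isClosed_tsupport _).isOpen_compl.mem_nhds fun h => hx (hsub h)
    have hc := continuousAt_extChartAt_symm (I := 𝓡 3) x
    rw [ContinuousAt, extChartAt_to_inv] at hc
    filter_upwards [hc.eventually hn] with y hy
    apply chartForm_eq_zero
    rw [HK.fmul, image_eq_zero_of_notMem_tsupport hy, zero_smul]
  rw [this.extDeriv_eq]
  ext w
  simp [extDeriv, ContinuousAlternatingMap.alternatizeUncurryFin_apply]

theorem integral_eq_sum (vol b : Form M 3) :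
    integral vol b = ∑ c ∈ partIdx M, chartIntegral vol c (fmul (chartPartition M c) b) := by
  have h : ∀ c : M, (∫ y in (extChartAt (𝓡 3) c).target,
      chartPartition M c ((extChartAt (𝓡 3) c).symm y) *
        ((SignType.sign (chartForm c vol y stdB) : ℝ) * chartForm c b y stdB))
      = chartIntegral vol c (fmul (chartPartition M c) b) := fun c => by
    rw [chartIntegral]
    congr 1
    funext y
    rw [chartForm_fmul, comp3_fmul, comp3, comp3, coe_stdFrame]
    ring
  rw [integral]
  simp_rw [h]
  refine finsum_eq_sum_of_support_subset _ fun c hc => ?_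
  by_contra hn
  apply hc
  have : fmul (chartPartition M c) b = 0 := by
    funext x
    rw [HK.fmul, chartPartition_eq_zero hn, zero_smul]; rfl
  change chartIntegral vol c (fmul (chartPartition M c) b) = 0
  rw [this, chartIntegral_zero]

theorem integral_add' (hvol : SmoothForm vol) (hv : ∀ x, vol x ≠ 0) {a b : Form M 3}
    (ha : SmoothForm a) (hb : SmoothForm b) :
    integral vol (a + b) = integral vol a + integral vol b := by
  rw [integral_eq_sum, integral_eq_sum, integral_eq_sum, ← Finset.sum_add_distrib]
  refine Finset.sum_congr rfl fun c _ => ?_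
  rw [← chartIntegral_add hvol hv (SmoothForm.fmul (chartPartition_smooth c) ha)
    (supportedIn_chartPartition c a) (SmoothForm.fmul (chartPartition_smooth c) hb)
    (supportedIn_chartPartition c b)]
  congr 1
  funext x
  simp [HK.fmul]

theorem integral_smul' (r : ℝ) (b : Form M 3) : integral vol (r • b) = r * integral vol b := by
  rw [integral_eq_sum, integral_eq_sum, Finset.mul_sum]
  refine Finset.sum_congr rfl fun c _ => ?_
  rw [← chartIntegral_smul]
  congr 1
  funext x
  exact smul_comm (chartPartition M c x) r (b x)

theorem sum_fmul_chartPartition {k : ℕ} (b : Form M k) :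
    ∑ c ∈ partIdx M, fmul (chartPartition M c) b = b := by
  funext x
  simp only [Finset.sum_apply, HK.fmul]
  rw [← Finset.sum_smul, sum_chartPartition, one_smul]

/-- Stokes' theorem on a closed manifold. -/
theorem integral_extD (hvol : SmoothForm vol) (hv : ∀ x, vol x ≠ 0) {b : Form M 2}
    (hb : SmoothForm b) : integral vol (extD b) = 0 := by
  have hsm : ∀ c, SmoothForm (extD (fmul (chartPartition M c) b)) := fun c =>
    (SmoothForm.fmul (chartPartition_smooth c) hb).extD
  have hd : extD b = ∑ c ∈ partIdx M, extD (fmul (chartPartition M c) b) := by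
    rw [← extD_sum fun c _ => SmoothForm.fmul (chartPartition_smooth c) hb,
      sum_fmul_chartPartition]
  have h1 : ∀ c, fmul (chartPartition M c) (extD b)
      = ∑ c' ∈ partIdx M, fmul (chartPartition M c) (extD (fmul (chartPartition M c') b)) := by
    intro c
    funext x
    simp only [Finset.sum_apply, HK.fmul]
    rw [← Finset.smul_sum, ← Finset.sum_apply]
    exact congrArg (fun B : Form M 3 => chartPartition M c x • B x) hd
  rw [integral_eq_sum]
  -- The form ρ_c d(ρ_{c'} b) vanishes outside both chart domains, so its integral may be moved from
  -- the chart at `c` to that at `c'`. Summing over `c` then removes ρ_c, and Stokes' theorem is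
  -- needed in one chart only.
  have h2 : ∀ c, chartIntegral vol c (fmul (chartPartition M c) (extD b))
      = ∑ c' ∈ partIdx M, chartIntegral vol c'
        (fmul (chartPartition M c) (extD (fmul (chartPartition M c') b))) := by
    intro c
    rw [h1, chartIntegral_sum hvol hv
      (fun c' _ => SmoothForm.fmul (chartPartition_smooth c) (hsm c'))
      (fun c' _ => supportedIn_chartPartition c _)]
    refine Finset.sum_congr rfl fun c' _ => chartIntegral_eq
      (fun x hx => fmul_chartPartition_eq_zero c _ x hx) fun x hx => ?_
    rw [HK.fmul, extD_fmul_chartPartition_eq_zero c' b x hx, smul_zero]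
  simp_rw [h2]
  rw [Finset.sum_comm]
  refine Finset.sum_eq_zero fun c' _ => ?_
  have hs : SupportedIn c' (extD (fmul (chartPartition M c') b)) :=
    SupportedIn.extD (SmoothForm.fmul (chartPartition_smooth c') hb) (supportedIn_chartPartition c' b)
  rw [← chartIntegral_sum hvol hv (fun c _ => SmoothForm.fmul (chartPartition_smooth c) (hsm c'))
    (fun c _ => hs.fmul _), sum_fmul_chartPartition]
  exact chartIntegral_extD hvol hv (SmoothForm.fmul (chartPartition_smooth c') hb)
    (supportedIn_chartPartition c' b)

/-- A nonnegative smooth function with zero integral vanishes. -/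
theorem eq_zero_of_integral_eq_zero (hvol : SmoothForm vol) (hv : ∀ x, vol x ≠ 0) {f : M → ℝ}
    (hf : SmoothFun f) (hpos : ∀ x, 0 ≤ f x) (hint : integral vol (fmul f vol) = 0) (x : M) :
    f x = 0 := by
  have hsm : ∀ c : M, SmoothForm (fmul (chartPartition M c) (fmul f vol)) := fun c =>
    SmoothForm.fmul (chartPartition_smooth c) (SmoothForm.fmul hf hvol)
  -- The orientation sign turns the coordinate volume into its absolute value. Every chart then
  -- contributes a nonnegative integral, so all of them vanish with their sum.
  have hval : ∀ (c : M) (y : E3), (SignType.sign (comp3 stdFrame (chartForm c vol y)) : ℝ) *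
      comp3 stdFrame (chartForm c (fmul (chartPartition M c) (fmul f vol)) y)
      = chartPartition M c ((extChartAt (𝓡 3) c).symm y) * f ((extChartAt (𝓡 3) c).symm y) *
        |comp3 stdFrame (chartForm c vol y)| := fun c y => by
    rw [chartForm_fmul, chartForm_fmul, comp3_fmul, comp3_fmul, ← sign_mul_self]
    ring
  have hnn : ∀ (c : M) (y : E3), 0 ≤ (SignType.sign (comp3 stdFrame (chartForm c vol y)) : ℝ) *
      comp3 stdFrame (chartForm c (fmul (chartPartition M c) (fmul f vol)) y) := fun c y => by
    rw [hval]
    exact mul_nonneg (mul_nonneg ((chartPartition M).nonneg c _) (hpos _)) (abs_nonneg _)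
  rw [integral_eq_sum, Finset.sum_eq_zero_iff_of_nonneg (f := fun c => chartIntegral vol c
    (fmul (chartPartition M c) (fmul f vol))) fun c _ =>
    setIntegral_nonneg (isOpen_extChartAt_target c).measurableSet fun y _ => hnn c y] at hint
  have key : ∀ c ∈ partIdx M, chartPartition M c x * f x = 0 := by
    intro c hc
    by_cases hx : x ∈ (extChartAt (𝓡 3) c).source
    · obtain ⟨K, hK, hKU, h0⟩ := supportedIn_chartPartition c (fmul f vol)
      have := eq_zero_of_setIntegral_eq_zero (isOpen_extChartAt_target c) hK hKU
        (smoothForm3_iff.1 (hsm c) c)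
        (fun y hy hyK => by rw [chartForm_eq_zero (h0 y hy hyK)]; rfl)
        (sign_locally_constant hvol hv c) (fun y _ => hnn c y) (hint c hc)
        (extChartAt (𝓡 3) c x) ((extChartAt (𝓡 3) c).map_source hx)
      rw [hval, (extChartAt (𝓡 3) c).left_inv hx] at this
      exact (mul_eq_zero.1 this).resolve_right (abs_ne_zero.2
        (comp3_chartForm_ne_zero hv ((extChartAt (𝓡 3) c).map_source hx)))
    · have := fmul_chartPartition_eq_zero c vol x hx
      rw [HK.fmul, smul_eq_zero] at this
      rw [this.resolve_right (hv x), zero_mul]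
  have h1 := sum_chartPartition x
  calc f x = (∑ c ∈ partIdx M, chartPartition M c x) * f x := by rw [h1, one_mul]
    _ = 0 := by rw [Finset.sum_mul]; exact Finset.sum_eq_zero key

end Integral

end

/-! ### Bilinear products, ε-contractions and first-order variations -/

section

section Bilinear

variable {M : Type*} {k : ℕ}

theorem wedge_add (a : Form M 1) (b c : Form M k) : wedge a (b + c) = wedge a b + wedge a c := by
  funext x; ext w
  rw [Pi.add_apply, ContinuousAlternatingMap.add_apply]
  simp only [wedge_apply, Pi.add_apply, ContinuousAlternatingMap.add_apply, mul_add,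
    Finset.sum_add_distrib]

theorem add_wedge (a b : Form M 1) (c : Form M k) : wedge (a + b) c = wedge a c + wedge b c := by
  funext x; ext w
  rw [Pi.add_apply, ContinuousAlternatingMap.add_apply]
  simp only [wedge_apply, Pi.add_apply, ContinuousAlternatingMap.add_apply, add_mul, mul_add,
    Finset.sum_add_distrib]

theorem wedge_smul (r : ℝ) (a : Form M 1) (b : Form M k) : wedge a (r • b) = r • wedge a b := by
  funext x; ext w
  rw [Pi.smul_apply, ContinuousAlternatingMap.smul_apply]
  simp only [wedge_apply, Pi.smul_apply, ContinuousAlternatingMap.smul_apply, smul_eq_mul,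
    Finset.mul_sum]
  exact Finset.sum_congr rfl fun i _ => by ring

theorem smul_wedge (r : ℝ) (a : Form M 1) (b : Form M k) : wedge (r • a) b = r • wedge a b := by
  funext x; ext w
  rw [Pi.smul_apply, ContinuousAlternatingMap.smul_apply]
  simp only [wedge_apply, Pi.smul_apply, ContinuousAlternatingMap.smul_apply, smul_eq_mul,
    Finset.mul_sum]
  exact Finset.sum_congr rfl fun i _ => by ring

theorem wedge_zero (a : Form M 1) : wedge a (0 : Form M k) = 0 := by
  simpa using wedge_smul 0 a (0 : Form M k)

theorem zero_wedge (b : Form M k) : wedge 0 b = 0 := by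
  simpa using smul_wedge 0 (0 : Form M 1) b

theorem wedge_comm (a b : Form M 1) : wedge a b = -wedge b a := by
  funext x
  refine ext_comp2 stdFrame fun i => ?_
  rw [Pi.neg_apply, comp2_neg, comp2_wedge, comp2_wedge]
  ring

theorem fmul_add (f : M → ℝ) (a b : Form M k) : fmul f (a + b) = fmul f a + fmul f b := by
  funext x; exact smul_add (f x) (a x) (b x)

theorem fmul_smul (f : M → ℝ) (r : ℝ) (a : Form M k) : fmul f (r • a) = r • fmul f a := by
  funext x; exact smul_comm (f x) r (a x)

theorem neg_eq_smul (a : Form M k) : -a = (-1 : ℝ) • a := by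
  funext x; ext w; exact (neg_one_mul _).symm

theorem fmul_zero (f : M → ℝ) : fmul f (0 : Form M k) = 0 := by
  funext x; exact smul_zero (f x)

end Bilinear

section Epsilon

variable {M : Type*}

theorem eps_sum3 {V : Type*} [AddCommGroup V] [Module ℝ V] (f : Fin 3 → Fin 3 → Fin 3 → V) :
    ∑ i, ∑ j, ∑ k, eps i j k • f i j k = f 0 1 2 - f 0 2 1 + (f 1 2 0 - f 1 0 2)
      + (f 2 0 1 - f 2 1 0) := by
  rw [Finset.sum_congr rfl fun i _ => eps_sum i (f i), Fin.sum_univ_three]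
  rfl

theorem eps_sum3_mul (f : Fin 3 → Fin 3 → Fin 3 → ℝ) :
    ∑ i, ∑ j, ∑ k, eps i j k * f i j k = f 0 1 2 - f 0 2 1 + (f 1 2 0 - f 1 0 2)
      + (f 2 0 1 - f 2 1 0) := eps_sum3 f

/-- The product of two 1-forms. -/
def wedge2 (a b : Form M 1) : Form M 2 := wedge a b

/-- The product of a 1-form and a 2-form. -/
def wedge3 (a : Form M 1) (b : Form M 2) : Form M 3 := wedge a b

/-- `ε_{ijk} a^j ∧ b^k` for 1-forms. -/
def cross2 (a b : Fin 3 → Form M 1) (i : Fin 3) : Form M 2 :=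
  wedge2 (a (i + 1)) (b (i + 2)) - wedge2 (a (i + 2)) (b (i + 1))

/-- `ε_{ijk} a^j ∧ b^k` for 1-forms `a` and 2-forms `b`. -/
def cross3 (a : Fin 3 → Form M 1) (b : Fin 3 → Form M 2) (i : Fin 3) : Form M 3 :=
  wedge3 (a (i + 1)) (b (i + 2)) - wedge3 (a (i + 2)) (b (i + 1))

/-- `ε_{ijk} f^j b^k` for functions `f`. -/
def crossFun {k : ℕ} (f : Fin 3 → M → ℝ) (b : Fin 3 → Form M k) (i : Fin 3) : Form M k :=
  fmul (f (i + 1)) (b (i + 2)) - fmul (f (i + 2)) (b (i + 1))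

/-- `wedge2`, `wedge3`, `d1`, `d2`, `cov1` and `cov2` unfold to the general operations, with degrees
written 2 and 3 instead of `1 + 1` and `2 + 1`. From here on formulas are put in terms of them. -/
theorem eps_wedge2 (a b : Fin 3 → Form M 1) (i : Fin 3) :
    ∑ j, ∑ k, eps i j k • wedge (a j) (b k) = cross2 a b i :=
  eps_sum (V := Form M 2) i fun j k => wedge2 (a j) (b k)

theorem eps_wedge3 (a : Fin 3 → Form M 1) (b : Fin 3 → Form M 2) (i : Fin 3) :
    ∑ j, ∑ k, eps i j k • wedge (a j) (b k) = cross3 a b i :=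
  eps_sum (V := Form M 3) i fun j k => wedge3 (a j) (b k)

theorem eps_fmul {k : ℕ} (f : Fin 3 → M → ℝ) (b : Fin 3 → Form M k) (i : Fin 3) :
    ∑ j, ∑ k, eps i j k • fmul (f j) (b k) = crossFun f b i :=
  eps_sum i fun j k => fmul (f j) (b k)

section Components

variable (v : Frame) (x : M)

theorem comp2_wedge2 (a b : Form M 1) (i : Fin 3) :
    comp2 v (wedge2 a b x) i = comp1 v (a x) (i + 1) * comp1 v (b x) (i + 2)
      - comp1 v (a x) (i + 2) * comp1 v (b x) (i + 1) := comp2_wedge v x a b i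

theorem comp3_wedge3 (a : Form M 1) (b : Form M 2) :
    comp3 v (wedge3 a b x) = ∑ i, comp1 v (a x) i * comp2 v (b x) i := comp3_wedge v x a b

end Components

theorem wedge2_comm (a b : Form M 1) : wedge2 a b = -wedge2 b a := wedge_comm a b

/-- The two orderings contribute equally, since ε and the product of 1-forms change sign together;
this cancels the factor ½. In `volOf_eq` six equal terms cancel 1/6. -/
theorem dual2_eq (e : Fin 3 → Form M 1) (i : Fin 3) :
    dual2 e i = wedge2 (e (i + 1)) (e (i + 2)) := by
  have h : dual2 e i = (1 / 2 : ℝ) • cross2 e e i :=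
    congrArg (fun b : Form M 2 => (1 / 2 : ℝ) • b) (eps_wedge2 e e i)
  rw [h, cross2, wedge2_comm (e (i + 2)), sub_neg_eq_add, ← two_smul ℝ (wedge2 _ _), smul_smul]
  norm_num

theorem volOf_eq (e : Fin 3 → Form M 1) : volOf e = wedge3 (e 0) (wedge2 (e 1) (e 2)) := by
  have h : volOf e = (1 / 6 : ℝ) • (wedge3 (e 0) (wedge2 (e 1) (e 2))
      - wedge3 (e 0) (wedge2 (e 2) (e 1)) + (wedge3 (e 1) (wedge2 (e 2) (e 0))
      - wedge3 (e 1) (wedge2 (e 0) (e 2))) + (wedge3 (e 2) (wedge2 (e 0) (e 1))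
      - wedge3 (e 2) (wedge2 (e 1) (e 0)))) :=
    congrArg (fun b : Form M 3 => (1 / 6 : ℝ) • b)
      (eps_sum3 (V := Form M 3) fun i j k => wedge3 (e i) (wedge2 (e j) (e k)))
  rw [h]
  funext x
  refine ext_comp3 stdFrame ?_
  simp only [Pi.add_apply, Pi.sub_apply, Pi.smul_apply, comp3_add, comp3_sub, comp3_smul,
    comp3_wedge3, comp2_wedge2, Fin.sum_univ_three, Fin.isValue, Fin.reduceAdd]
  ring

variable [TopologicalSpace M] [ChartedSpace E3 M]

/-- The differential of a 1-form. -/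
def d1 (a : Form M 1) : Form M 2 := extD a

/-- The differential of a 2-form. -/
def d2 (b : Form M 2) : Form M 3 := extD b

theorem curv_eq (A : Fin 3 → Form M 1) (i : Fin 3) :
    curv A i = d1 (A i) + wedge2 (A (i + 1)) (A (i + 2)) := by
  rw [← dual2_eq]; rfl

theorem cov_eq1 (A b : Fin 3 → Form M 1) (i : Fin 3) : cov A b i = d1 (b i) + cross2 A b i := by
  rw [← eps_wedge2]; rfl

theorem cov_eq2 (A : Fin 3 → Form M 1) (b : Fin 3 → Form M 2) (i : Fin 3) :
    cov A b i = d2 (b i) + cross3 A b i := by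
  rw [← eps_wedge3]; rfl

/-- The minus sign comes from writing the function as the first factor of the cross product, while
in DΛ it is the second. -/
theorem covFun_eq (A : Fin 3 → Form M 1) (L : Fin 3 → M → ℝ) (i : Fin 3) :
    covFun A L i = dFun (L i) - crossFun L A i := by
  rw [covFun, eps_sum i fun j k => fmul (L k) (A j), crossFun]
  abel

theorem HForm_eq (e : Fin 3 → Form M 1) (φ : M → ℝ) (i : Fin 3) :
    HForm e φ i = wedge2 (e (i + 1)) (e (i + 2)) + wedge2 (e i) (dFun φ) := by
  rw [← dual2_eq]; rfl

/-- `Dβ_i` for 1-forms. -/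
def cov1 (A b : Fin 3 → Form M 1) (i : Fin 3) : Form M 2 := cov A b i

/-- `Dβ_i` for 2-forms. -/
def cov2 (A : Fin 3 → Form M 1) (b : Fin 3 → Form M 2) (i : Fin 3) : Form M 3 := cov A b i

theorem cov1_eq (A b : Fin 3 → Form M 1) (i : Fin 3) : cov1 A b i = d1 (b i) + cross2 A b i :=
  cov_eq1 A b i

theorem cov2_eq (A : Fin 3 → Form M 1) (b : Fin 3 → Form M 2) (i : Fin 3) :
    cov2 A b i = d2 (b i) + cross3 A b i := cov_eq2 A b i

end Epsilon

section Families

variable {M : Type*} [TopologicalSpace M] [ChartedSpace E3 M]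

/-- Families of smooth forms which are polynomial in the parameter, with their terms of order 0
and 1. -/
inductive Fam {k : ℕ} : (ℝ → Form M k) → Form M k → Form M k → Prop
  | const {c : Form M k} (hc : SmoothForm c) : Fam (fun _ => c) c 0
  | add {b c : ℝ → Form M k} {b0 b1 c0 c1 : Form M k} (hb : Fam b b0 b1) (hc : Fam c c0 c1) :
      Fam (fun s => b s + c s) (b0 + c0) (b1 + c1)
  | mul_id {b : ℝ → Form M k} {b0 b1 : Form M k} (hb : Fam b b0 b1) : Fam (fun s => s • b s) 0 b0

namespace Fam

variable {k : ℕ} {b c : ℝ → Form M k} {b0 b1 c0 c1 : Form M k}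

/-- Smoothness, the value at 0 and derivatives are all obtained by induction on the construction of
the family. No topology on the space of forms is involved, so a nonlocal functional such as
`integral` can be differentiated from its linearity on smooth forms alone. -/
theorem smooth (h : Fam b b0 b1) : (∀ s, SmoothForm (b s)) ∧ SmoothForm b0 ∧ SmoothForm b1 := by
  induction h with
  | const hc => exact ⟨fun _ => hc, hc, SmoothForm.zero⟩
  | add _ _ ihb ihc => exact ⟨fun s => (ihb.1 s).add (ihc.1 s), ihb.2.1.add ihc.2.1, ihb.2.2.add ihc.2.2⟩
  | mul_id _ ih => exact ⟨fun s => (ih.1 s).smul s, SmoothForm.zero, ih.2.1⟩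

theorem at_zero (h : Fam b b0 b1) : b 0 = b0 := by
  induction h with
  | const hc => rfl
  | add _ _ ihb ihc => simp only [ihb, ihc]
  | mul_id _ ih => simp

/-- A linear functional may be differentiated term by term. -/
theorem hasDerivAt {V : Type*} [NormedAddCommGroup V] [NormedSpace ℝ V] (h : Fam b b0 b1)
    (T : Form M k → V) (hadd : ∀ a c, SmoothForm a → SmoothForm c → T (a + c) = T a + T c)
    (hsmul : ∀ (r : ℝ) a, SmoothForm a → T (r • a) = r • T a) :
    HasDerivAt (fun s => T (b s)) (T b1) 0 := by
  induction h with
  | const hc =>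
    have : T 0 = 0 := by simpa using hsmul 0 0 SmoothForm.zero
    rw [this]
    exact hasDerivAt_const _ _
  | add hb hc ihb ihc =>
    rw [hadd _ _ hb.smooth.2.2 hc.smooth.2.2]
    simp_rw [fun s => hadd _ _ (hb.smooth.1 s) (hc.smooth.1 s)]
    exact ihb.add ihc
  | mul_id hb ih =>
    simp_rw [fun s => hsmul s _ (hb.smooth.1 s)]
    have := (hasDerivAt_id (0 : ℝ)).fun_smul ih
    simpa only [hb.at_zero, id, zero_smul, one_smul, zero_add] using this

theorem cast (h : Fam b b0 b1) {b' : ℝ → Form M k} {b0' b1' : Form M k} (e : ∀ s, b' s = b s)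
    (e0 : b0' = b0) (e1 : b1' = b1) : Fam b' b0' b1' := by
  rw [e0, e1, funext e]; exact h

theorem line {a d : Form M k} (ha : SmoothForm a) (hd : SmoothForm d) :
    Fam (fun s => a + s • d) a d :=
  ((const ha).add (const hd).mul_id).cast (fun _ => rfl) (by simp) (by simp)

theorem smul (r : ℝ) (h : Fam b b0 b1) : Fam (fun s => r • b s) (r • b0) (r • b1) := by
  induction h with
  | const hc => exact (const (hc.smul r)).cast (fun _ => rfl) rfl (by simp)
  | add _ _ ihb ihc => exact (ihb.add ihc).cast (fun _ => smul_add _ _ _) (smul_add _ _ _) (smul_add _ _ _)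
  | mul_id _ ih => exact ih.mul_id.cast (fun _ => smul_comm _ _ _) (by simp) rfl

theorem neg (h : Fam b b0 b1) : Fam (fun s => -b s) (-b0) (-b1) :=
  (h.smul (-1)).cast (fun _ => neg_eq_smul _) (neg_eq_smul _) (neg_eq_smul _)

theorem sub (hb : Fam b b0 b1) (hc : Fam c c0 c1) :
    Fam (fun s => b s - c s) (b0 - c0) (b1 - c1) :=
  (hb.add hc.neg).cast (fun _ => sub_eq_add_neg _ _) (sub_eq_add_neg _ _) (sub_eq_add_neg _ _)

theorem sum {ι : Type*} (s : Finset ι) {b : ι → ℝ → Form M k} {b0 b1 : ι → Form M k}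
    (h : ∀ i, Fam (b i) (b0 i) (b1 i)) :
    Fam (fun t => ∑ i ∈ s, b i t) (∑ i ∈ s, b0 i) (∑ i ∈ s, b1 i) := by
  classical
  induction s using Finset.induction_on with
  | empty => simpa using const SmoothForm.zero
  | insert i s hi ih =>
    simp_rw [Finset.sum_insert hi]
    exact (h i).add ih

theorem map {l : ℕ} (T : Form M k → Form M l) (hT : ∀ a, SmoothForm a → SmoothForm (T a))
    (hadd : ∀ a c, SmoothForm a → SmoothForm c → T (a + c) = T a + T c)
    (hsmul : ∀ (r : ℝ) a, SmoothForm a → T (r • a) = r • T a) (h : Fam b b0 b1) :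
    Fam (fun s => T (b s)) (T b0) (T b1) := by
  have h0 : T 0 = 0 := by simpa using hsmul 0 0 SmoothForm.zero
  induction h with
  | const hc => exact (const (hT _ hc)).cast (fun _ => rfl) rfl h0
  | add hb hc ihb ihc =>
    exact (ihb.add ihc).cast (fun s => hadd _ _ (hb.smooth.1 s) (hc.smooth.1 s))
      (hadd _ _ hb.smooth.2.1 hc.smooth.2.1) (hadd _ _ hb.smooth.2.2 hc.smooth.2.2)
  | mul_id hb ih => exact ih.mul_id.cast (fun s => hsmul s _ (hb.smooth.1 s)) h0 rfl

/-- Leibniz' rule, by induction on the first family, the second being carried along by linearity. A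
family s a(s) has zero term of order 0, so only its first-order part meets the value of the second
family at 0. -/
theorem bilin {l m : ℕ} (T : Form M l → Form M k → Form M m)
    (hT : ∀ a b, SmoothForm a → SmoothForm b → SmoothForm (T a b))
    (hadd : ∀ a b c, T a (b + c) = T a b + T a c) (hsmul : ∀ (r : ℝ) a b, T a (r • b) = r • T a b)
    (hadd' : ∀ a b c, T (a + b) c = T a c + T b c) (hsmul' : ∀ (r : ℝ) a b, T (r • a) b = r • T a b)
    {a : ℝ → Form M l} {a0 a1 : Form M l} (ha : Fam a a0 a1) (h : Fam b b0 b1) :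
    Fam (fun s => T (a s) (b s)) (T a0 b0) (T a1 b0 + T a0 b1) := by
  have h0 : ∀ b, T 0 b = 0 := fun b => by simpa using hsmul' 0 0 b
  induction ha with
  | const hc =>
    exact (h.map (T _) (fun b hb => hT _ b hc hb) (fun _ _ _ _ => hadd _ _ _)
      fun _ _ _ => hsmul _ _ _).cast (fun _ => rfl) rfl (by rw [h0, zero_add])
  | add _ _ ih1 ih2 =>
    refine (ih1.add ih2).cast (fun s => hadd' _ _ _) (hadd' _ _ _) ?_
    rw [hadd', hadd']; abel
  | mul_id hb ih =>
    exact ih.mul_id.cast (fun s => hsmul' _ _ _) (h0 _) (by rw [h0, add_zero])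

theorem wedge2 {a b : ℝ → Form M 1} {a0 a1 b0 b1 : Form M 1} (ha : Fam a a0 a1)
    (hb : Fam b b0 b1) : Fam (fun s => wedge2 (a s) (b s)) (wedge2 a0 b0)
      (wedge2 a1 b0 + wedge2 a0 b1) :=
  bilin HK.wedge2 (fun _ _ h1 h2 => h1.wedge11 h2) wedge_add (fun r a b => wedge_smul r a b) add_wedge
    (fun r a b => smul_wedge r a b) ha hb

theorem wedge3 {a : ℝ → Form M 1} {b : ℝ → Form M 2} {a0 a1 : Form M 1} {b0 b1 : Form M 2}
    (ha : Fam a a0 a1) (hb : Fam b b0 b1) :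
    Fam (fun s => wedge3 (a s) (b s)) (wedge3 a0 b0)
      (wedge3 a1 b0 + wedge3 a0 b1) :=
  bilin HK.wedge3 (fun _ _ h1 h2 => h1.wedge12 h2) wedge_add (fun r a b => wedge_smul r a b) add_wedge
    (fun r a b => smul_wedge r a b) ha hb

variable [IsManifold (𝓡 3) ∞ M]

theorem fmul {f : M → ℝ} (hf : SmoothFun f) (h : Fam b b0 b1) :
    Fam (fun s => fmul f (b s)) (fmul f b0) (fmul f b1) :=
  h.map (HK.fmul f) (fun _ ha => SmoothForm.fmul hf ha) (fun _ _ _ _ => fmul_add _ _ _)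
    fun _ _ _ => fmul_smul _ _ _

theorem fmul_line {f g : M → ℝ} (hf : SmoothFun f) (hg : SmoothFun g) (h : Fam b b0 b1) :
    Fam (fun s => HK.fmul (fun x => f x + s * g x) (b s)) (HK.fmul f b0)
      (HK.fmul g b0 + HK.fmul f b1) := by
  refine ((h.fmul hf).add (h.fmul hg).mul_id).cast (fun s => ?_) (by simp) (by rw [add_comm])
  funext x
  rw [HK.fmul, add_smul, mul_smul]
  rfl

theorem d1 {b : ℝ → Form M 1} {b0 b1 : Form M 1} (h : Fam b b0 b1) :
    Fam (fun s => d1 (b s)) (d1 b0) (d1 b1) :=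
  h.map HK.d1 (fun _ ha => ha.extD) (fun _ _ h1 h2 => extD_add h1 h2) fun r a _ => extD_smul r a

theorem d2 {b : ℝ → Form M 2} {b0 b1 : Form M 2} (h : Fam b b0 b1) :
    Fam (fun s => d2 (b s)) (d2 b0) (d2 b1) :=
  h.map HK.d2 (fun _ ha => ha.extD) (fun _ _ h1 h2 => extD_add h1 h2) fun r a _ => extD_smul r a

theorem dFun_line {f g : M → ℝ} (hf : SmoothFun f) (hg : SmoothFun g) :
    Fam (fun s => dFun (fun x => f x + s * g x)) (dFun f) (dFun g) := by
  refine (line (SmoothForm.dFun hf) (SmoothForm.dFun hg)).cast (fun s => ?_) rfl rfl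
  rw [dFun_add hf ((SmoothFun.const s).mul hg), dFun_smul s hg]

theorem cov {A : Fin 3 → ℝ → Form M 1} {A0 A1 : Fin 3 → Form M 1} (hA : ∀ i, Fam (A i) (A0 i) (A1 i))
    {b : Fin 3 → ℝ → Form M 2} {b0 b1 : Fin 3 → Form M 2} (hb : ∀ i, Fam (b i) (b0 i) (b1 i))
    (i : Fin 3) : Fam (fun s => cov2 (fun j => A j s) (fun j => b j s) i) (cov2 A0 b0 i)
      (cov2 A0 b1 i + cross3 A1 b0 i) := by
  simp only [cov2_eq, cross3]
  refine ((hb i).d2.add (((hA (i + 1)).wedge3 (hb (i + 2))).sub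
    ((hA (i + 2)).wedge3 (hb (i + 1))))).cast (fun _ => rfl) rfl ?_
  abel

end Fam

end Families

end

/-! ### Covariant differentials -/

section

variable {M : Type*} [TopologicalSpace M] [ChartedSpace E3 M] [IsManifold (𝓡 3) ∞ M]

section Smooth

theorem SmoothForm.wedge2 {a b : Form M 1} (ha : SmoothForm a) (hb : SmoothForm b) :
    SmoothForm (wedge2 a b) := ha.wedge11 hb

theorem SmoothForm.wedge3 {a : Form M 1} {b : Form M 2} (ha : SmoothForm a) (hb : SmoothForm b) :
    SmoothForm (wedge3 a b) := ha.wedge12 hb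

theorem SmoothForm.d1 {a : Form M 1} (ha : SmoothForm a) : SmoothForm (d1 a) := ha.extD

theorem SmoothForm.d2 {a : Form M 2} (ha : SmoothForm a) : SmoothForm (d2 a) := ha.extD

theorem SmoothForm.cross2 {a b : Fin 3 → Form M 1} (ha : ∀ i, SmoothForm (a i))
    (hb : ∀ i, SmoothForm (b i)) (i : Fin 3) : SmoothForm (cross2 a b i) :=
  ((ha _).wedge2 (hb _)).sub ((ha _).wedge2 (hb _))

theorem SmoothForm.cross3 {a : Fin 3 → Form M 1} {b : Fin 3 → Form M 2} (ha : ∀ i, SmoothForm (a i))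
    (hb : ∀ i, SmoothForm (b i)) (i : Fin 3) : SmoothForm (cross3 a b i) :=
  ((ha _).wedge3 (hb _)).sub ((ha _).wedge3 (hb _))

theorem SmoothForm.crossFun {k : ℕ} {f : Fin 3 → M → ℝ} {b : Fin 3 → Form M k}
    (hf : ∀ i, SmoothFun (f i)) (hb : ∀ i, SmoothForm (b i)) (i : Fin 3) :
    SmoothForm (crossFun f b i) :=
  (SmoothForm.fmul (hf _) (hb _)).sub (SmoothForm.fmul (hf _) (hb _))

theorem SmoothForm.cov1 {A b : Fin 3 → Form M 1} (hA : ∀ i, SmoothForm (A i))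
    (hb : ∀ i, SmoothForm (b i)) (i : Fin 3) : SmoothForm (cov1 A b i) := by
  rw [cov1_eq]; exact (hb i).d1.add (SmoothForm.cross2 hA hb i)

theorem SmoothForm.cov2 {A : Fin 3 → Form M 1} {b : Fin 3 → Form M 2} (hA : ∀ i, SmoothForm (A i))
    (hb : ∀ i, SmoothForm (b i)) (i : Fin 3) : SmoothForm (cov2 A b i) := by
  rw [cov2_eq]; exact (hb i).d2.add (SmoothForm.cross3 hA hb i)

theorem SmoothForm.curv {A : Fin 3 → Form M 1} (hA : ∀ i, SmoothForm (A i)) (i : Fin 3) :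
    SmoothForm (curv A i) := by
  rw [curv_eq]; exact (hA i).d1.add ((hA _).wedge2 (hA _))

theorem SmoothForm.covFun {A : Fin 3 → Form M 1} {L : Fin 3 → M → ℝ} (hA : ∀ i, SmoothForm (A i))
    (hL : ∀ i, SmoothFun (L i)) (i : Fin 3) : SmoothForm (covFun A L i) := by
  rw [covFun_eq]; exact (SmoothForm.dFun (hL i)).sub (SmoothForm.crossFun hL hA i)

theorem SmoothForm.HForm {e : Fin 3 → Form M 1} {φ : M → ℝ} (he : ∀ i, SmoothForm (e i))
    (hφ : SmoothFun φ) (i : Fin 3) : SmoothForm (HForm e φ i) := by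
  rw [HForm_eq]
  exact ((he _).wedge2 (he _)).add ((he i).wedge2 (SmoothForm.dFun hφ))

end Smooth

section Leibniz

theorem d1_fmul {f : M → ℝ} {a : Form M 1} (hf : SmoothFun f) (ha : SmoothForm a) :
    d1 (fmul f a) = wedge2 (dFun f) a + fmul f (d1 a) := extD_fmul1 hf ha

theorem d2_fmul {f : M → ℝ} {b : Form M 2} (hf : SmoothFun f) (hb : SmoothForm b) :
    d2 (fmul f b) = wedge3 (dFun f) b + fmul f (d2 b) := extD_fmul2 hf hb

theorem d2_wedge2 {a b : Form M 1} (ha : SmoothForm a) (hb : SmoothForm b) :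
    d2 (wedge2 a b) = wedge3 b (d1 a) - wedge3 a (d1 b) := extD_wedge ha hb

theorem d2_d1 {a : Form M 1} (ha : SmoothForm a) : d2 (d1 a) = 0 := extD_extD ha

theorem d1_dFun {f : M → ℝ} (hf : SmoothFun f) : d1 (dFun f) = 0 := extD_dFun hf

theorem d1_add {a b : Form M 1} (ha : SmoothForm a) (hb : SmoothForm b) :
    d1 (a + b) = d1 a + d1 b := extD_add ha hb

theorem d1_sub {a b : Form M 1} (ha : SmoothForm a) (hb : SmoothForm b) :
    d1 (a - b) = d1 a - d1 b := extD_sub ha hb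

theorem d2_add {a b : Form M 2} (ha : SmoothForm a) (hb : SmoothForm b) :
    d2 (a + b) = d2 a + d2 b := extD_add ha hb

theorem d2_sub {a b : Form M 2} (ha : SmoothForm a) (hb : SmoothForm b) :
    d2 (a - b) = d2 a - d2 b := extD_sub ha hb

end Leibniz

section Covariant

variable {A a b : Fin 3 → Form M 1} (hA : ∀ i, SmoothForm (A i)) (ha : ∀ i, SmoothForm (a i))
  (hb : ∀ i, SmoothForm (b i)) {B : Fin 3 → Form M 2} (hB : ∀ i, SmoothForm (B i))
  {f : M → ℝ} (hf : SmoothFun f) {L : Fin 3 → M → ℝ} (hL : ∀ i, SmoothFun (L i)) (i : Fin 3)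
include hA

include ha hb in
theorem cov2_cross2 : cov2 A (cross2 a b) i = -cross3 a (cov1 A b) i - cross3 b (cov1 A a) i := by
  simp only [cov2_eq, cross3, cov1_eq, cross2]
  rw [d2_sub ((ha _).wedge2 (hb _)) ((ha _).wedge2 (hb _)), d2_wedge2 (ha _) (hb _),
    d2_wedge2 (ha _) (hb _)]
  funext x
  refine ext_comp3 stdFrame ?_
  simp only [Pi.add_apply, Pi.sub_apply, Pi.neg_apply, comp3_add, comp3_sub, comp3_neg,
    comp3_wedge3, comp2_add, comp2_sub, comp2_wedge2, Fin.sum_univ_three, Fin.isValue,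
    Fin.reduceAdd, add_assoc, add_zero, zero_add]
  ring

omit hA in
include hb hf in
theorem cov1_fmul : cov1 A (fun j => fmul f (b j)) i = wedge2 (dFun f) (b i) + fmul f (cov1 A b i) := by
  simp only [cov1_eq, cross2]
  rw [d1_fmul hf (hb i)]
  funext x
  refine ext_comp2 stdFrame fun m => ?_
  simp only [Pi.add_apply, Pi.sub_apply, comp2_add, comp2_sub, comp2_wedge2, comp2_fmul, comp1_fmul]
  ring

omit hA in
include hb hf in
theorem cov2_wedge2_dFun :
    cov2 A (fun j => wedge2 (b j) (dFun f)) i = wedge3 (dFun f) (cov1 A b i) := by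
  simp only [cov2_eq, cross3, cov1_eq, cross2]
  rw [d2_wedge2 (hb i) (SmoothForm.dFun hf), d1_dFun hf]
  funext x
  refine ext_comp3 stdFrame ?_
  simp only [Pi.add_apply, Pi.sub_apply, Pi.zero_apply, comp3_add, comp3_sub, comp3_wedge3,
    comp2_wedge2, comp2_add, comp2_sub, comp2_zero, Fin.sum_univ_three, Fin.isValue, Fin.reduceAdd]
  ring

/-- The Bianchi identity. -/
theorem cov2_curv : cov2 A (curv A) i = 0 := by
  simp only [cov2_eq, cross3, curv_eq]
  rw [d2_add (hA i).d1 ((hA _).wedge2 (hA _)), d2_d1 (hA i), d2_wedge2 (hA _) (hA _)]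
  funext x
  refine ext_comp3 stdFrame ?_
  simp only [Pi.add_apply, Pi.sub_apply, Pi.zero_apply, comp3_add, comp3_sub, comp3_wedge3,
    comp2_wedge2, comp2_add, comp3_zero, Fin.sum_univ_three, Fin.isValue,
    Fin.reduceAdd, add_assoc, add_zero]
  ring

include hb in
-- D² acts through the curvature: d² = 0 removes second derivatives of b, its first derivatives
-- cancel, and what is left assembles into F. The minus sign comes from placing the 1-form b to the
-- left of F.
theorem cov2_cov1 : cov2 A (cov1 A b) i = -cross3 b (curv A) i := by
  simp only [cov2_eq, cross3, curv_eq, cov1_eq, cross2]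
  rw [d2_add (hb i).d1 (((hA _).wedge2 (hb _)).sub ((hA _).wedge2 (hb _))), d2_d1 (hb i),
    d2_sub ((hA _).wedge2 (hb _)) ((hA _).wedge2 (hb _)), d2_wedge2 (hA _) (hb _),
    d2_wedge2 (hA _) (hb _)]
  funext x
  refine ext_comp3 stdFrame ?_
  simp only [Pi.add_apply, Pi.sub_apply, Pi.neg_apply, Pi.zero_apply, comp3_add, comp3_sub,
    comp3_wedge3, comp3_neg, comp2_wedge2, comp2_add, comp2_sub, comp3_zero, Fin.sum_univ_three,
    Fin.isValue, Fin.reduceAdd, add_assoc, add_zero]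
  ring

include hL hb in
theorem cov1_crossFun : cov1 A (crossFun L b) i = cross2 (covFun A L) b i + crossFun L (cov1 A b) i := by
  simp only [cov1_eq, cross2, covFun_eq, crossFun]
  have h := fun j k => SmoothForm.fmul (hL j) (hb k)
  rw [d1_sub (h _ _) (h _ _), d1_fmul (hL _) (hb _), d1_fmul (hL _) (hb _)]
  funext x
  refine ext_comp2 stdFrame fun m => ?_
  simp only [Pi.add_apply, Pi.sub_apply, comp2_add, comp2_sub,
    comp2_wedge2, comp2_fmul, comp1_fmul, comp1_sub, Fin.isValue,
    Fin.reduceAdd, add_assoc, add_zero]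
  ring

omit i
include ha hb in
-- The connection terms cancel in the sum because ε is antisymmetric, so d of a contracted product
-- may be computed with D. Combined with Stokes' theorem, this and `d2_sum_fmul` are covariant
-- integration by parts.
theorem d2_sum_wedge2 :
    d2 (∑ i, wedge2 (a i) (b i)) = ∑ i, (wedge3 (b i) (cov1 A a i) - wedge3 (a i) (cov1 A b i)) := by
  have h : d2 (∑ i, wedge2 (a i) (b i)) = ∑ i, (wedge3 (b i) (d1 (a i)) - wedge3 (a i) (d1 (b i))) :=
    (extD_sum fun i _ => (ha i).wedge2 (hb i)).trans
      (Finset.sum_congr rfl fun i _ => d2_wedge2 (ha i) (hb i))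
  rw [h]
  funext x
  refine ext_comp3 stdFrame ?_
  simp only [cov1_eq, cross2, Pi.add_apply, Pi.sub_apply, comp3_add, comp3_sub, comp3_wedge3,
    comp2_wedge2, comp2_add, comp2_sub, Fin.sum_univ_three, Fin.isValue, Fin.reduceAdd]
  ring

include hL hB in
theorem d2_sum_fmul :
    d2 (∑ i, fmul (L i) (B i)) = ∑ i, (wedge3 (covFun A L i) (B i) + fmul (L i) (cov2 A B i)) := by
  have h : d2 (∑ i, fmul (L i) (B i)) = ∑ i, (wedge3 (dFun (L i)) (B i) + fmul (L i) (d2 (B i))) :=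
    (extD_sum fun i _ => SmoothForm.fmul (hL i) (hB i)).trans
      (Finset.sum_congr rfl fun i _ => d2_fmul (hL i) (hB i))
  rw [h]
  funext x
  refine ext_comp3 stdFrame ?_
  simp only [cov2_eq, cross3, covFun_eq, crossFun, Pi.add_apply, Pi.sub_apply, comp3_add, comp3_sub,
    comp3_wedge3, comp3_fmul, comp1_fmul, comp1_sub, Fin.sum_univ_three, Fin.isValue, Fin.reduceAdd]
  ring

end Covariant

end

/-! ### First variations of H, π, the constraints and the Hamiltonian -/

section

variable {M : Type*} [TopologicalSpace M] [ChartedSpace E3 M]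

/-- The 3-forms `ε_{ijk} e^j ∧ F^k + dφ ∧ F_i`. -/
def constrF (q : Fields M) (i : Fin 3) : Form M 3 :=
  cross3 q.e (curv q.A) i + wedge3 (dFun q.φ) (curv q.A i)

/-- The 3-forms `ε_{ijk} e^j ∧ De^k - dφ ∧ De_i`. -/
def constrT (q : Fields M) (i : Fin 3) : Form M 3 :=
  cross3 q.e (cov1 q.A q.e) i - wedge3 (dFun q.φ) (cov1 q.A q.e i)

theorem secondaryF_iff (q : Fields M) : SecondaryF q ↔ ∀ i, constrF q i = 0 := by
  refine forall_congr' fun i => ?_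
  rw [eps_wedge3]; rfl

theorem secondaryT_iff (q : Fields M) : SecondaryT q ↔ ∀ i, constrT q i = 0 := by
  refine forall_congr' fun i => ?_
  have := eps_wedge3 q.e (cov1 q.A q.e) i
  exact Eq.congr (congrArg (fun b : Form M 3 => b - wedge3 (dFun q.φ) (cov1 q.A q.e i)) this) rfl

/-- First variation of `H`. -/
def varH (q Y : Fields M) (i : Fin 3) : Form M 2 :=
  cross2 q.e Y.e i + wedge2 (Y.e i) (dFun q.φ) + wedge2 (q.e i) (dFun Y.φ)

/-- First variation of `π`. -/
def varPi (q Y : Fields M) : Form M 3 :=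
  -∑ i, (wedge3 (Y.e i) (curv q.A i) + wedge3 (q.e i) (cov1 q.A Y.A i))

/-- First variation of `DH`. -/
def varDH (q Y : Fields M) (i : Fin 3) : Form M 3 :=
  cov2 q.A (varH q Y) i + cross3 Y.A (HForm q.e q.φ) i

/-- First variation of `constrF`. -/
def varC (q Y : Fields M) (i : Fin 3) : Form M 3 :=
  cross3 Y.e (curv q.A) i + cross3 q.e (cov1 q.A Y.A) i + wedge3 (dFun Y.φ) (curv q.A i)
    + wedge3 (dFun q.φ) (cov1 q.A Y.A i)

variable [IsManifold (𝓡 3) ∞ M]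

section Families

variable {q Y : Fields M} (hq : q.Smooth) (hY : Y.Smooth)
include hq hY

theorem fam_e (i : Fin 3) : Fam (fun s => (q.move Y s).e i) (q.e i) (Y.e i) :=
  Fam.line (hq.e i) (hY.e i)

theorem fam_A (i : Fin 3) : Fam (fun s => (q.move Y s).A i) (q.A i) (Y.A i) :=
  Fam.line (hq.A i) (hY.A i)

theorem fam_dφ : Fam (fun s => dFun (q.move Y s).φ) (dFun q.φ) (dFun Y.φ) :=
  Fam.dFun_line hq.φ hY.φ

/-- The two first-order terms of ½ ε A ∧ A combine, by anticommutativity, into the cross product of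
A with its variation; so F varies by D of the variation of A. -/
theorem fam_curv (i : Fin 3) :
    Fam (fun s => curv (q.move Y s).A i) (curv q.A i) (cov1 q.A Y.A i) := by
  refine ((fam_A hq hY i).d1.add ((fam_A hq hY (i + 1)).wedge2 (fam_A hq hY (i + 2)))).cast
    (fun s => curv_eq _ _) (curv_eq _ _) ?_
  rw [cov1_eq, cross2, wedge2_comm (q.A (i + 2))]
  abel

theorem fam_HForm (i : Fin 3) :
    Fam (fun s => HForm (q.move Y s).e (q.move Y s).φ i) (HForm q.e q.φ i) (varH q Y i) := by
  refine (((fam_e hq hY (i + 1)).wedge2 (fam_e hq hY (i + 2))).add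
    ((fam_e hq hY i).wedge2 (fam_dφ hq hY))).cast
    (fun s => HForm_eq _ _ _) (HForm_eq _ _ _) ?_
  rw [varH, cross2, wedge2_comm (q.e (i + 2))]
  abel

theorem fam_piForm : Fam (fun s => piForm (q.move Y s).e (q.move Y s).A) (piForm q.e q.A)
    (varPi q Y) :=
  (Fam.sum Finset.univ fun i => (fam_e hq hY i).wedge3 (fam_curv hq hY i)).neg

theorem fam_DH (i : Fin 3) : Fam (fun s => cov2 (q.move Y s).A (HForm (q.move Y s).e (q.move Y s).φ) i)
    (cov2 q.A (HForm q.e q.φ) i) (varDH q Y i) :=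
  Fam.cov (fam_A hq hY) (fam_HForm hq hY) i

theorem fam_constrF (i : Fin 3) : Fam (fun s => constrF (q.move Y s) i) (constrF q i) (varC q Y i) := by
  refine ((((fam_e hq hY (i + 1)).wedge3 (fam_curv hq hY (i + 2))).sub
    ((fam_e hq hY (i + 2)).wedge3 (fam_curv hq hY (i + 1)))).add
    ((fam_dφ hq hY).wedge3 (fam_curv hq hY i))).cast (fun s => rfl) rfl ?_
  rw [varC, cross3, cross3]
  abel

theorem vary_HForm (i : Fin 3) : vary (fun p => HForm p.e p.φ i) q Y = varH q Y i := by
  funext x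
  exact ((fam_HForm hq hY i).hasDerivAt (fun b => b x) (fun _ _ _ _ => rfl) fun _ _ _ => rfl).deriv

end Families

theorem dualVec_add (vol : Form M 3) (a b : Form M 2) (x : M) :
    dualVec vol (a + b) x = dualVec vol a x + dualVec vol b x := by
  refine stdFrame.ext_elem fun i => ?_
  rw [map_add, Finsupp.add_apply, repr_dualVec, repr_dualVec, repr_dualVec, Pi.add_apply, comp2_add,
    add_div]

theorem dualVec_smul (vol : Form M 3) (r : ℝ) (a : Form M 2) (x : M) :
    dualVec vol (r • a) x = r • dualVec vol a x := by
  refine stdFrame.ext_elem fun i => ?_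
  rw [map_smul, Finsupp.smul_apply, repr_dualVec, repr_dualVec, Pi.smul_apply, comp2_smul,
    mul_div_assoc, smul_eq_mul]

theorem ratio_add (vol a b : Form M 3) (x : M) : ratio (a + b) vol x = ratio a vol x + ratio b vol x :=
  add_div _ _ _

theorem ratio_smul (vol : Form M 3) (r : ℝ) (a : Form M 3) (x : M) :
    ratio (r • a) vol x = r * ratio a vol x := mul_div_assoc _ _ _

theorem hasDerivAt_line (a b : ℝ) : HasDerivAt (fun s : ℝ => a + s * b) b 0 := by
  simpa using ((hasDerivAt_id (0 : ℝ)).mul_const b).const_add a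

/-- At a fixed point, `dualVec` and `ratio` are linear in the form, so their variations are the same
operations applied to the first-order terms of H and π. -/
theorem TJ_eq (vol0 : Form M 3) {q Y : Fields M} (hq : q.Smooth) (hY : Y.Smooth) :
    TJ vol0 q Y = ⟨Y.et, fun i => dualVec vol0 (varH q Y i), Y.At, Y.A, Y.φ, ratio (varPi q Y) vol0⟩ := by
  rw [TJ]
  congr 1
  · funext i x; exact (hasDerivAt_line _ _).deriv
  · funext i x
    exact ((fam_HForm hq hY i).hasDerivAt (fun b => dualVec vol0 b x)
      (fun _ _ _ _ => dualVec_add _ _ _ _) fun _ _ _ => dualVec_smul _ _ _ _).deriv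
  · funext i x; exact (hasDerivAt_line _ _).deriv
  · funext i x
    exact ((fam_A hq hY i).hasDerivAt (fun b => b x) (fun _ _ _ _ => rfl) fun _ _ _ => rfl).deriv
  · funext x; exact (hasDerivAt_line _ _).deriv
  · funext x
    exact ((fam_piForm hq hY).hasDerivAt (fun b => ratio b vol0 x)
      (fun _ _ _ _ => ratio_add _ _ _ _) fun _ _ _ => ratio_smul _ _ _ _).deriv

theorem J_smooth {vol0 : Form M 3} (hvol : SmoothForm vol0) (hv : ∀ x, vol0 x ≠ 0) {q : Fields M}
    (hq : q.Smooth) : (J vol0 q).Smooth where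
  et := hq.et
  Ht i := SmoothVF.dualVec hvol hv (SmoothForm.HForm hq.e hq.φ i)
  At := hq.At
  A := hq.A
  φ := hq.φ
  pit := by
    refine SmoothFun.ratio (SmoothForm.neg ?_) hvol hv
    exact SmoothForm.sum (k := 3) fun i _ => (hq.e i).wedge3 (SmoothForm.curv hq.A i)

section Presymplectic

variable [T2Space M] [CompactSpace M] {vol0 : Form M 3} (hvol : SmoothForm vol0)
  (hv : ∀ x, vol0 x ≠ 0) {q : Fields M} (hq : q.Smooth)
include hvol hv hq

/-- First variation of the integrand of the momenta. -/
def varMom (q W Y : Fields M) : Form M 3 :=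
  ∑ i, wedge3 (W.A i) (varH q Y i) + fmul W.φ (varPi q Y)

omit [T2Space M] [CompactSpace M] hvol hv in
theorem fam_mom {W Y : Fields M} (hW : W.Smooth) (hY : Y.Smooth) :
    Fam (fun s => (∑ i, wedge3 (W.A i) (HForm (q.move Y s).e (q.move Y s).φ i))
        + fmul W.φ (piForm (q.move Y s).e (q.move Y s).A))
      ((∑ i, wedge3 (W.A i) (HForm q.e q.φ i)) + fmul W.φ (piForm q.e q.A)) (varMom q W Y) := by
  refine ((Fam.sum Finset.univ fun i => (Fam.const (hW.A i)).wedge3 (fam_HForm hq hY i)).add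
    ((fam_piForm hq hY).fmul hW.φ)).cast (fun _ => rfl) rfl ?_
  have h : ∀ i, wedge3 0 (HForm q.e q.φ i) = 0 := fun i => zero_wedge _
  simp only [h, zero_add]
  rfl

omit [T2Space M] [CompactSpace M] hvol hv in
theorem smooth_varMom {W Y : Fields M} (hW : W.Smooth) (hY : Y.Smooth) :
    SmoothForm (varMom q W Y) := (fam_mom hq hW hY).smooth.2.2

theorem deriv_momentum {W Y : Fields M} (hW : W.Smooth) (hY : Y.Smooth) :
    deriv (fun s : ℝ => momentum vol0 (q.move Y s) W) 0 = integral vol0 (varMom q W Y) :=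
  ((fam_mom hq hW hY).hasDerivAt (integral vol0)
    (fun _ _ ha hb => integral_add' hvol hv ha hb) fun r a _ => integral_smul' r a).deriv

theorem omega_eq {Z Y : Fields M} (hZ : Z.Smooth) (hY : Y.Smooth) :
    omega vol0 q Z Y = integral vol0 (varMom q Z Y - varMom q Y Z) := by
  rw [omega, deriv_momentum hvol hv hq hZ hY, deriv_momentum hvol hv hq hY hZ,
    sub_eq_add_neg (varMom q Z Y), neg_eq_smul, integral_add' hvol hv (smooth_varMom hq hZ hY)
      ((smooth_varMom hq hY hZ).smul _), integral_smul']
  ring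

/-- First variation of the integrand of the Hamiltonian. -/
def varHam (q Y : Fields M) : Form M 3 :=
  -∑ i, (fmul (Y.At i) (cov2 q.A (HForm q.e q.φ) i) + fmul (q.At i) (varDH q Y i)
    + (fmul (Y.et i) (constrF q i) + fmul (q.et i) (varC q Y i)))

omit [T2Space M] [CompactSpace M] hvol hv in
theorem fam_ham {Y : Fields M} (hY : Y.Smooth) :
    Fam (fun s => ∑ i, (fmul ((q.move Y s).At i) (cov (q.move Y s).A (HForm (q.move Y s).e (q.move Y s).φ) i)
      + fmul ((q.move Y s).et i) ((∑ j, ∑ k, eps i j k • wedge ((q.move Y s).e j) (curv (q.move Y s).A k))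
          + wedge (dFun (q.move Y s).φ) (curv (q.move Y s).A i))))
      (∑ i, (fmul (q.At i) (cov2 q.A (HForm q.e q.φ) i) + fmul (q.et i) (constrF q i)))
      (-varHam q Y) := by
  refine (Fam.sum Finset.univ fun i => ((fam_DH hq hY i).fmul_line (hq.At i) (hY.At i)).add
    ((fam_constrF hq hY i).fmul_line (hq.et i) (hY.et i))).cast (fun s => ?_) rfl (neg_neg _)
  refine Finset.sum_congr rfl fun i _ => ?_
  rw [eps_wedge3]
  rfl

theorem deriv_hamiltonian {Y : Fields M} (hY : Y.Smooth) :
    deriv (fun s : ℝ => hamiltonian vol0 (q.move Y s)) 0 = integral vol0 (varHam q Y) := by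
  have h := ((fam_ham hq hY).hasDerivAt (integral vol0)
    (fun _ _ ha hb => integral_add' hvol hv ha hb) fun r a _ => integral_smul' r a).neg
  rw [neg_eq_smul, integral_smul', neg_one_mul, neg_neg] at h
  exact h.deriv

end Presymplectic

end

/-! ### Integration by parts in the presymplectic form and in dH -/

section

variable {M : Type*} [TopologicalSpace M] [ChartedSpace E3 M]

/-- The 2-forms `ε_{ijk} e^j ∧ Z_A^k + dφ ∧ Z_{A i} - F_i Z_φ`. -/
def eqE (q Z : Fields M) (i : Fin 3) : Form M 2 :=
  cross2 q.e Z.A i + wedge2 (dFun q.φ) (Z.A i) - fmul Z.φ (curv q.A i)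

/-- The 2-forms `-ε_{ijk} e^j ∧ Z_e^k + dφ ∧ Z_{e i} - Z_φ De_i`. -/
def eqA (q Z : Fields M) (i : Fin 3) : Form M 2 :=
  -cross2 q.e Z.e i + wedge2 (dFun q.φ) (Z.e i) - fmul Z.φ (cov1 q.A q.e i)

/-- The 3-form `F_i ∧ Z_e^i + De_i ∧ Z_A^i`. -/
def eqφ (q Z : Fields M) : Form M 3 :=
  ∑ i, (wedge3 (Z.e i) (curv q.A i) + wedge3 (Z.A i) (cov1 q.A q.e i))

/-- The integrand of the expanded presymplectic form. -/
def expInt (q Z Y : Fields M) : Form M 3 :=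
  ∑ i, wedge3 (Y.e i) (eqE q Z i) + ∑ i, wedge3 (Y.A i) (eqA q Z i) + fmul Y.φ (eqφ q Z)

/-- The 1-forms `ε_{ijk} e_t^j e^k + e_t^i dφ`. -/
def shiftForm (q : Fields M) (i : Fin 3) : Form M 1 :=
  crossFun q.et q.e i + fmul (q.et i) (dFun q.φ)

/-- The variation of the Hamiltonian with respect to `e`. -/
def hamE (q : Fields M) (i : Fin 3) : Form M 2 :=
  cross2 q.e (covFun q.A q.At) i + wedge2 (dFun q.φ) (covFun q.A q.At i)
    + crossFun q.et (curv q.A) i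

/-- The variation of the Hamiltonian with respect to `A`. -/
def hamA (q : Fields M) (i : Fin 3) : Form M 2 :=
  crossFun q.At (HForm q.e q.φ) i - cov1 q.A (shiftForm q) i

/-- The integrand of the variation of the Hamiltonian along vectors with `Y_φ = 0`. -/
def hamInt (q Y : Fields M) : Form M 3 :=
  ∑ i, wedge3 (Y.e i) (hamE q i) + ∑ i, wedge3 (Y.A i) (hamA q i)
    - ∑ i, (fmul (Y.At i) (cov2 q.A (HForm q.e q.φ) i) + fmul (Y.et i) (constrF q i))

variable [IsManifold (𝓡 3) ∞ M]

theorem SmoothForm.shiftForm {q : Fields M} (hq : q.Smooth) (i : Fin 3) :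
    SmoothForm (shiftForm q i) :=
  (SmoothForm.crossFun hq.et hq.e i).add (SmoothForm.fmul (hq.et i) (SmoothForm.dFun hq.φ))

theorem SmoothForm.eqE {q Z : Fields M} (hq : q.Smooth) (hZ : Z.Smooth) (i : Fin 3) :
    SmoothForm (eqE q Z i) :=
  ((SmoothForm.cross2 hq.e hZ.A i).add ((SmoothForm.dFun hq.φ).wedge2 (hZ.A i))).sub
    (SmoothForm.fmul hZ.φ (SmoothForm.curv hq.A i))

theorem SmoothForm.eqA {q Z : Fields M} (hq : q.Smooth) (hZ : Z.Smooth) (i : Fin 3) :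
    SmoothForm (eqA q Z i) :=
  (((SmoothForm.cross2 hq.e hZ.e i).neg).add ((SmoothForm.dFun hq.φ).wedge2 (hZ.e i))).sub
    (SmoothForm.fmul hZ.φ (SmoothForm.cov1 hq.A hq.e i))

theorem SmoothForm.hamE {q : Fields M} (hq : q.Smooth) (i : Fin 3) : SmoothForm (hamE q i) :=
  have h := SmoothForm.covFun hq.A hq.At
  ((SmoothForm.cross2 hq.e h i).add ((SmoothForm.dFun hq.φ).wedge2 (h i))).add
    (SmoothForm.crossFun hq.et (SmoothForm.curv hq.A) i)

theorem SmoothForm.hamA {q : Fields M} (hq : q.Smooth) (i : Fin 3) : SmoothForm (hamA q i) :=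
  (SmoothForm.crossFun hq.At (SmoothForm.HForm hq.e hq.φ) i).sub
    (SmoothForm.cov1 hq.A (SmoothForm.shiftForm hq) i)

theorem SmoothForm.constrF {q : Fields M} (hq : q.Smooth) (i : Fin 3) : SmoothForm (constrF q i) :=
  (SmoothForm.cross3 hq.e (SmoothForm.curv hq.A) i).add
    ((SmoothForm.dFun hq.φ).wedge3 (SmoothForm.curv hq.A i))

theorem SmoothForm.expInt {q Z Y : Fields M} (hq : q.Smooth) (hZ : Z.Smooth) (hY : Y.Smooth) :
    SmoothForm (expInt q Z Y) :=
  ((SmoothForm.sum fun i _ => (hY.e i).wedge3 (SmoothForm.eqE hq hZ i)).add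
    (SmoothForm.sum fun i _ => (hY.A i).wedge3 (SmoothForm.eqA hq hZ i))).add
    (SmoothForm.fmul hY.φ (SmoothForm.sum fun i _ => ((hZ.e i).wedge3 (SmoothForm.curv hq.A i)).add
      ((hZ.A i).wedge3 (SmoothForm.cov1 hq.A hq.e i))))

theorem SmoothForm.hamInt {q Y : Fields M} (hq : q.Smooth) (hY : Y.Smooth) :
    SmoothForm (hamInt q Y) :=
  ((SmoothForm.sum fun i _ => (hY.e i).wedge3 (SmoothForm.hamE hq i)).add
    (SmoothForm.sum fun i _ => (hY.A i).wedge3 (SmoothForm.hamA hq i))).sub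
    (SmoothForm.sum fun i _ => (SmoothForm.fmul (hY.At i)
      (SmoothForm.cov2 hq.A (SmoothForm.HForm hq.e hq.φ) i)).add
      (SmoothForm.fmul (hY.et i) (SmoothForm.constrF hq i)))

/-- The two integrands of the presymplectic form differ by an exact form. -/
theorem varMom_sub {q Z Y : Fields M} (hq : q.Smooth) (hZ : Z.Smooth) (hY : Y.Smooth) :
    varMom q Z Y - varMom q Y Z = expInt q Z Y
      + d2 (∑ i, wedge2 (fmul Z.φ (q.e i)) (Y.A i) - ∑ i, wedge2 (fmul Y.φ (q.e i)) (Z.A i)) := by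
  -- The primitives Z_φ e_i ∧ Y_A^i and Y_φ e_i ∧ Z_A^i are those whose differentials remove every
  -- derivative of Y_A and Y_φ from the integrand.
  have h1 := fun i => SmoothForm.fmul hZ.φ (hq.e i)
  have h2 := fun i => SmoothForm.fmul hY.φ (hq.e i)
  rw [d2_sub (SmoothForm.sum fun i _ => (h1 i).wedge2 (hY.A i))
    (SmoothForm.sum fun i _ => (h2 i).wedge2 (hZ.A i)), d2_sum_wedge2 hq.A h1 hY.A,
    d2_sum_wedge2 hq.A h2 hZ.A]
  simp only [cov1_fmul hq.e hZ.φ, cov1_fmul hq.e hY.φ]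
  funext x
  refine ext_comp3 stdFrame ?_
  simp only [varMom, varH, varPi, expInt, eqE, eqA, eqφ, cross2, Fin.sum_univ_three, Pi.add_apply,
    Pi.sub_apply, Pi.neg_apply, comp3_add, comp3_sub, comp3_neg, comp3_wedge3, comp2_add, comp2_sub,
    comp2_neg, comp2_wedge2, comp3_fmul, comp2_fmul, comp1_fmul, Fin.isValue, Fin.reduceAdd]
  ring

/-- The variation of the Hamiltonian, up to an exact form. -/
theorem varHam_eq {q Y : Fields M} (hq : q.Smooth) (hY : Y.Smooth) (hφ : Y.φ = 0) :
    varHam q Y = hamInt q Y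
      + d2 (∑ i, wedge2 (shiftForm q i) (Y.A i) - ∑ i, fmul (q.At i) (varH q Y i)) := by
  have hH : ∀ i, SmoothForm (varH q Y i) := fun i => (fam_HForm hq hY i).smooth.2.2
  have hd : dFun Y.φ = 0 := by rw [hφ]; exact dFun_const 0
  have h0 : ∀ i, wedge2 (q.e i) 0 = 0 := fun i => wedge_zero _
  have h1 : ∀ i, wedge3 0 (curv q.A i) = 0 := fun i => zero_wedge _
  -- D is moved from Y_A onto `shiftForm`, and from the variation of H onto A_t.
  rw [d2_sub (SmoothForm.sum fun i _ => (SmoothForm.shiftForm hq i).wedge2 (hY.A i))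
    (SmoothForm.sum fun i _ => SmoothForm.fmul (hq.At i) (hH i)),
    d2_sum_wedge2 (a := shiftForm q) hq.A (SmoothForm.shiftForm hq) hY.A,
    d2_sum_fmul (B := varH q Y) hq.A hH hq.At]
  funext x
  refine ext_comp3 stdFrame ?_
  simp only [varHam, varDH, varC, hamInt, hamE, hamA, shiftForm, hd, h1, add_zero]
  simp only [Fin.sum_univ_three, Pi.add_apply, Pi.sub_apply, Pi.neg_apply, comp3_add, comp3_sub,
    comp3_neg, comp3_wedge3, comp2_add, comp2_sub, comp2_wedge2, comp3_fmul, Fin.isValue,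
    Fin.reduceAdd]
  simp only [varH, hd, h0, Pi.zero_apply, comp2_zero, cross2, cross3, crossFun, Pi.add_apply,
    Pi.sub_apply, comp3_sub, comp3_wedge3, comp2_add, comp2_sub, comp1_add, comp1_sub,
    comp2_wedge2, comp2_fmul, comp1_fmul, Fin.sum_univ_three, Fin.isValue, Fin.reduceAdd]
  ring

section Integrals

variable [T2Space M] [CompactSpace M] {vol0 : Form M 3} (hvol : SmoothForm vol0)
  (hv : ∀ x, vol0 x ≠ 0) {q : Fields M} (hq : q.Smooth)
include hvol hv

theorem integral_add_d2 {a : Form M 3} {b : Form M 2} (ha : SmoothForm a) (hb : SmoothForm b) :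
    integral vol0 (a + d2 b) = integral vol0 a := by
  rw [integral_add' hvol hv ha hb.d2]
  exact (congrArg _ (integral_extD hvol hv hb)).trans (add_zero _)

include hq

theorem omega_eq_expInt {Z Y : Fields M} (hZ : Z.Smooth) (hY : Y.Smooth) :
    omega vol0 q Z Y = integral vol0 (expInt q Z Y) := by
  rw [omega_eq hvol hv hq hZ hY, varMom_sub hq hZ hY]
  exact integral_add_d2 hvol hv (SmoothForm.expInt hq hZ hY) ((SmoothForm.sum fun i _ =>
    (SmoothForm.fmul hZ.φ (hq.e i)).wedge2 (hY.A i)).sub (SmoothForm.sum fun i _ =>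
      (SmoothForm.fmul hY.φ (hq.e i)).wedge2 (hZ.A i)))

omit hvol hv hq in
theorem omegaExpanded_eq (Z Y : Fields M) :
    omegaExpanded vol0 q Z Y = integral vol0 (expInt q Z Y) := by
  simp only [omegaExpanded, eps_wedge2]
  rfl

theorem omega_eq_omegaExpanded {Z Y : Fields M} (hZ : Z.Smooth) (hY : Y.Smooth) :
    omega vol0 q Z Y = omegaExpanded vol0 q Z Y := by
  rw [omega_eq_expInt hvol hv hq hZ hY, omegaExpanded_eq]

/-- No integration by parts is needed: for a 1-form θ, the product of θ with a 2-form B is θ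
evaluated on `dualVec vol0 B`, times the volume form. The two integrands are thus equal point by
point. -/
theorem omega_eq_omegaCan {Z Y : Fields M} (hZ : Z.Smooth) (hY : Y.Smooth) :
    omega vol0 q Z Y = omegaCan vol0 (TJ vol0 q Z) (TJ vol0 q Y) := by
  rw [omega_eq hvol hv hq hZ hY, TJ_eq vol0 hq hZ, TJ_eq vol0 hq hY, omegaCan]
  congr 1
  funext x
  refine ext_comp3 stdFrame ?_
  have h := comp3_ne_zero stdFrame (hv x)
  simp only [varMom, Fin.sum_univ_three, Pi.add_apply, Pi.sub_apply, comp3_add, comp3_sub,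
    comp3_wedge3, comp3_fmul, ev_eq stdFrame, repr_dualVec, ratio_eq stdFrame]
  field_simp
  ring

theorem deriv_hamiltonian_eq {Y : Fields M} (hY : Y.Smooth) (hφ : Y.φ = 0) :
    deriv (fun s : ℝ => hamiltonian vol0 (q.move Y s)) 0 = integral vol0 (hamInt q Y) := by
  rw [deriv_hamiltonian hvol hv hq hY, varHam_eq hq hY hφ]
  exact integral_add_d2 hvol hv (SmoothForm.hamInt hq hY) ((SmoothForm.sum fun i _ =>
    (SmoothForm.shiftForm hq i).wedge2 (hY.A i)).sub (SmoothForm.sum fun i _ =>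
      SmoothForm.fmul (hq.At i) (fam_HForm hq hY i).smooth.2.2))

end Integrals

end

/-! ### The matrix of the operator `opL` and its explicit inverse -/

section

section Cyclic

/-- Sums are started at a free index i and the second index is split, by `cyclic_cases`, into i, i +
1 and i + 2. One symbolic computation then covers all values of i. -/
theorem sum_cyclic {V : Type*} [AddCommMonoid V] (f : Fin 3 → V) (i : Fin 3) :
    ∑ k, f k = f i + f (i + 1) + f (i + 2) := by
  have h : ∀ a b c d : V, a + b + c = d → b + c + a = d := fun a b c d h => by rw [← h]; abel
  rw [Fin.sum_univ_three]
  fin_cases i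
  · rfl
  · exact (h _ _ _ _ rfl).symm
  · exact h _ _ _ _ rfl

@[elab_as_elim]
theorem cyclic_cases {p : Fin 3 → Prop} (i : Fin 3) (h0 : p i) (h1 : p (i + 1)) (h2 : p (i + 2))
    (m : Fin 3) : p m := by
  have h : ∀ i m : Fin 3, m = i ∨ m = i + 1 ∨ m = i + 2 := by decide
  rcases h i m with rfl | rfl | rfl <;> assumption

theorem kron_self (i : Fin 3) : kron i i = 1 := if_pos rfl

theorem kron_01 (i : Fin 3) : kron i (i + 1) = 0 := by fin_cases i <;> simp [kron]
theorem kron_02 (i : Fin 3) : kron i (i + 2) = 0 := by fin_cases i <;> simp [kron]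
theorem kron_10 (i : Fin 3) : kron (i + 1) i = 0 := by fin_cases i <;> simp [kron]
theorem kron_12 (i : Fin 3) : kron (i + 1) (i + 2) = 0 := by fin_cases i <;> simp [kron]
theorem kron_20 (i : Fin 3) : kron (i + 2) i = 0 := by fin_cases i <;> simp [kron]
theorem kron_21 (i : Fin 3) : kron (i + 2) (i + 1) = 0 := by fin_cases i <;> simp [kron]

end Cyclic

section Matrices

/-- The coefficients of `ε_{ijk} e^j ∧ w^k + s w_i ∧ p` for the coefficients `w` of the `w_i` and
`a` of `p` in the coframe `e`. -/
def opMat (s : ℝ) (a : Fin 3 → ℝ) (w : Fin 3 → Fin 3 → ℝ) (i m : Fin 3) : ℝ :=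
  kron i m * (∑ k, w k k) - w m i + s * (w i (m + 1) * a (m + 2) - w i (m + 2) * a (m + 1))

/-- The inverse of `opMat`, up to the factor `2 (1 + a²)`. -/
def invMat (s : ℝ) (a : Fin 3 → ℝ) (B : Fin 3 → Fin 3 → ℝ) (i m : Fin 3) : ℝ :=
  let n := ∑ k, a k ^ 2
  let t := ∑ k, B k k
  let r := ∑ k, (a (k + 1) * B k (k + 2) - a (k + 2) * B k (k + 1))
  let u := fun k => ∑ j, B k j * a j
  let v := fun k => ∑ j, a j * B j k
  let y := fun k l => B k (l + 1) * a (l + 2) - B k (l + 2) * a (l + 1)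
  let b := ∑ k, a k * u k
  n * B i m - 2 * (1 + n) * B m i + 2 * s * (a (i + 1) * B (i + 2) m - a (i + 2) * B (i + 1) m)
    - a i * v m - u i * a m + (a (i + 1) * y (i + 2) m - a (i + 2) * y (i + 1) m)
    + kron i m * ((1 + n) * t + s * r)
    - (s * t + s * b) * (kron i (m + 1) * a (m + 2) - kron i (m + 2) * a (m + 1))
    + (s * r - b) * (a i * a m)
    + 2 * s * ((a (i + 1) * u (i + 2) - a (i + 2) * u (i + 1)) * a m)

/-- A polynomial identity in the entries of a and B, valid for s = 1 and s = -1; the converse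
composition is `invMat_opMat`. Invertibility at every point comes from the factor 2(1 + a²), which
never vanishes. -/
theorem opMat_invMat {s : ℝ} (hs : s * s = 1) (a : Fin 3 → ℝ) (B : Fin 3 → Fin 3 → ℝ) (i m : Fin 3) :
    opMat s a (invMat s a B) i m = 2 * (1 + ∑ i, a i ^ 2) * B i m := by
  rcases mul_self_eq_one_iff.1 hs with rfl | rfl <;>
  refine cyclic_cases i ?_ ?_ ?_ m <;>
  simp only [opMat, invMat, fun f : Fin 3 → ℝ => sum_cyclic f i, kron_self, kron_01, kron_02, kron_10,
    kron_12, kron_20, kron_21, add_assoc, Fin.isValue, Fin.reduceAdd, add_zero, mul_one, one_mul,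
    zero_mul, mul_zero, zero_sub, sub_zero] <;>
  ring

theorem invMat_opMat {s : ℝ} (hs : s * s = 1) (a : Fin 3 → ℝ) (w : Fin 3 → Fin 3 → ℝ) (i m : Fin 3) :
    invMat s a (opMat s a w) i m = 2 * (1 + ∑ i, a i ^ 2) * w i m := by
  rcases mul_self_eq_one_iff.1 hs with rfl | rfl <;>
  refine cyclic_cases i ?_ ?_ ?_ m <;>
  simp only [opMat, invMat, fun f : Fin 3 → ℝ => sum_cyclic f i, kron_self, kron_01, kron_02, kron_10,
    kron_12, kron_20, kron_21, add_assoc, Fin.isValue, Fin.reduceAdd, add_zero, mul_one, one_mul,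
    zero_mul, mul_zero, zero_sub, sub_zero] <;>
  ring

end Matrices

end

/-! ### Dual frames, and the operator `opL` on forms -/

section

section Coframe

variable {M : Type*} {e : Fin 3 → Form M 1} {x : M}

/-- A frame dual to the coframe `e` at `x`. -/
def DualFrame (v : Frame) (e : Fin 3 → Form M 1) (x : M) : Prop :=
  ∀ i j, comp1 v (e i x) j = kron i j

theorem comp3_volOf (v : Frame) (e : Fin 3 → Form M 1) (x : M) :
    comp3 v (volOf e x) = (Matrix.of fun i j => comp1 v (e i x) j).det := by
  rw [volOf_eq, Matrix.det_fin_three]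
  simp only [comp3_wedge3, comp2_wedge2, Fin.sum_univ_three, Fin.isValue, Fin.reduceAdd,
    Matrix.of_apply]
  ring

/-- The e^i together map the tangent space linearly to ℝ³, injectively because vol_e is the
determinant of their components. The frame is the preimage of the standard basis. It is chosen point
by point, with no claim of smooth dependence. -/
theorem exists_dualFrame (h : volOf e x ≠ 0) : ∃ v : Frame, DualFrame v e x := by
  have hd := comp3_ne_zero stdFrame h
  rw [comp3_volOf] at hd
  let T : E3 →ₗ[ℝ] (Fin 3 → ℝ) := LinearMap.pi fun i =>
    ((ContinuousAlternatingMap.ofSubsingleton ℝ E3 ℝ (0 : Fin 1)).symm (e i x) : E3 →L[ℝ] ℝ)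
  have hT : ∀ u i, T u i = e i x (fun _ => u) := fun u i => by
    simp [T, ContinuousAlternatingMap.ofSubsingleton]
  have hinj : Function.Injective T := by
    rw [injective_iff_map_eq_zero]
    intro u hu
    refine stdFrame.ext_elem fun i => ?_
    have h0 := Matrix.eq_zero_of_mulVec_eq_zero hd (v := fun j => stdFrame.repr u j) (by
      funext i
      have := hT u i
      rw [hu, form_apply_eq_comp1 stdFrame] at this
      simp only [Matrix.mulVec, dotProduct, Matrix.of_apply]
      rw [Pi.zero_apply] at this ⊢
      rw [this]
      exact Finset.sum_congr rfl fun j _ => mul_comm _ _)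
    rw [map_zero]
    exact congrFun h0 i
  let L := LinearMap.linearEquivOfInjective T hinj (by simp)
  refine ⟨(Pi.basisFun ℝ (Fin 3)).map L.symm, fun i j => ?_⟩
  rw [comp1, ← hT, Module.Basis.map_apply]
  have : T (L.symm ((Pi.basisFun ℝ (Fin 3)) j)) = (Pi.basisFun ℝ (Fin 3)) j :=
    L.apply_symm_apply _
  rw [this, Pi.basisFun_apply, Pi.single_apply, kron]

theorem DualFrame.comp3_volOf {v : Frame} (hv : DualFrame v e x) : comp3 v (volOf e x) = 1 := by
  rw [HK.comp3_volOf, Matrix.det_fin_three]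
  simp [hv _ _, kron]

/-- The coefficients of a 1-form in the coframe `e`. -/
def coef (e : Fin 3 → Form M 1) (a : Form M 1) (m : Fin 3) : M → ℝ :=
  ratio (wedge3 a (wedge2 (e (m + 1)) (e (m + 2)))) (volOf e)

/-- The coefficients of a 2-form in the coframe `e`. -/
def coef2 (e : Fin 3 → Form M 1) (B : Form M 2) (m : Fin 3) : M → ℝ :=
  ratio (wedge3 (e m) B) (volOf e)

theorem DualFrame.coef_eq {v : Frame} (hv : DualFrame v e x) (a : Form M 1) (m : Fin 3) :
    coef e a m x = comp1 v (a x) m := by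
  rw [coef, ratio_eq v, hv.comp3_volOf, comp3_wedge3, div_one, sum_cyclic _ m]
  simp only [comp2_wedge2, hv _ _, kron_self, kron_10, kron_12, kron_20, kron_21, add_assoc, Fin.isValue, Fin.reduceAdd, add_zero, mul_one,
    mul_zero, sub_zero]

theorem DualFrame.coef2_eq {v : Frame} (hv : DualFrame v e x) (B : Form M 2) (m : Fin 3) :
    coef2 e B m x = comp2 v (B x) m := by
  rw [coef2, ratio_eq v, hv.comp3_volOf, comp3_wedge3, div_one, sum_cyclic _ m]
  simp only [hv _ _, kron_self, kron_01, kron_02, one_mul, zero_mul, add_zero]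

theorem alpha_eq_coef (e : Fin 3 → Form M 1) [TopologicalSpace M] [ChartedSpace E3 M] (φ : M → ℝ)
    (i : Fin 3) : alpha e φ i = coef e (dFun φ) i := by
  have : alpha e φ i = ratio (wedge3 (dFun φ) (dual2 e i)) (volOf e) := rfl
  rw [this, dual2_eq, coef]

theorem matOf_eq_coef2 (F : Fin 3 → Form M 2) (e : Fin 3 → Form M 1) (i j : Fin 3) :
    matOf F e i j = coef2 e (F i) j := rfl

/-- The map `w ↦ ε_{ijk} e^j ∧ w^k + s w_i ∧ p`. -/
def opL (s : ℝ) (e : Fin 3 → Form M 1) (p : Form M 1) (w : Fin 3 → Form M 1) (i : Fin 3) :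
    Form M 2 := cross2 e w i + s • wedge2 (w i) p

/-- The inverse of `opL`. -/
def invL (s : ℝ) (e : Fin 3 → Form M 1) (p : Form M 1) (B : Fin 3 → Form M 2) (i : Fin 3) :
    Form M 1 := fun x =>
  ∑ m, (invMat s (fun k => coef e p k x) (fun j k => coef2 e (B j) k x) i m /
    (2 * (1 + ∑ k, coef e p k x ^ 2))) • e m x

theorem one_add_sum_sq_pos (a : Fin 3 → ℝ) : 0 < 1 + ∑ k, a k ^ 2 := by positivity

theorem DualFrame.comp2_opL {v : Frame} (hv : DualFrame v e x) (s : ℝ) (p : Form M 1)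
    (w : Fin 3 → Form M 1) (i m : Fin 3) :
    comp2 v (opL s e p w i x) m
      = opMat s (fun k => comp1 v (p x) k) (fun i j => comp1 v (w i x) j) i m := by
  simp only [opL, opMat, cross2, Pi.add_apply, Pi.sub_apply, Pi.smul_apply, comp2_add, comp2_sub,
    comp2_smul, comp2_wedge2, hv _ _]
  refine cyclic_cases i ?_ ?_ ?_ m <;>
  simp only [fun f : Fin 3 → ℝ => sum_cyclic f i, kron_self, kron_01, kron_02, kron_10,
    kron_12, kron_20, kron_21, add_assoc, Fin.isValue, Fin.reduceAdd, add_zero] <;>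
  ring

theorem DualFrame.comp1_sum_smul {v : Frame} (hv : DualFrame v e x) (c : Fin 3 → ℝ) (m : Fin 3) :
    comp1 v (∑ k, c k • e k x) m = c m := by
  rw [comp1_sum, sum_cyclic _ m]
  simp only [comp1_smul, hv _ _, kron_self, kron_10, kron_20, mul_one, mul_zero, add_zero]

theorem DualFrame.comp1_invL {v : Frame} (hv : DualFrame v e x) (s : ℝ) (p : Form M 1)
    (B : Fin 3 → Form M 2) (i m : Fin 3) :
    comp1 v (invL s e p B i x) m
      = invMat s (fun k => comp1 v (p x) k) (fun j k => comp2 v (B j x) k) i m /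
        (2 * (1 + ∑ k, comp1 v (p x) k ^ 2)) := by
  rw [invL, hv.comp1_sum_smul]
  simp only [hv.coef_eq, hv.coef2_eq]

theorem opMat_div (s : ℝ) (a : Fin 3 → ℝ) (w : Fin 3 → Fin 3 → ℝ) (c : ℝ) (i m : Fin 3) :
    opMat s a (fun i j => w i j / c) i m = opMat s a w i m / c := by
  simp only [opMat, ← Finset.sum_div]
  ring

theorem opL_invL {s : ℝ} (hs : s * s = 1) (he : ∀ x, volOf e x ≠ 0) (p : Form M 1)
    (B : Fin 3 → Form M 2) (i : Fin 3) : opL s e p (invL s e p B) i = B i := by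
  funext x
  obtain ⟨v, hv⟩ := exists_dualFrame (he x)
  refine ext_comp2 v fun m => ?_
  have := one_add_sum_sq_pos fun k => comp1 v (p x) k
  simp only [hv.comp2_opL, hv.comp1_invL]
  rw [opMat_div, opMat_invMat hs]
  field_simp

theorem invL_opL {s : ℝ} (hs : s * s = 1) (he : ∀ x, volOf e x ≠ 0) (p : Form M 1)
    (w : Fin 3 → Form M 1) (i : Fin 3) : invL s e p (opL s e p w) i = w i := by
  funext x
  obtain ⟨v, hv⟩ := exists_dualFrame (he x)
  refine ext_comp1 v fun m => ?_
  have := one_add_sum_sq_pos fun k => comp1 v (p x) k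
  rw [hv.comp1_invL]
  simp only [hv.comp2_opL]
  rw [invMat_opMat hs]
  field_simp

theorem opL_injective {s : ℝ} (hs : s * s = 1) (he : ∀ x, volOf e x ≠ 0) {p : Form M 1}
    {w z : Fin 3 → Form M 1} (h : ∀ i, opL s e p w i = opL s e p z i) (i : Fin 3) : w i = z i := by
  rw [← invL_opL hs he p w, funext h, invL_opL hs he]

/-- A 2-form is determined by its products with the elements of a coframe. -/
theorem eq_zero_of_wedge3_eq_zero (he : volOf e x ≠ 0) {B : Form M 2}
    (h : ∀ m, ratio (wedge3 (e m) B) (volOf e) x = 0) : B x = 0 := by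
  obtain ⟨v, hv⟩ := exists_dualFrame he
  exact ext_comp2 v fun m => (hv.coef2_eq B m).symm.trans (h m)

end Coframe

section Smooth

variable {M : Type*} [TopologicalSpace M] [ChartedSpace E3 M] [IsManifold (𝓡 3) ∞ M]
  {e : Fin 3 → Form M 1} (hes : ∀ i, SmoothForm (e i)) (he : ∀ x, volOf e x ≠ 0)
include hes

theorem smooth_volOf : SmoothForm (volOf e) := by
  rw [volOf_eq]; exact (hes 0).wedge3 ((hes 1).wedge2 (hes 2))

include he

theorem SmoothFun.coef {a : Form M 1} (ha : SmoothForm a) (m : Fin 3) : SmoothFun (coef e a m) :=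
  SmoothFun.ratio (ha.wedge3 ((hes _).wedge2 (hes _))) (smooth_volOf hes) he

theorem SmoothFun.coef2 {B : Form M 2} (hB : SmoothForm B) (m : Fin 3) : SmoothFun (coef2 e B m) :=
  SmoothFun.ratio ((hes m).wedge3 hB) (smooth_volOf hes) he

omit hes he [IsManifold (𝓡 3) ∞ M] in
theorem SmoothFun.invMat {s : ℝ} {a : Fin 3 → M → ℝ} {B : Fin 3 → Fin 3 → M → ℝ}
    (ha : ∀ i, SmoothFun (a i)) (hB : ∀ i j, SmoothFun (B i j)) (i m : Fin 3) :
    SmoothFun (fun x => invMat s (fun k => a k x) (fun j k => B j k x) i m) := by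
  have hn : SmoothFun (fun x => ∑ k, a k x ^ 2) :=
    SmoothFun.sum fun k _ => by simpa only [pow_two] using (ha k).mul (ha k)
  have ht : SmoothFun (fun x => ∑ k, B k k x) := SmoothFun.sum fun k _ => hB k k
  have hr : SmoothFun (fun x => ∑ k, (a (k + 1) x * B k (k + 2) x - a (k + 2) x * B k (k + 1) x)) :=
    SmoothFun.sum fun k _ => ((ha _).mul (hB _ _)).sub ((ha _).mul (hB _ _))
  have hu : ∀ k, SmoothFun (fun x => ∑ j, B k j x * a j x) := fun k =>
    SmoothFun.sum fun j _ => (hB _ _).mul (ha _)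
  have hw : ∀ k, SmoothFun (fun x => ∑ j, a j x * B j k x) := fun k =>
    SmoothFun.sum fun j _ => (ha _).mul (hB _ _)
  have hy : ∀ k l, SmoothFun (fun x => B k (l + 1) x * a (l + 2) x - B k (l + 2) x * a (l + 1) x) :=
    fun k l => ((hB _ _).mul (ha _)).sub ((hB _ _).mul (ha _))
  have hb : SmoothFun (fun x => ∑ k, a k x * ∑ j, B k j x * a j x) :=
    SmoothFun.sum fun k _ => (ha k).mul (hu k)
  have h1 := (SmoothFun.const (M := M) 1).add hn
  have c := fun r : ℝ => SmoothFun.const (M := M) r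
  exact (((((((((hn.mul (hB i m)).sub (((c 2).mul h1).mul (hB m i))).add
    ((c (2 * s)).mul (((ha _).mul (hB _ _)).sub ((ha _).mul (hB _ _))))).sub
    ((ha i).mul (hw m))).sub ((hu i).mul (ha m))).add
    (((ha _).mul (hy _ m)).sub ((ha _).mul (hy _ m)))).add
    ((c (kron i m)).mul ((h1.mul ht).add ((c s).mul hr)))).sub
    ((((c s).mul ht).add ((c s).mul hb)).mul (((c (kron i (m + 1))).mul (ha _)).sub
      ((c (kron i (m + 2))).mul (ha _))))).add
    ((((c s).mul hr).sub hb).mul ((ha i).mul (ha m)))).add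
    ((c (2 * s)).mul ((((ha _).mul (hu _)).sub ((ha _).mul (hu _))).mul (ha m)))

/-- The coefficients in `invL` are quotients of globally defined 3-forms and not components in a
chosen dual frame; smoothness of the solutions rests on this. -/
theorem SmoothForm.invL (s : ℝ) {p : Form M 1} (hp : SmoothForm p) {B : Fin 3 → Form M 2}
    (hB : ∀ i, SmoothForm (B i)) (i : Fin 3) : SmoothForm (invL s e p B i) := by
  have hc := fun k => SmoothFun.coef hes he hp k
  have h : HK.invL s e p B i = ∑ m, HK.fmul (fun x => HK.invMat s (fun k => HK.coef e p k x)
      (fun j k => HK.coef2 e (B j) k x) i m / (2 * (1 + ∑ k, HK.coef e p k x ^ 2))) (e m) := by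
    funext x
    rw [Finset.sum_apply]
    rfl
  rw [h]
  refine SmoothForm.sum fun m _ => SmoothForm.fmul ?_ (hes m)
  refine SmoothFun.div (SmoothFun.invMat hc (fun j k => SmoothFun.coef2 hes he (hB j) k) i m)
    ((SmoothFun.const 2).mul ((SmoothFun.const 1).add (SmoothFun.sum fun k _ => ?_))) fun x =>
      (mul_pos two_pos (one_add_sum_sq_pos _)).ne'
  simpa only [pow_two] using (hc k).mul (hc k)

end Smooth

end

/-! ### Symmetric solutions, and additivity of variations -/

section

section Symmetric

variable {M : Type*} {e : Fin 3 → Form M 1} {x : M} {v : Frame} (hv : DualFrame v e x)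
include hv

/-- The antisymmetric part of `w`, recovered from `opL`. -/
theorem DualFrame.antisymm_opL {s : ℝ} (hs : s * s = 1) (p : Form M 1) (w : Fin 3 → Form M 1)
    (i : Fin 3) :
    comp3 v (cross3 e (opL s e p w) i x) - s * comp3 v (wedge3 p (opL s e p w i) x)
      = comp1 v (w (i + 2) x) (i + 1) - comp1 v (w (i + 1) x) (i + 2) := by
  simp only [cross3, Pi.sub_apply, comp3_sub, comp3_wedge3, hv.comp2_opL, hv _ _, opMat,
    fun f : Fin 3 → ℝ => sum_cyclic f i, kron_self, kron_01, kron_02, kron_10, kron_12, kron_20,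
    kron_21, add_assoc, Fin.isValue, Fin.reduceAdd, add_zero]
  rcases mul_self_eq_one_iff.1 hs with rfl | rfl <;> ring

/-- This is how the secondary constraints act. For F = opL(-1) w, (F) means that the matrix of w is
symmetric; for De = -opL(1) z, (T) means the same for z. -/
theorem DualFrame.symm_of_opL {s : ℝ} (hs : s * s = 1) {p : Form M 1} {w : Fin 3 → Form M 1}
    (h : ∀ i, cross3 e (opL s e p w) i - s • wedge3 p (opL s e p w i) = 0) (i j : Fin 3) :
    comp1 v (w i x) j = comp1 v (w j x) i := by
  have h1 : ∀ i, comp1 v (w (i + 2) x) (i + 1) = comp1 v (w (i + 1) x) (i + 2) := fun i => by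
    have := congrArg (comp3 v) (congrFun (h i) x)
    rw [← sub_eq_zero, ← hv.antisymm_opL hs p w i]
    simpa only [Pi.sub_apply, Pi.smul_apply, Pi.zero_apply, comp3_sub, comp3_smul, comp3_zero] using this
  refine cyclic_cases i rfl ?_ ?_ j
  · have := h1 (i + 2)
    simp only [add_assoc, Fin.isValue, Fin.reduceAdd, add_zero] at this
    exact this.symm
  · have := h1 (i + 1)
    simpa only [add_assoc, Fin.isValue, Fin.reduceAdd, add_zero] using this

omit hv in
-- The operators with s = -1 and s = 1 are adjoint for the pairing Σ z_i ∧ B_i: exchanging the two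
-- 1-forms changes the sign of the term containing p.
theorem sum_wedge3_opL (he : volOf e x ≠ 0) (p : Form M 1) (w z : Fin 3 → Form M 1) :
    ∑ i, (wedge3 (z i) (opL (-1) e p w i) - wedge3 (w i) (opL 1 e p z i)) x = 0 := by
  obtain ⟨v, hv⟩ := exists_dualFrame he
  refine ext_comp3 v ?_
  simp only [opL, cross2, Fin.sum_univ_three, Pi.add_apply, Pi.sub_apply, Pi.smul_apply, comp3_add,
    comp3_sub, comp3_wedge3, comp3_zero, comp2_add, comp2_sub, comp2_smul, comp2_wedge2,
    Fin.isValue, Fin.reduceAdd]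
  ring

/-- The cross-product companion of the adjointness relation, here for symmetric matrices. Together
with `cross3_flux` it makes dH vanish along the kernel vectors. -/
theorem DualFrame.cross3_opL {p : Form M 1} {w z : Fin 3 → Form M 1}
    (hw : ∀ i j, comp1 v (w i x) j = comp1 v (w j x) i)
    (hz : ∀ i j, comp1 v (z i x) j = comp1 v (z j x) i) (i : Fin 3) :
    cross3 z (opL (-1) e p w) i x + cross3 w (opL 1 e p z) i x = 0 := by
  refine ext_comp3 v ?_
  simp only [cross3, Pi.sub_apply, comp3_add, comp3_sub, comp3_wedge3, comp3_zero, hv.comp2_opL,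
    opMat, fun f : Fin 3 → ℝ => sum_cyclic f i, kron_self, kron_01, kron_02, kron_10, kron_12,
    kron_20, kron_21, add_assoc, Fin.isValue, Fin.reduceAdd, add_zero, hw (i + 1) i, hw (i + 2) i,
    hw (i + 2) (i + 1), hz (i + 1) i, hz (i + 2) i, hz (i + 2) (i + 1)]
  ring

theorem DualFrame.cross3_flux {p : Form M 1} {w : Fin 3 → Form M 1}
    (hw : ∀ i j, comp1 v (w i x) j = comp1 v (w j x) i) (i : Fin 3) :
    cross3 e (opL (-1) e p w) i x
      + cross3 w (fun i => wedge2 (e (i + 1)) (e (i + 2)) + wedge2 (e i) p) i x = 0 := by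
  refine ext_comp3 v ?_
  simp only [cross3, Pi.sub_apply, Pi.add_apply, comp3_add, comp3_sub, comp3_wedge3, comp3_zero,
    hv.comp2_opL, hv _ _, comp2_add, comp2_wedge2,
    opMat, fun f : Fin 3 → ℝ => sum_cyclic f i, kron_self, kron_01, kron_02, kron_10, kron_12,
    kron_20, kron_21, add_assoc, Fin.isValue, Fin.reduceAdd, add_zero, hw (i + 1) i, hw (i + 2) i,
    hw (i + 2) (i + 1)]
  ring

end Symmetric

section Variation

variable {M : Type*} [TopologicalSpace M] [ChartedSpace E3 M] [IsManifold (𝓡 3) ∞ M]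

/-- `DH` is the torsion constraint. -/
theorem cov2_HForm {q : Fields M} (hq : q.Smooth) (i : Fin 3) :
    cov2 q.A (HForm q.e q.φ) i = -constrT q i := by
  have h1 : cov2 q.A (HForm q.e q.φ) i
      = d2 (wedge2 (q.e (i + 1)) (q.e (i + 2))) + cov2 q.A (fun j => wedge2 (q.e j) (dFun q.φ)) i
        + cross3 q.A (fun j => wedge2 (q.e (j + 1)) (q.e (j + 2))) i := by
    rw [cov2_eq, cov2_eq, HForm_eq, d2_add ((hq.e _).wedge2 (hq.e _))
      ((hq.e _).wedge2 (SmoothForm.dFun hq.φ))]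
    funext x
    refine ext_comp3 stdFrame ?_
    simp only [cross3, HForm_eq, Pi.add_apply, Pi.sub_apply, comp3_add, comp3_sub, comp3_wedge3,
      comp2_add, Fin.sum_univ_three]
    ring
  rw [h1, cov2_wedge2_dFun hq.e hq.φ, d2_wedge2 (hq.e _) (hq.e _), constrT]
  funext x
  refine ext_comp3 stdFrame ?_
  simp only [cov1_eq, cross2, cross3, Pi.add_apply, Pi.sub_apply, Pi.neg_apply, comp3_add, comp3_sub,
    comp3_neg, comp3_wedge3, comp2_add, comp2_sub, comp2_wedge2, Fin.sum_univ_three, add_assoc,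
    Fin.isValue, Fin.reduceAdd, add_zero, zero_add]
  ring

theorem cov1_add {A a b : Fin 3 → Form M 1} (ha : ∀ i, SmoothForm (a i)) (hb : ∀ i, SmoothForm (b i))
    (i : Fin 3) : cov1 A (fun i => a i + b i) i = cov1 A a i + cov1 A b i := by
  simp only [cov1_eq, cross2]
  rw [d1_add (ha i) (hb i)]
  funext x
  refine ext_comp2 stdFrame fun m => ?_
  simp only [Pi.add_apply, Pi.sub_apply, comp2_add, comp2_sub, comp2_wedge2, comp1_add]
  ring

theorem cov1_sub {A a b : Fin 3 → Form M 1} (ha : ∀ i, SmoothForm (a i)) (hb : ∀ i, SmoothForm (b i))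
    (i : Fin 3) : cov1 A (fun i => a i - b i) i = cov1 A a i - cov1 A b i := by
  simp only [cov1_eq, cross2]
  rw [d1_sub (ha i) (hb i)]
  funext x
  refine ext_comp2 stdFrame fun m => ?_
  simp only [Pi.add_apply, Pi.sub_apply, comp2_add, comp2_sub, comp2_wedge2, comp1_sub]
  ring

theorem cov2_add {A : Fin 3 → Form M 1} {a b : Fin 3 → Form M 2} (ha : ∀ i, SmoothForm (a i))
    (hb : ∀ i, SmoothForm (b i)) (i : Fin 3) :
    cov2 A (fun i => a i + b i) i = cov2 A a i + cov2 A b i := by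
  simp only [cov2_eq, cross3]
  rw [d2_add (ha i) (hb i)]
  funext x
  refine ext_comp3 stdFrame ?_
  simp only [Pi.add_apply, Pi.sub_apply, comp3_add, comp3_sub, comp3_wedge3, comp2_add,
    Fin.sum_univ_three]
  ring

/-- Sums of tangent vectors. -/
def Fields.add {M : Type*} (Y K : Fields M) : Fields M where
  et := fun i x => Y.et i x + K.et i x
  e := fun i => Y.e i + K.e i
  At := fun i x => Y.At i x + K.At i x
  A := fun i => Y.A i + K.A i
  φ := fun x => Y.φ x + K.φ x

theorem expInt_add (q Z Y K : Fields M) : expInt q Z (Y.add K) = expInt q Z Y + expInt q Z K := by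
  funext x
  refine ext_comp3 stdFrame ?_
  simp only [expInt, Fields.add, Fin.sum_univ_three, Pi.add_apply, comp3_add, comp3_wedge3,
    comp3_fmul, comp1_add]
  ring

theorem varH_add {q Y K : Fields M} (hY : Y.Smooth) (hK : K.Smooth) (i : Fin 3) :
    varH q (Y.add K) i = varH q Y i + varH q K i := by
  rw [varH, Fields.add, dFun_add hY.φ hK.φ]
  funext x
  refine ext_comp2 stdFrame fun m => ?_
  simp only [varH, cross2, Pi.add_apply, Pi.sub_apply, comp2_add, comp2_sub, comp2_wedge2, comp1_add]
  ring

theorem varHam_add {q Y K : Fields M} (hq : q.Smooth) (hY : Y.Smooth) (hK : K.Smooth) :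
    varHam q (Y.add K) = varHam q Y + varHam q K := by
  have h1 : ∀ i, cov2 q.A (varH q (Y.add K)) i = cov2 q.A (varH q Y) i + cov2 q.A (varH q K) i :=
    fun i => by
      rw [funext (varH_add (q := q) hY hK), cov2_add (fun i => (fam_HForm hq hY i).smooth.2.2)
        fun i => (fam_HForm hq hK i).smooth.2.2]
  have h2 : ∀ i, cov1 q.A (Y.add K).A i = cov1 q.A Y.A i + cov1 q.A K.A i := cov1_add hY.A hK.A
  have h3 : dFun (Y.add K).φ = dFun Y.φ + dFun K.φ := dFun_add hY.φ hK.φ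
  funext x
  refine ext_comp3 stdFrame ?_
  simp only [varHam, varDH, varC, cross3, h1, h2, h3]
  simp only [Fields.add, Fin.sum_univ_three, Pi.add_apply, Pi.sub_apply, Pi.neg_apply, comp3_add,
    comp3_sub, comp3_neg, comp3_wedge3, comp3_fmul, comp2_add, comp1_add, Fin.isValue, Fin.reduceAdd]
  ring

end Variation

end

/-! ### Kernel vectors of the presymplectic form -/

section

variable {M : Type*} [TopologicalSpace M] [ChartedSpace E3 M] [IsManifold (𝓡 3) ∞ M]

theorem volOf_ne_zero_of_ratio {e : Fin 3 → Form M 1} {vol0 : Form M 3} {x : M}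
    (h : ratio (volOf e) vol0 x ≠ 0) : volOf e x ≠ 0 := by
  intro h0
  apply h
  rw [ratio, h0]
  exact zero_div _

section Automatic

/-- The vectors along which the presymplectic form and, on the constraint surface, the differential
of the Hamiltonian vanish. -/
def kernelVec (q : Fields M) (l : M → ℝ) : Fields M where
  et := 0
  e := fun i => fmul l (invL 1 q.e (dFun q.φ) (fun i => -cov1 q.A q.e i) i)
  At := 0
  A := fun i => fmul l (invL (-1) q.e (dFun q.φ) (curv q.A) i)
  φ := l

variable {q : Fields M} (hq : q.Smooth) (he : ∀ x, volOf q.e x ≠ 0)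
include hq he

theorem kernelVec_smooth {l : M → ℝ} (hl : SmoothFun l) : (kernelVec q l).Smooth where
  et _ := SmoothFun.const 0
  e i := SmoothForm.fmul hl (SmoothForm.invL hq.e he _ (SmoothForm.dFun hq.φ)
    (fun i => (SmoothForm.cov1 hq.A hq.e i).neg) i)
  At _ := SmoothFun.const 0
  A i := SmoothForm.fmul hl (SmoothForm.invL hq.e he _ (SmoothForm.dFun hq.φ)
    (SmoothForm.curv hq.A) i)
  φ := hl

/-- With w and z defined by opL(-1) w = F and opL(1) z = -De, the vector (Z_e, Z_A, Z_φ) = l (z, w,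
1) cancels `eqE` and `eqA` by construction. It cancels `eqφ` because the two operators are adjoint.
The constraints play no role. -/
theorem expInt_kernelVec (l : M → ℝ) (Z : Fields M) : expInt q (kernelVec q l) Z = 0 := by
  have hw := opL_invL (s := -1) (by norm_num) he (dFun q.φ) (curv q.A)
  have hz := opL_invL (s := 1) (by norm_num) he (dFun q.φ) (fun i => -cov1 q.A q.e i)
  have hk : kernelVec q l = ⟨0, fun i => fmul l (invL 1 q.e (dFun q.φ) (fun i => -cov1 q.A q.e i) i),
    0, fun i => fmul l (invL (-1) q.e (dFun q.φ) (curv q.A) i), l⟩ := rfl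
  rw [hk]
  generalize invL (-1) q.e (dFun q.φ) (curv q.A) = w at hw ⊢
  generalize invL 1 q.e (dFun q.φ) (fun i => -cov1 q.A q.e i) = z at hz ⊢
  have hT : ∀ i, cov1 q.A q.e i = -opL 1 q.e (dFun q.φ) z i := fun i => by rw [hz, neg_neg]
  funext x
  have h := congrArg (comp3 stdFrame) (sum_wedge3_opL (he x) (dFun q.φ) w z)
  refine ext_comp3 stdFrame ?_
  simp only [Fin.sum_univ_three, Pi.sub_apply, comp3_add, comp3_sub, comp3_wedge3, comp3_zero] at h
  simp only [expInt, eqE, eqA, eqφ, hT, ← hw]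
  simp only [Fin.sum_univ_three, Pi.add_apply, Pi.sub_apply, Pi.neg_apply, Pi.zero_apply, comp3_add,
    comp3_wedge3, comp3_fmul, comp2_add, comp2_sub, comp2_neg, comp2_fmul, comp1_fmul, comp3_zero]
  simp only [opL, cross2, Pi.add_apply, Pi.sub_apply, Pi.smul_apply, comp2_add, comp2_sub,
    comp2_smul, comp2_wedge2, comp1_fmul, Fin.isValue, Fin.reduceAdd] at h ⊢
  linear_combination (Z.φ x * l x) * h

/-- H varies by -D(l e), so D of its variation is (l e) × F. Adding (l w) × H gives zero for
symmetric w, which settles the terms in A_t. For those in e_t, the Bianchi identity applied to F =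
opL(-1) w expresses e × Dw + dφ ∧ Dw as -w × De, which cancels against z × F when w and z are
symmetric. -/
theorem varHam_kernelVec {l : M → ℝ} (hl : SmoothFun l) (hF : ∀ i, constrF q i = 0)
    (hT : ∀ i, constrT q i = 0) : varHam q (kernelVec q l) = 0 := by
  have hw := opL_invL (s := -1) (by norm_num) he (dFun q.φ) (curv q.A)
  have hz := opL_invL (s := 1) (by norm_num) he (dFun q.φ) (fun i => -cov1 q.A q.e i)
  have hws := SmoothForm.invL hq.e he (-1) (SmoothForm.dFun hq.φ) (SmoothForm.curv hq.A)
  have hk : kernelVec q l = ⟨0, fun i => fmul l (invL 1 q.e (dFun q.φ) (fun i => -cov1 q.A q.e i) i),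
    0, fun i => fmul l (invL (-1) q.e (dFun q.φ) (curv q.A) i), l⟩ := rfl
  -- As opL(1) z = -De, the algebraic part of the variation is -l De, which joins e ∧ dl to form a
  -- covariant differential.
  have hH : ∀ i, varH q (kernelVec q l) i = -cov1 q.A (fun i => fmul l (q.e i)) i := fun i => by
    rw [cov1_fmul hq.e hl, hk]
    generalize invL 1 q.e (dFun q.φ) (fun i => -cov1 q.A q.e i) = z at hz ⊢
    have h : cov1 q.A q.e i = -opL 1 q.e (dFun q.φ) z i := by rw [hz, neg_neg]
    funext x
    refine ext_comp2 stdFrame fun m => ?_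
    simp only [varH, h, opL, cross2, Pi.add_apply, Pi.sub_apply, Pi.neg_apply, Pi.smul_apply,
      comp2_add, comp2_sub, comp2_neg, comp2_smul, comp2_fmul, comp2_wedge2, comp1_fmul]
    ring
  have hDH : ∀ i, cov2 q.A (varH q (kernelVec q l)) i = cross3 (fun i => fmul l (q.e i)) (curv q.A) i :=
    fun i => by
      have h := cov2_cov1 hq.A (fun i => SmoothForm.fmul hl (hq.e i)) i
      have h2 : cov2 q.A (fun i => -cov1 q.A (fun i => fmul l (q.e i)) i) i
          = -cov2 q.A (cov1 q.A (fun i => fmul l (q.e i))) i := by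
        rw [cov2_eq, cov2_eq]
        have h3 : d2 (-cov1 q.A (fun i => fmul l (q.e i)) i)
          = -d2 (cov1 q.A (fun i => fmul l (q.e i)) i) := extD_neg _
        rw [h3]
        funext x
        refine ext_comp3 stdFrame ?_
        simp only [cross3, Pi.add_apply, Pi.sub_apply, Pi.neg_apply, comp3_add, comp3_sub, comp3_neg,
          comp3_wedge3, comp2_neg, Fin.sum_univ_three]
        ring
      rw [funext hH, h2, h, neg_neg]
  have hDw : ∀ i, cov1 q.A (kernelVec q l).A i
      = wedge2 (dFun l) (invL (-1) q.e (dFun q.φ) (curv q.A) i)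
        + fmul l (cov1 q.A (invL (-1) q.e (dFun q.φ) (curv q.A)) i) := cov1_fmul hws hl
  -- the covariant derivative of the equation for the connection
  have hB : ∀ i, cross3 q.e (cov1 q.A (invL (-1) q.e (dFun q.φ) (curv q.A))) i
      + wedge3 (dFun q.φ) (cov1 q.A (invL (-1) q.e (dFun q.φ) (curv q.A)) i)
      + cross3 (invL (-1) q.e (dFun q.φ) (curv q.A)) (cov1 q.A q.e) i = 0 := fun i => by
    have h1 := cov2_curv hq.A i
    have h2 := cov2_cross2 hq.A hq.e hws i
    have h3 := cov2_wedge2_dFun (A := q.A) hws hq.φ i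
    have h4 : curv q.A = fun i => cross2 q.e (invL (-1) q.e (dFun q.φ) (curv q.A)) i
        + (-1 : ℝ) • wedge2 (invL (-1) q.e (dFun q.φ) (curv q.A) i) (dFun q.φ) :=
      funext fun i => (hw i).symm
    have h6 : ∀ (B : Fin 3 → Form M 2), cov2 q.A (fun i => (-1 : ℝ) • B i) i = (-1 : ℝ) • cov2 q.A B i :=
      fun B => by
        rw [cov2_eq, cov2_eq]
        have h3 : d2 ((-1 : ℝ) • B i) = (-1 : ℝ) • d2 (B i) := extD_smul _ _
        rw [h3]
        funext x
        refine ext_comp3 stdFrame ?_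
        simp only [cross3, Pi.add_apply, Pi.sub_apply, Pi.smul_apply, comp3_add, comp3_sub, comp3_smul,
          comp3_wedge3, comp2_smul, Fin.sum_univ_three]
        ring
    have h5 := cov2_add (A := q.A) (SmoothForm.cross2 hq.e hws)
      (fun i => ((hws i).wedge2 (SmoothForm.dFun hq.φ)).smul (-1)) i
    rw [← h4, h1, h6, h2, h3] at h5
    funext x
    have h7 := congrArg (comp3 stdFrame) (congrFun h5 x)
    refine ext_comp3 stdFrame ?_
    simp only [Pi.add_apply, Pi.sub_apply, Pi.neg_apply, Pi.smul_apply, Pi.zero_apply, comp3_add,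
      comp3_sub, comp3_neg, comp3_smul, comp3_zero] at h7 ⊢
    linear_combination h7
  rw [varHam]
  funext x
  obtain ⟨v, hv⟩ := exists_dualFrame (he x)
  simp only [varDH, varC, hDH, funext hDw]
  rw [hk]
  generalize invL (-1) q.e (dFun q.φ) (curv q.A) = w at *
  generalize invL 1 q.e (dFun q.φ) (fun i => -cov1 q.A q.e i) = z at *
  have hT' : ∀ i, cov1 q.A q.e i = -opL 1 q.e (dFun q.φ) z i := fun i => by rw [hz, neg_neg]
  -- The constraint (F) enters here, as symmetry of w; (T) enters next, as symmetry of z.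
  have hwsym := hv.symm_of_opL (s := -1) (by norm_num) (p := dFun q.φ) (w := w) fun i => by
    rw [← hF i, funext hw, constrF, ← neg_eq_smul, sub_neg_eq_add]
  have hzsym := hv.symm_of_opL (s := 1) (by norm_num) (p := dFun q.φ) (w := z) fun i => by
    have h := hT i
    rw [constrT, funext hT'] at h
    funext x
    have h7 := congrArg (comp3 stdFrame) (congrFun h x)
    refine ext_comp3 stdFrame ?_
    simp only [cross3, Pi.add_apply, Pi.sub_apply, Pi.neg_apply, Pi.smul_apply, Pi.zero_apply, comp3_add,
      comp3_sub, comp3_neg, comp3_smul, comp3_zero, comp3_wedge3, comp2_neg, Fin.sum_univ_three] at h7 ⊢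
    linear_combination -h7
  have k1 := fun i => congrArg (comp3 v) (hv.cross3_flux (p := dFun q.φ) hwsym i)
  have k2 := fun i => congrArg (comp3 v) (hv.cross3_opL (p := dFun q.φ) hwsym hzsym i)
  have k3 := fun i => congrArg (comp3 v) (congrFun (hB i) x)
  have k4 : ∀ i, comp3 v (wedge3 (dFun l) (curv q.A i) x)
      = comp3 v (wedge3 (dFun l) (opL (-1) q.e (dFun q.φ) w i) x) := fun i => by rw [hw]
  simp only [funext hw] at k1 k2
  have hz' : opL 1 q.e (dFun q.φ) z = fun i => -cov1 q.A q.e i := funext hz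
  simp only [hz'] at k2
  simp only [opL] at k4
  refine ext_comp3 v ?_
  simp only [← HForm_eq] at k1
  -- This is the coefficient of A_t^i. The next one is that of e_t^i, where the terms with dl cancel
  -- by F = opL(-1) w alone.
  have key1 : ∀ i, comp3 v (cross3 (fun i => fmul l (q.e i)) (curv q.A) i x
      + cross3 (fun i => fmul l (w i)) (HForm q.e q.φ) i x) = 0 := fun i => by
    have := k1 i
    simp only [cross3, Pi.add_apply, Pi.sub_apply, comp3_add, comp3_sub, comp3_wedge3, comp1_fmul,
      comp3_zero, Fin.sum_univ_three] at this ⊢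
    linear_combination l x * this
  have key2 : ∀ i, comp3 v ((cross3 (fun i => fmul l (z i)) (curv q.A) i
      + cross3 q.e (fun i => wedge2 (dFun l) (w i) + fmul l (cov1 q.A w i)) i
      + wedge3 (dFun l) (curv q.A i)
      + wedge3 (dFun q.φ) (wedge2 (dFun l) (w i) + fmul l (cov1 q.A w i))) x) = 0 := fun i => by
    have h2 := k2 i
    have h3 := k3 i
    have h4 := k4 i
    simp only [cross2, cross3, Pi.add_apply, Pi.sub_apply, Pi.neg_apply, Pi.zero_apply, Pi.smul_apply,
      comp3_add, comp3_sub, comp3_wedge3, comp1_fmul, comp2_neg, comp2_add, comp2_sub, comp2_smul,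
      comp2_wedge2, comp2_fmul, comp3_zero, Fin.sum_univ_three, Fin.isValue, Fin.reduceAdd] at h2 h3 h4 ⊢
    linear_combination l x * h2 + l x * h3 + h4
  have fz : ∀ b : Form M 3, fmul (0 : M → ℝ) b = 0 := fun b => by
    funext x; exact zero_smul _ _
  simp only [Pi.zero_apply, fz, zero_add]
  simp only [Fin.sum_univ_three, Pi.neg_apply, Pi.add_apply, comp3_neg, comp3_add, comp3_fmul,
    comp3_zero] at key1 key2 ⊢
  linear_combination -q.At 0 x * key1 0 - q.At 1 x * key1 1 - q.At 2 x * key1 2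
    - q.et 0 x * key2 0 - q.et 1 x * key2 1 - q.et 2 x * key2 2

end Automatic

end

/-! ### Equivalence of the Hamilton equation with the field equations -/

section

variable {M : Type*} [TopologicalSpace M] [ChartedSpace E3 M] [IsManifold (𝓡 3) ∞ M]

section Test

variable {vol0 : Form M 3} (hvol : SmoothForm vol0) (hv : ∀ x, vol0 x ≠ 0) {e : Fin 3 → Form M 1}
include hv

omit [TopologicalSpace M] [ChartedSpace E3 M] [IsManifold (𝓡 3) ∞ M] in
theorem eq_fmul_ratio (b : Form M 3) : b = fmul (ratio b vol0) vol0 := by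
  funext x
  refine ext_comp3 stdFrame ?_
  rw [comp3_fmul, ratio_eq stdFrame, div_mul_cancel₀ _ (comp3_ne_zero stdFrame (hv x))]

omit [TopologicalSpace M] [ChartedSpace E3 M] [IsManifold (𝓡 3) ∞ M] in
theorem eq_zero_of_ratio_eq_zero {b : Form M 3} (h : ∀ x, ratio b vol0 x = 0) : b = 0 := by
  rw [eq_fmul_ratio hv b]
  funext x
  rw [fmul, h, zero_smul]
  rfl

/-- A 1-form whose product with the 2-form `P` is a sum of squares. -/
def testForm (vol0 : Form M 3) (e : Fin 3 → Form M 1) (P : Form M 2) : Form M 1 :=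
  ∑ m, fmul (ratio (wedge3 (e m) P) vol0) (e m)

omit hv [TopologicalSpace M] [ChartedSpace E3 M] [IsManifold (𝓡 3) ∞ M] in
theorem ratio_wedge3_testForm (P : Form M 2) (x : M) :
    ratio (wedge3 (testForm vol0 e P) P) vol0 x = ∑ m, ratio (wedge3 (e m) P) vol0 x ^ 2 := by
  simp only [testForm, ratio_eq stdFrame, comp3_wedge3, Fin.sum_univ_three, Pi.add_apply,
    comp1_add, comp1_fmul]
  ring

include hvol in
theorem SmoothForm.testForm (he : ∀ i, SmoothForm (e i)) {P : Form M 2} (hP : SmoothForm P) :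
    SmoothForm (testForm vol0 e P) :=
  SmoothForm.sum fun m _ => SmoothForm.fmul (SmoothFun.ratio ((he m).wedge3 hP) hvol hv) (he m)

omit [TopologicalSpace M] [ChartedSpace E3 M] [IsManifold (𝓡 3) ∞ M] in
theorem eq_zero_of_ratio_wedge3 (he : ∀ x, volOf e x ≠ 0) {P : Form M 2}
    (h : ∀ m x, ratio (wedge3 (e m) P) vol0 x = 0) : P = 0 := by
  funext x
  refine eq_zero_of_wedge3_eq_zero (he x) fun m => ?_
  rw [eq_zero_of_ratio_eq_zero hv (h m), ratio]
  exact zero_div _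

end Test

variable [T2Space M] [CompactSpace M] {vol0 : Form M 3} (hvol : SmoothForm vol0)
  (hv : ∀ x, vol0 x ≠ 0) {q : Fields M} (hq : q.Smooth) (he : ∀ x, volOf q.e x ≠ 0)
include hvol hv hq he

theorem omega_antisymm (Z Y : Fields M) : omega vol0 q Z Y = -omega vol0 q Y Z := by
  rw [omega, omega, neg_sub]

/-- The test vector is assembled from the residuals of the equations themselves, so that ω(Z, Y) -
dH(Y) is the integral of a sum of squares. That integral is zero, and a nonnegative smooth function
with zero integral vanishes. -/
theorem equations_of_isHamiltonianAt {Z : Fields M} (hZ : Z.Smooth) (h : IsHamiltonianAt vol0 q Z) :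
    (∀ i, constrF q i = 0) ∧ (∀ i, constrT q i = 0) ∧ (∀ i, eqE q Z i = hamE q i) ∧
      ∀ i, eqA q Z i = hamA q i := by
  have sP : ∀ i, SmoothForm (eqE q Z i - hamE q i) := fun i =>
    (SmoothForm.eqE hq hZ i).sub (SmoothForm.hamE hq i)
  have sQ : ∀ i, SmoothForm (eqA q Z i - hamA q i) := fun i =>
    (SmoothForm.eqA hq hZ i).sub (SmoothForm.hamA hq i)
  have sD : ∀ i, SmoothForm (cov2 q.A (HForm q.e q.φ) i) :=
    SmoothForm.cov2 hq.A (SmoothForm.HForm hq.e hq.φ)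
  have sC : ∀ i, SmoothForm (constrF q i) := SmoothForm.constrF hq
  -- Y_φ = 0 makes the integrated formula for dH applicable. Y_{e_t} and Y_{A_t} carry a plus sign
  -- because they enter dH with a minus sign and dH is subtracted.
  let Y : Fields M :=
    { et := fun i => ratio (constrF q i) vol0
      e := fun i => testForm vol0 q.e (eqE q Z i - hamE q i)
      At := fun i => ratio (cov2 q.A (HForm q.e q.φ) i) vol0
      A := fun i => testForm vol0 q.e (eqA q Z i - hamA q i)
      φ := 0 }
  have hY : Y.Smooth :=
    { et := fun i => SmoothFun.ratio (sC i) hvol hv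
      e := fun i => SmoothForm.testForm hvol hv hq.e (sP i)
      At := fun i => SmoothFun.ratio (sD i) hvol hv
      A := fun i => SmoothForm.testForm hvol hv hq.e (sQ i)
      φ := SmoothFun.const 0 }
  have h1 := h Y hY
  rw [omega_eq_expInt hvol hv hq hZ hY, deriv_hamiltonian_eq hvol hv hq hY rfl] at h1
  set f : M → ℝ := ratio (expInt q Z Y - hamInt q Y) vol0 with hf
  have h2 : integral vol0 (fmul f vol0) = 0 := by
    rw [← eq_fmul_ratio hv, sub_eq_add_neg (expInt q Z Y), neg_eq_smul,
      integral_add' hvol hv (SmoothForm.expInt hq hZ hY) ((SmoothForm.hamInt hq hY).smul _),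
      integral_smul', h1]
    ring
  have h3 : ∀ x, f x = ∑ i, (∑ m, ratio (wedge3 (q.e m) (eqE q Z i - hamE q i)) vol0 x ^ 2
      + ∑ m, ratio (wedge3 (q.e m) (eqA q Z i - hamA q i)) vol0 x ^ 2
      + ratio (cov2 q.A (HForm q.e q.φ) i) vol0 x ^ 2 + ratio (constrF q i) vol0 x ^ 2) := fun x => by
    simp only [← ratio_wedge3_testForm]
    have hw := comp3_ne_zero stdFrame (hv x)
    simp only [hf, expInt, hamInt, Y, ratio_eq stdFrame, Pi.add_apply, Pi.sub_apply, Pi.zero_apply,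
      comp3_add, comp3_sub, comp3_wedge3, comp3_fmul, comp2_sub, Fin.sum_univ_three]
    field_simp
    ring
  have h4 : SmoothFun f :=
    SmoothFun.ratio ((SmoothForm.expInt hq hZ hY).sub (SmoothForm.hamInt hq hY)) hvol hv
  have h5 : ∀ x i, ∑ m, ratio (wedge3 (q.e m) (eqE q Z i - hamE q i)) vol0 x ^ 2
      + ∑ m, ratio (wedge3 (q.e m) (eqA q Z i - hamA q i)) vol0 x ^ 2
      + ratio (cov2 q.A (HForm q.e q.φ) i) vol0 x ^ 2 + ratio (constrF q i) vol0 x ^ 2 = 0 := by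
    intro x i
    have h0 := eq_zero_of_integral_eq_zero hvol hv h4 (fun x => by rw [h3]; positivity) h2 x
    rw [h3] at h0
    exact (Finset.sum_eq_zero_iff_of_nonneg fun i _ => by positivity).1 h0 i (Finset.mem_univ i)
  have n1 : ∀ x i, 0 ≤ ∑ m, ratio (wedge3 (q.e m) (eqE q Z i - hamE q i)) vol0 x ^ 2 :=
    fun x i => by positivity
  have n2 : ∀ x i, 0 ≤ ∑ m, ratio (wedge3 (q.e m) (eqA q Z i - hamA q i)) vol0 x ^ 2 :=
    fun x i => by positivity
  have z1 : ∀ {x i}, ∑ m, ratio (wedge3 (q.e m) (eqE q Z i - hamE q i)) vol0 x ^ 2 = 0 :=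
    fun {x i} => by nlinarith [h5 x i, n1 x i, n2 x i]
  have z2 : ∀ {x i}, ∑ m, ratio (wedge3 (q.e m) (eqA q Z i - hamA q i)) vol0 x ^ 2 = 0 :=
    fun {x i} => by nlinarith [h5 x i, n1 x i, n2 x i]
  refine ⟨fun i => ?_, fun i => ?_, fun i => ?_, fun i => ?_⟩
  · exact eq_zero_of_ratio_eq_zero hv fun x => by nlinarith [h5 x i, n1 x i, n2 x i]
  · rw [← neg_eq_zero, ← cov2_HForm hq]
    exact eq_zero_of_ratio_eq_zero hv fun x => by nlinarith [h5 x i, n1 x i, n2 x i]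
  · refine sub_eq_zero.1 (eq_zero_of_ratio_wedge3 hv he fun m x => ?_)
    exact pow_eq_zero_iff two_ne_zero |>.1
      ((Finset.sum_eq_zero_iff_of_nonneg fun i _ => by positivity).1 z1 m (Finset.mem_univ m))
  · refine sub_eq_zero.1 (eq_zero_of_ratio_wedge3 hv he fun m x => ?_)
    exact pow_eq_zero_iff two_ne_zero |>.1
      ((Finset.sum_eq_zero_iff_of_nonneg fun i _ => by positivity).1 z2 m (Finset.mem_univ m))

/-- An arbitrary Y is split into a kernel vector with the same φ-component and a remainder with Y_φ
= 0. Neither ω nor dH sees the former, and on the remainder the equations make the two integrands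
equal. -/
theorem isHamiltonianAt_of_equations {Z : Fields M} (hZ : Z.Smooth) (hF : ∀ i, constrF q i = 0)
    (hT : ∀ i, constrT q i = 0) (hE : ∀ i, eqE q Z i = hamE q i) (hA : ∀ i, eqA q Z i = hamA q i) :
    IsHamiltonianAt vol0 q Z := by
  intro Y hY
  have hK := kernelVec_smooth hq he hY.φ
  set K := kernelVec q Y.φ with hKdef
  let Y0 : Fields M :=
    { et := Y.et
      e := fun i => Y.e i - K.e i
      At := Y.At
      A := fun i => Y.A i - K.A i
      φ := 0 }
  have hY0 : Y0.Smooth := ⟨hY.et, fun i => (hY.e i).sub (hK.e i), hY.At,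
    fun i => (hY.A i).sub (hK.A i), SmoothFun.const 0⟩
  have hsum : Y0.add K = Y := by
    obtain ⟨et, e, At, A, φ⟩ := Y
    simp only [Fields.add, Y0, sub_add_cancel, hKdef, kernelVec, Pi.zero_apply, add_zero, zero_add]
  -- The integrand vanishes identically only when the kernel vector is the first argument;
  -- antisymmetry of ω transfers this to the integral with the arguments exchanged.
  have h1 : integral vol0 (expInt q Z K) = 0 := by
    rw [← omega_eq_expInt hvol hv hq hZ hK, omega_antisymm hvol hv hq he,
      omega_eq_expInt hvol hv hq hK hZ, expInt_kernelVec hq he]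
    have := integral_smul' (vol := vol0) 0 0
    rw [zero_smul, zero_mul] at this
    rw [this, neg_zero]
  rw [omega_eq_expInt hvol hv hq hZ hY, deriv_hamiltonian hvol hv hq hY, ← hsum, expInt_add,
    varHam_add hq hY0 hK, varHam_kernelVec hq he hY.φ hF hT, add_zero,
    integral_add' hvol hv (SmoothForm.expInt hq hZ hY0) (SmoothForm.expInt hq hZ hK), h1, add_zero,
    ← deriv_hamiltonian hvol hv hq hY0, deriv_hamiltonian_eq hvol hv hq hY0 rfl]
  congr 1
  have hD : ∀ i, cov2 q.A (HForm q.e q.φ) i = 0 := fun i => by rw [cov2_HForm hq, hT, neg_zero]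
  have f0 : ∀ (g : M → ℝ), fmul g (0 : Form M 3) = 0 := fun g => fmul_zero g
  have f1 : ∀ b : Form M 3, fmul (0 : M → ℝ) b = 0 := fun b => by
    funext x; exact zero_smul _ _
  rw [expInt, hamInt]
  simp only [hE, hA, hD, hF, f0, f1, add_zero, Finset.sum_const_zero, sub_zero, Y0]

theorem isHamiltonianAt_iff {Z : Fields M} (hZ : Z.Smooth) : IsHamiltonianAt vol0 q Z ↔
    SecondaryF q ∧ SecondaryT q ∧ (∀ i, eqE q Z i = hamE q i) ∧ ∀ i, eqA q Z i = hamA q i := by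
  rw [secondaryF_iff, secondaryT_iff]
  exact ⟨equations_of_isHamiltonianAt hvol hv hq he hZ, fun ⟨hF, hT, hE, hA⟩ =>
    isHamiltonianAt_of_equations hvol hv hq he hZ hF hT hE hA⟩

end

/-! ### The auxiliary triad h -/

section

section Matrices

/-- The matrix `δ_{im} + ε_{ijm} a_j`. -/
def fluxMat (a : Fin 3 → ℝ) (i m : Fin 3) : ℝ :=
  kron i m + (kron i (m + 1) * a (m + 2) - kron i (m + 2) * a (m + 1))

/-- The matrix `δ_{im} + a_i a_m + ε_{ijm} a_j`. -/
def triadMat (a : Fin 3 → ℝ) (i m : Fin 3) : ℝ := fluxMat a i m + a i * a m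

theorem fluxMat_self (a : Fin 3 → ℝ) (i : Fin 3) : fluxMat a i i = 1 := by
  simp only [fluxMat, kron_self, kron_01, kron_02]; ring

theorem fluxMat_01 (a : Fin 3 → ℝ) (i : Fin 3) : fluxMat a i (i + 1) = -a (i + 2) := by
  simp only [fluxMat, kron_self, kron_01, kron_02, add_assoc, Fin.isValue, Fin.reduceAdd, add_zero]
  ring

theorem fluxMat_02 (a : Fin 3 → ℝ) (i : Fin 3) : fluxMat a i (i + 2) = a (i + 1) := by
  simp only [fluxMat, kron_self, kron_01, kron_02, add_assoc, Fin.isValue, Fin.reduceAdd, add_zero]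
  ring

theorem fluxMat_10 (a : Fin 3 → ℝ) (i : Fin 3) : fluxMat a (i + 1) i = a (i + 2) := by
  have := fluxMat_02 a (i + 1)
  simpa only [add_assoc, Fin.isValue, Fin.reduceAdd, add_zero] using this

theorem fluxMat_12 (a : Fin 3 → ℝ) (i : Fin 3) : fluxMat a (i + 1) (i + 2) = -a i := by
  have := fluxMat_01 a (i + 1)
  simpa only [add_assoc, Fin.isValue, Fin.reduceAdd, add_zero] using this

theorem fluxMat_20 (a : Fin 3 → ℝ) (i : Fin 3) : fluxMat a (i + 2) i = -a (i + 1) := by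
  have := fluxMat_01 a (i + 2)
  simpa only [add_assoc, Fin.isValue, Fin.reduceAdd, add_zero] using this

theorem fluxMat_21 (a : Fin 3 → ℝ) (i : Fin 3) : fluxMat a (i + 2) (i + 1) = a i := by
  have := fluxMat_02 a (i + 2)
  simpa only [add_assoc, Fin.isValue, Fin.reduceAdd, add_zero] using this

/-- `triadMat` is the cofactor matrix of `fluxMat`. -/
theorem cofactor_fluxMat (a : Fin 3 → ℝ) (i m : Fin 3) :
    fluxMat a (i + 1) (m + 1) * fluxMat a (i + 2) (m + 2)
      - fluxMat a (i + 1) (m + 2) * fluxMat a (i + 2) (m + 1) = triadMat a i m := by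
  refine cyclic_cases i ?_ ?_ ?_ m <;>
  simp only [triadMat, fluxMat_self, fluxMat_01, fluxMat_02, fluxMat_10, fluxMat_12, fluxMat_20,
    fluxMat_21, add_assoc, Fin.isValue, Fin.reduceAdd, add_zero] <;> ring

/-- Taking cofactors twice multiplies a 3 × 3 matrix by its determinant, here 1 + a². -/
theorem cofactor_triadMat (a : Fin 3 → ℝ) (i m : Fin 3) :
    triadMat a (i + 1) (m + 1) * triadMat a (i + 2) (m + 2)
      - triadMat a (i + 1) (m + 2) * triadMat a (i + 2) (m + 1)
      = (1 + ∑ k, a k ^ 2) * fluxMat a i m := by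
  rw [sum_cyclic _ i]
  refine cyclic_cases i ?_ ?_ ?_ m <;>
  simp only [triadMat, fluxMat_self, fluxMat_01, fluxMat_02, fluxMat_10, fluxMat_12, fluxMat_20,
    fluxMat_21, add_assoc, Fin.isValue, Fin.reduceAdd, add_zero] <;> ring

theorem det_fluxMat (a : Fin 3 → ℝ) (i : Fin 3) :
    ∑ m, fluxMat a i m * triadMat a i m = 1 + ∑ k, a k ^ 2 := by
  rw [sum_cyclic _ i, sum_cyclic _ i]
  simp only [triadMat, fluxMat_self, fluxMat_01, fluxMat_02]
  ring

theorem det_fluxMat' (a : Fin 3 → ℝ) (i : Fin 3) :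
    ∑ m, triadMat a i m * fluxMat a i m = 1 + ∑ k, a k ^ 2 := by
  rw [← det_fluxMat a i]
  exact Finset.sum_congr rfl fun m _ => mul_comm _ _

theorem sum_fluxMat_mul (a : Fin 3 → ℝ) (i : Fin 3) : ∑ m, fluxMat a i m * a m = a i := by
  rw [sum_cyclic _ i]
  simp only [fluxMat_self, fluxMat_01, fluxMat_02]
  ring

theorem eps_sum_mid (a : Fin 3 → ℝ) (i m : Fin 3) :
    ∑ j, eps i j m * a j = kron i (m + 1) * a (m + 2) - kron i (m + 2) * a (m + 1) := by
  fin_cases i <;> fin_cases m <;> simp [eps, kron, Fin.sum_univ_three] <;> norm_num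

theorem sqrt_sq_of (a : Fin 3 → ℝ) :
    Real.sqrt (1 + ∑ k, a k ^ 2) ^ 2 = 1 + ∑ k, a k ^ 2 :=
  Real.sq_sqrt (one_add_sum_sq_pos a).le

theorem sqrt_pos_of (a : Fin 3 → ℝ) : 0 < Real.sqrt (1 + ∑ k, a k ^ 2) :=
  Real.sqrt_pos.2 (one_add_sum_sq_pos a)

end Matrices

section Pointwise

variable {M : Type*} [TopologicalSpace M] [ChartedSpace E3 M] {e : Fin 3 → Form M 1} {x : M}
  {v : Frame} (hv : DualFrame v e x) (φ : M → ℝ)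
include hv

theorem DualFrame.alpha_eq (i : Fin 3) : alpha e φ i x = comp1 v (dFun φ x) i := by
  rw [alpha_eq_coef, hv.coef_eq]

theorem DualFrame.alphaSq_eq : alphaSq e φ x = ∑ k, comp1 v (dFun φ x) k ^ 2 := by
  simp only [alphaSq, hv.alpha_eq]

theorem DualFrame.comp1_hTriad (i m : Fin 3) :
    comp1 v (hTriad e φ i x) m
      = (Real.sqrt (1 + ∑ k, comp1 v (dFun φ x) k ^ 2))⁻¹ * triadMat (comp1 v (dFun φ x)) i m := by
  rw [hTriad, comp1_smul, hv.comp1_sum_smul]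
  simp only [hv.alphaSq_eq, hv.alpha_eq, triadMat, fluxMat, eps_sum_mid]
  ring

theorem DualFrame.comp2_HForm (i m : Fin 3) :
    comp2 v (HForm e φ i x) m = fluxMat (comp1 v (dFun φ x)) i m := by
  rw [HForm_eq]
  simp only [Pi.add_apply, comp2_add, comp2_wedge2, hv _ _]
  refine cyclic_cases i ?_ ?_ ?_ m <;>
  simp only [fluxMat, kron_self, kron_01, kron_02, kron_10, kron_12, kron_20, kron_21, add_assoc,
    Fin.isValue, Fin.reduceAdd, add_zero] <;> ring

/-- The determinant of `triadMat` is (1 + a²)², and the three normalizing factors divide it by (1 +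
a²)^{3/2}. -/
theorem DualFrame.comp3_volOf_hTriad :
    comp3 v (volOf (hTriad e φ) x) = Real.sqrt (1 + ∑ k, comp1 v (dFun φ x) k ^ 2) := by
  have h1 := sqrt_sq_of (comp1 v (dFun φ x))
  have h2 := sqrt_pos_of (comp1 v (dFun φ x))
  have h3 := det_fluxMat' (comp1 v (dFun φ x)) 0
  have h4 := fun m => cofactor_triadMat (comp1 v (dFun φ x)) 0 m
  simp only [volOf_eq, comp3_wedge3, comp2_wedge2, hv.comp1_hTriad]
  have h5 : ∀ m : Fin 3, triadMat (comp1 v (dFun φ x)) 1 (m + 1) * triadMat (comp1 v (dFun φ x)) 2 (m + 2)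
      - triadMat (comp1 v (dFun φ x)) 1 (m + 2) * triadMat (comp1 v (dFun φ x)) 2 (m + 1)
      = (1 + ∑ k, comp1 v (dFun φ x) k ^ 2) * fluxMat (comp1 v (dFun φ x)) 0 m := h4
  set s := Real.sqrt (1 + ∑ k, comp1 v (dFun φ x) k ^ 2)
  rw [← h1] at h3 h5
  calc _ = ∑ m, (s⁻¹) ^ 3 * (triadMat (comp1 v (dFun φ x)) 0 m * (s ^ 2 * fluxMat (comp1 v (dFun φ x)) 0 m)) :=
        Finset.sum_congr rfl fun m _ => by rw [← h5]; ring
    _ = (s⁻¹) ^ 3 * (s ^ 2 * ∑ m, triadMat (comp1 v (dFun φ x)) 0 m * fluxMat (comp1 v (dFun φ x)) 0 m) := by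
        simp only [Finset.mul_sum]
        exact Finset.sum_congr rfl fun m _ => by ring
    _ = s := by rw [h3]; field_simp

omit hv in
theorem volOf_hTriad_ne_zero (he : volOf e x ≠ 0) : volOf (hTriad e φ) x ≠ 0 := by
  obtain ⟨v, hv⟩ := exists_dualFrame he
  intro h
  have h2 := hv.comp3_volOf_hTriad φ
  rw [h, comp3_zero] at h2
  exact (sqrt_pos_of (comp1 v (dFun φ x))).ne h2

end Pointwise

section Triad

variable {M : Type*} [TopologicalSpace M] [ChartedSpace E3 M] {e : Fin 3 → Form M 1}
  (he : ∀ x, volOf e x ≠ 0) (φ : M → ℝ)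
include he

theorem dFun_eq_sum : dFun φ = ∑ i, fmul (alpha e φ i) (e i) := by
  funext x
  obtain ⟨v, hv⟩ := exists_dualFrame (he x)
  refine ext_comp1 v fun m => ?_
  rw [Finset.sum_apply]
  exact ((hv.comp1_sum_smul (fun i => alpha e φ i x) m).trans (hv.alpha_eq φ m)).symm

/-- The cofactors of `triadMat` are (1 + a²) times `fluxMat`, the matrix of H, and the two
normalizing factors in a product of two h's cancel the factor 1 + a². -/
theorem HForm_eq_dual2 (i : Fin 3) : HForm e φ i = dual2 (hTriad e φ) i := by
  funext x
  obtain ⟨v, hv⟩ := exists_dualFrame (he x)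
  refine ext_comp2 v fun m => ?_
  rw [hv.comp2_HForm, dual2_eq, comp2_wedge2]
  simp only [hv.comp1_hTriad]
  have h := cofactor_triadMat (comp1 v (dFun φ x)) i m
  have h1 := sqrt_sq_of (comp1 v (dFun φ x))
  have h2 := (sqrt_pos_of (comp1 v (dFun φ x))).ne'
  rw [← h1] at h
  field_simp
  linear_combination -h

variable {vol0 : Form M 3} (hpos : ∀ x, 0 < ratio (volOf e) vol0 x)
include hpos

omit he in
theorem DualFrame.ratio_volOf {x : M} {v : Frame} (hv : DualFrame v e x) :
    0 < comp3 v (vol0 x) := by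
  have := hpos x
  rw [ratio_eq v, hv.comp3_volOf] at this
  exact one_div_pos.1 this

theorem ratio_volOf_hTriad_pos (x : M) : 0 < ratio (volOf (hTriad e φ)) vol0 x := by
  obtain ⟨v, hv⟩ := exists_dualFrame (he x)
  rw [ratio_eq v, hv.comp3_volOf_hTriad]
  exact div_pos (sqrt_pos_of _) (hv.ratio_volOf hpos)

omit he in
theorem DualFrame.repr_flux {x : M} {v : Frame} (hv : DualFrame v e x) (i m : Fin 3) :
    v.repr (dualVec vol0 (HForm e φ i) x) m = fluxMat (comp1 v (dFun φ x)) i m / comp3 v (vol0 x) := by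
  rw [repr_dualVec, hv.comp2_HForm]

omit he in
-- Two contractions of the volume form with H̃ produce the cofactors of `fluxMat`. The factor -2
-- counts the two orderings of ε and records that the innermost contraction fills the first slot; it
-- is the origin of the minus signs in the formulas for h and (det h)².
theorem DualFrame.comp1_inner_flux {x : M} {v : Frame} (hv : DualFrame v e x) (i m : Fin 3) :
    comp1 v (∑ j, ∑ k, eps i j k • inner1 (dualVec vol0 (HForm e φ j))
      (inner1 (dualVec vol0 (HForm e φ k)) vol0) x) m
      = -2 * triadMat (comp1 v (dFun φ x)) i m / comp3 v (vol0 x) := by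
  have h0 := (hv.ratio_volOf hpos).ne'
  rw [eps_sum i fun j k => inner1 (dualVec vol0 (HForm e φ j))
      (inner1 (dualVec vol0 (HForm e φ k)) vol0) x, comp1_sub, comp1_inner1, comp1_inner1]
  simp only [comp2_inner1, hv.repr_flux φ hpos, ← cofactor_fluxMat]
  field_simp
  ring

omit he in
theorem DualFrame.detHSq_eq {x : M} {v : Frame} (hv : DualFrame v e x) :
    detHSq vol0 (fun i => dualVec vol0 (HForm e φ i)) x
      = (1 + ∑ k, comp1 v (dFun φ x) k ^ 2) / comp3 v (vol0 x) ^ 2 := by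
  have h0 := (hv.ratio_volOf hpos).ne'
  have h : ∀ i, ∑ j, ∑ k, eps i j k * ev (dualVec vol0 (HForm e φ i))
      (inner1 (dualVec vol0 (HForm e φ j)) (inner1 (dualVec vol0 (HForm e φ k)) vol0)) x
      = -2 * (1 + ∑ k, comp1 v (dFun φ x) k ^ 2) / comp3 v (vol0 x) ^ 2 := fun i => by
    have h1 := fun m => hv.comp1_inner_flux φ hpos i m
    simp only [comp1_sum, comp1_smul] at h1
    have h2 : ∑ j, ∑ k, eps i j k * ev (dualVec vol0 (HForm e φ i))
      (inner1 (dualVec vol0 (HForm e φ j)) (inner1 (dualVec vol0 (HForm e φ k)) vol0)) x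
      = ∑ m, v.repr (dualVec vol0 (HForm e φ i) x) m * ∑ j, ∑ k, eps i j k *
        comp1 v (inner1 (dualVec vol0 (HForm e φ j))
          (inner1 (dualVec vol0 (HForm e φ k)) vol0) x) m := by
      simp only [ev_eq v, Fin.sum_univ_three]
      ring
    rw [h2, ← det_fluxMat _ i]
    rw [Finset.sum_congr rfl fun m _ => by rw [h1 m, hv.repr_flux φ hpos]]
    simp only [Fin.sum_univ_three]
    field_simp
    ring
  rw [detHSq, Finset.sum_congr rfl fun i _ => h i, Fin.sum_univ_three]
  ring

theorem ratio_volOf_hTriad_sq (x : M) : ratio (volOf (hTriad e φ)) vol0 x ^ 2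
    = detHSq vol0 (fun i => dualVec vol0 (HForm e φ i)) x := by
  obtain ⟨v, hv⟩ := exists_dualFrame (he x)
  rw [hv.detHSq_eq φ hpos, ratio_eq v, hv.comp3_volOf_hTriad, div_pow, sqrt_sq_of]

theorem hTriad_eq_triadOfHt (i : Fin 3) :
    hTriad e φ i = triadOfHt vol0 (fun i => dualVec vol0 (HForm e φ i)) i := by
  funext x
  obtain ⟨v, hv⟩ := exists_dualFrame (he x)
  refine ext_comp1 v fun m => ?_
  have h0 := hv.ratio_volOf hpos
  have h2 := (sqrt_pos_of (comp1 v (dFun φ x))).ne'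
  rw [triadOfHt, comp1_smul, hv.comp1_inner_flux φ hpos, hv.comp1_hTriad, hv.detHSq_eq φ hpos,
    Real.sqrt_div (one_add_sum_sq_pos _).le, Real.sqrt_sq h0.le]
  field_simp

end Triad

end

/-! ### The constraints in canonical variables -/

section

variable {M : Type*} [TopologicalSpace M] [ChartedSpace E3 M]

section Pointwise

variable {q : Fields M} {vol0 : Form M 3} (hpos : ∀ x, 0 < ratio (volOf q.e) vol0 x) {x : M}
  {v : Frame} (hv : DualFrame v q.e x)
include hpos hv

/-- The left-hand side of the scalar constraint. -/
theorem DualFrame.scalar_eq (p : ℝ) :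
    2 * p - (Real.sqrt (detHSq vol0 (J vol0 q).Ht x
        - ∑ l, ev ((J vol0 q).Ht l) (dFun q.φ) x ^ 2))⁻¹ *
      (∑ i, ∑ j, ∑ k, eps i j k * ev ((J vol0 q).Ht i) (inner1 ((J vol0 q).Ht j) (curv q.A k)) x)
      = 2 * (p - (piTilde vol0 q x
        - (∑ i, comp1 v (dFun q.φ x) i * comp3 v (constrF q i x)) / comp3 v (vol0 x))) := by
  have hp := hv.ratio_volOf hpos
  have h0 := hp.ne'
  have hJ : (J vol0 q).Ht = fun i => dualVec vol0 (HForm q.e q.φ i) := rfl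
  have h1 : ∀ l, ev (dualVec vol0 (HForm q.e q.φ l)) (dFun q.φ) x
      = comp1 v (dFun q.φ x) l / comp3 v (vol0 x) := fun l => by
    rw [ev_eq v, ← sum_fluxMat_mul (comp1 v (dFun q.φ x)) l, Finset.sum_div]
    exact Finset.sum_congr rfl fun m _ => by rw [hv.repr_flux q.φ hpos]; ring
  -- With V the component of vol₀, the radicand is (1 + a²)/V² - a²/V² = 1/V². Positivity of V, that
  -- is of det e, selects the root 1/V.
  have h2 : Real.sqrt (detHSq vol0 (fun i => dualVec vol0 (HForm q.e q.φ i)) x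
      - ∑ l, ev (dualVec vol0 (HForm q.e q.φ l)) (dFun q.φ) x ^ 2) = (comp3 v (vol0 x))⁻¹ := by
    rw [hv.detHSq_eq q.φ hpos]
    simp only [h1, div_pow, ← Finset.sum_div]
    rw [← sub_div, add_sub_cancel_right, Real.sqrt_div zero_le_one, Real.sqrt_sq hp.le,
      Real.sqrt_one, one_div]
  have h3 : ∀ i j k, ev (dualVec vol0 (HForm q.e q.φ i))
      (inner1 (dualVec vol0 (HForm q.e q.φ j)) (curv q.A k)) x
      = (∑ m, fluxMat (comp1 v (dFun q.φ x)) i m * (fluxMat (comp1 v (dFun q.φ x)) j (m + 2)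
        * comp2 v (curv q.A k x) (m + 1) - fluxMat (comp1 v (dFun q.φ x)) j (m + 1)
        * comp2 v (curv q.A k x) (m + 2))) / comp3 v (vol0 x) ^ 2 := fun i j k => by
    rw [ev_eq v, Finset.sum_div]
    refine Finset.sum_congr rfl fun m _ => ?_
    rw [comp1_inner1, hv.repr_flux q.φ hpos, hv.repr_flux q.φ hpos, hv.repr_flux q.φ hpos]
    field_simp
  have h4 : piTilde vol0 q x = -(∑ i, comp2 v (curv q.A i x) i) / comp3 v (vol0 x) := by
    have : piTilde vol0 q x = ratio (-∑ i, wedge3 (q.e i) (curv q.A i)) vol0 x := rfl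
    rw [this, ratio_eq v]
    simp only [Pi.neg_apply, Finset.sum_apply, comp3_neg, comp3_sum, comp3_wedge3, hv _ _]
    simp [kron]
  simp only [hJ, h2, inv_inv]
  rw [eps_sum3_mul]
  simp only [h3, h4, constrF, cross3, Pi.add_apply, Pi.sub_apply, comp3_add, comp3_sub, comp3_wedge3,
    hv _ _, Fin.sum_univ_three, Fin.isValue, Fin.reduceAdd]
  simp only [fluxMat, kron, Fin.isValue, Fin.reduceAdd, Fin.reduceEq, if_true, if_false]
  field_simp
  ring

/-- The left-hand side of the vector constraint. -/
theorem DualFrame.vector_eq (p : M → ℝ) (m : Fin 3) :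
    comp1 v (((∑ i, inner1 ((J vol0 q).Ht i) (curv q.A i)) - fmul p (dFun q.φ)) x) m
      = comp3 v (constrF q m x) / comp3 v (vol0 x)
        + (piTilde vol0 q x - p x) * comp1 v (dFun q.φ x) m := by
  have h0 := (hv.ratio_volOf hpos).ne'
  have hJ : (J vol0 q).Ht = fun i => dualVec vol0 (HForm q.e q.φ i) := rfl
  have h4 : piTilde vol0 q x = -(∑ i, comp2 v (curv q.A i x) i) / comp3 v (vol0 x) := by
    have : piTilde vol0 q x = ratio (-∑ i, wedge3 (q.e i) (curv q.A i)) vol0 x := rfl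
    rw [this, ratio_eq v]
    simp only [Pi.neg_apply, Finset.sum_apply, comp3_neg, comp3_sum, comp3_wedge3, hv _ _]
    simp [kron]
  rw [h4, hJ]
  simp only [Pi.sub_apply, Finset.sum_apply, comp1_sub, comp1_sum, comp1_fmul, comp1_inner1,
    hv.repr_flux q.φ hpos, constrF, cross3, Pi.add_apply, comp3_add, comp3_sub, comp3_wedge3, hv _ _]
  simp only [fun f : Fin 3 → ℝ => sum_cyclic f m, kron_self, kron_01, kron_02, kron_10, kron_12,
    kron_20, kron_21, fluxMat_self, fluxMat_01, fluxMat_02, fluxMat_10, fluxMat_12, fluxMat_20,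
    fluxMat_21, add_assoc, Fin.isValue, Fin.reduceAdd, add_zero]
  field_simp
  ring

end Pointwise

section Constraints

variable [IsManifold (𝓡 3) ∞ M] {q : Fields M} {vol0 : Form M 3} (hv0 : ∀ x, vol0 x ≠ 0)
  (he : ∀ x, volOf q.e x ≠ 0) (hpos : ∀ x, 0 < ratio (volOf q.e) vol0 x) {p : M → ℝ}
include he hpos

theorem scalarConstraint_iff (hF : ∀ i, constrF q i = 0) :
    p = piTilde vol0 q ↔ ScalarConstraint vol0 { J vol0 q with pit := p } := by
  refine funext_iff.trans (forall_congr' fun x => ?_)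
  obtain ⟨v, hv⟩ := exists_dualFrame (he x)
  refine Iff.trans ?_ (Eq.congr (hv.scalar_eq hpos (p x)) rfl).symm
  simp only [hF, Pi.zero_apply, comp3_zero, mul_zero, Finset.sum_const_zero, zero_div, sub_zero]
  constructor
  · intro h; rw [h]; ring
  · intro h; linarith

theorem vectorConstraint_iff (hp : p = piTilde vol0 q) :
    SecondaryF q ↔ VectorConstraint { J vol0 q with pit := p } := by
  rw [secondaryF_iff]
  have key : ∀ x (v : Frame) (hv : DualFrame v q.e x) m,
      comp1 v (((∑ i, inner1 ((J vol0 q).Ht i) (curv q.A i)) - fmul p (dFun q.φ)) x) m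
      = comp3 v (constrF q m x) / comp3 v (vol0 x) := fun x v hv m => by
    rw [hv.vector_eq hpos, hp, sub_self, zero_mul, add_zero]
  constructor
  · intro hF
    refine funext fun x => ?_
    obtain ⟨v, hv⟩ := exists_dualFrame (he x)
    refine ext_comp1 v fun m => (key x v hv m).trans ?_
    rw [hF, Pi.zero_apply, comp3_zero, zero_div]
    rfl
  · intro h i
    funext x
    obtain ⟨v, hv⟩ := exists_dualFrame (he x)
    refine ext_comp3 v ?_
    have h1 := key x v hv i
    have h2 : ((∑ i, inner1 ((J vol0 q).Ht i) (curv q.A i)) - fmul p (dFun q.φ)) x = 0 := congrFun h x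
    rw [h2, comp1_zero, eq_comm, div_eq_zero_iff] at h1
    exact h1.resolve_right (hv.ratio_volOf hpos).ne'

/-- The vector constraint gives C_m/V = (p - π̃) a_m; inserted in the scalar constraint it yields (p
- π̃)(1 + a²) = 0. -/
theorem scalar_vector_imp (hS : ScalarConstraint vol0 { J vol0 q with pit := p })
    (hV : VectorConstraint { J vol0 q with pit := p }) : p = piTilde vol0 q := by
  funext x
  obtain ⟨v, hv⟩ := exists_dualFrame (he x)
  have h0 := (hv.ratio_volOf hpos).ne'
  have h1 := (hv.scalar_eq hpos (p x)).symm.trans (hS x)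
  have h2 : ∀ m, comp3 v (constrF q m x) / comp3 v (vol0 x)
        + (piTilde vol0 q x - p x) * comp1 v (dFun q.φ x) m = 0 := fun m => by
    rw [← hv.vector_eq hpos p m]
    have h2 : ((∑ i, inner1 ((J vol0 q).Ht i) (curv q.A i)) - fmul p (dFun q.φ)) x = 0 := congrFun hV x
    rw [h2, comp1_zero]
  have h3 := one_add_sum_sq_pos (comp1 v (dFun q.φ x))
  have h4 : (p x - piTilde vol0 q x) * (1 + ∑ k, comp1 v (dFun q.φ x) k ^ 2) = 0 := by
    have a0 := h2 0
    have a1 := h2 1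
    have a2 := h2 2
    simp only [Fin.sum_univ_three, add_div] at h1 ⊢
    linear_combination h1 / 2 - comp1 v (dFun q.φ x) 0 * a0 - comp1 v (dFun q.φ x) 1 * a1
      - comp1 v (dFun q.φ x) 2 * a2
  exact sub_eq_zero.1 ((mul_eq_zero.1 h4).resolve_right h3.ne')

omit he hpos in
include hv0 in
-- Since H̃ ⌟ vol₀ = H, the divergence of H̃ is dH/vol₀ and the left-hand side of the Gauss
-- constraint is DH/vol₀.
theorem gaussConstraint_iff (hq : q.Smooth) :
    SecondaryT q ↔ GaussConstraint vol0 { J vol0 q with pit := p } := by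
  rw [secondaryT_iff]
  have key : ∀ i x, divergence vol0 ((J vol0 q).Ht i) x
      + ∑ j, ∑ k, eps i j k * ev ((J vol0 q).Ht k) (q.A j) x = -ratio (constrT q i) vol0 x := by
    intro i x
    have h0 := comp3_ne_zero stdFrame (hv0 x)
    have h1 : divergence vol0 ((J vol0 q).Ht i) = ratio (d2 (HForm q.e q.φ i)) vol0 :=
      congrArg (fun b => ratio (d2 b) vol0) (inner1_dualVec hv0 _)
    have h2 : ∀ j k, ev ((J vol0 q).Ht k) (q.A j) x = ratio (wedge3 (q.A j) (HForm q.e q.φ k)) vol0 x := by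
      intro j k
      have : (J vol0 q).Ht k = dualVec vol0 (HForm q.e q.φ k) := rfl
      simp only [this, ev_eq stdFrame, ratio_eq stdFrame, comp3_wedge3, repr_dualVec,
        Fin.sum_univ_three]
      field_simp
    have h3 := congrArg (comp3 stdFrame) (congrFun (cov2_HForm hq i) x)
    rw [cov2_eq] at h3
    rw [eps_sum_mul i fun j k => ev ((J vol0 q).Ht k) (q.A j) x, h1, h2, h2]
    simp only [cross3, Pi.add_apply, Pi.sub_apply, Pi.neg_apply, comp3_add, comp3_sub, comp3_neg] at h3
    simp only [ratio_eq stdFrame]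
    field_simp
    linear_combination h3
  refine forall_congr' fun i => ?_
  constructor
  · intro h x
    refine (key i x).trans ?_
    rw [h, ratio]
    exact neg_eq_zero.2 (zero_div _)
  · intro h
    refine eq_zero_of_ratio_eq_zero hv0 fun x => ?_
    exact neg_eq_zero.1 ((key i x).symm.trans (h x))

end Constraints

end

/-! ### Matrix identities for the evolution of the connection and of H -/

section

section Matrices

/-- The part of the evolution of the connection proportional to the lapse. -/
def lapseMat (a : Fin 3 → ℝ) (f : Fin 3 → Fin 3 → ℝ) (i m : Fin 3) : ℝ :=
  1 / 2 * (∑ k, f k k) * (2 * kron i m - fluxMat a i m + a i * a m) - f i m - (∑ p, f i p * a p) * a m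
    + (f i (m + 1) * a (m + 2) - f i (m + 2) * a (m + 1))

/-- Under (F) the matrix of F is opMat(-1) applied to a symmetric w. For such matrices `lapseMat`,
divided by 1 + a², is the preimage of F under opMat(-1). -/
theorem opMat_lapseMat (a : Fin 3 → ℝ) {w : Fin 3 → Fin 3 → ℝ} (hw : ∀ i j, w i j = w j i)
    (i m : Fin 3) : opMat (-1) a (lapseMat a (opMat (-1) a w)) i m
      = (1 + ∑ k, a k ^ 2) * opMat (-1) a w i m := by
  refine cyclic_cases i ?_ ?_ ?_ m <;>
  simp only [opMat, lapseMat, fun f : Fin 3 → ℝ => sum_cyclic f i, kron_self, kron_01, kron_02,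
    kron_10, kron_12, kron_20, kron_21, fluxMat_self, fluxMat_01, fluxMat_02, fluxMat_10, fluxMat_12,
    fluxMat_20, fluxMat_21, add_assoc, Fin.isValue, Fin.reduceAdd, add_zero, hw (i + 1) i,
    hw (i + 2) i, hw (i + 2) (i + 1)] <;>
  ring

/-- Applied to the shift term, the operator returns the source e_t × F together with an excess (e_t
· α) F. The lapse term must therefore account for (Z_φ - e_t · α) F, which is why the lapse is
proportional to Z_φ - e_t · α. -/
theorem opMat_shift (a t : Fin 3 → ℝ) {w : Fin 3 → Fin 3 → ℝ} (hw : ∀ i j, w i j = w j i)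
    (i m : Fin 3) :
    opMat (-1) a (fun i m => opMat (-1) a w i (m + 1) * t (m + 2)
      - opMat (-1) a w i (m + 2) * t (m + 1)) i m
      = (∑ k, t k * a k) * opMat (-1) a w i m
        + (t (i + 1) * opMat (-1) a w (i + 2) m - t (i + 2) * opMat (-1) a w (i + 1) m) := by
  refine cyclic_cases i ?_ ?_ ?_ m <;>
  simp only [opMat, fun f : Fin 3 → ℝ => sum_cyclic f i, kron_self, kron_01, kron_02,
    kron_10, kron_12, kron_20, kron_21, add_assoc, Fin.isValue, Fin.reduceAdd, add_zero, hw (i + 1) i,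
    hw (i + 2) i, hw (i + 2) (i + 1)] <;>
  ring

/-- In terms of metrics: h_i ⊗ h^i = e_i ⊗ e^i + dφ ⊗ dφ. -/
theorem sum_triadMat_mul (a : Fin 3 → ℝ) (p m : Fin 3) :
    ∑ j, triadMat a j p * triadMat a j m = (1 + ∑ k, a k ^ 2) * (kron p m + a p * a m) := by
  refine cyclic_cases p ?_ ?_ ?_ m <;>
  simp only [triadMat, fun f : Fin 3 → ℝ => sum_cyclic f p, kron_self, kron_01, kron_02,
    fluxMat_self, fluxMat_01, fluxMat_02, fluxMat_10, fluxMat_12,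
    fluxMat_20, fluxMat_21, add_assoc, Fin.isValue, Fin.reduceAdd, add_zero] <;>
  ring

/-- The internal shift, up to the factor `√(1 + a²)`. -/
def shiftMat (a t : Fin 3 → ℝ) (z : ℝ) (i : Fin 3) : ℝ :=
  t i + z * a i - (t (i + 1) * a (i + 2) - t (i + 2) * a (i + 1))

theorem eps_triadMat_shiftMat (a t : Fin 3 → ℝ) (z : ℝ) (p m : Fin 3) :
    ∑ j, ∑ k, ∑ l, eps k j l * (triadMat a j p * triadMat a k m * shiftMat a t z l)
      = (1 + ∑ k, a k ^ 2) * ∑ l, eps m p l * ((1 + ∑ k, a k ^ 2) * t l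
        + (z - ∑ k, t k * a k) * a l) := by
  -- Exchanging the first two indices of ε puts the sum in the order that `eps_sum3_mul` opens.
  have h : ∑ j, ∑ k, ∑ l, eps k j l * (triadMat a j p * triadMat a k m * shiftMat a t z l)
      = -∑ j, ∑ k, ∑ l, eps j k l * (triadMat a j p * triadMat a k m * shiftMat a t z l) := by
    simp only [← Finset.sum_neg_distrib]
    refine Finset.sum_congr rfl fun j _ => Finset.sum_congr rfl fun k _ =>
      Finset.sum_congr rfl fun l _ => ?_
    simp only [eps]; ring
  rw [h, eps_sum3_mul]
  fin_cases p <;> fin_cases m <;>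
  simp [triadMat, fluxMat, shiftMat, kron, eps, Fin.sum_univ_three] <;> ring

theorem sum_extra_triadMat (a : Fin 3 → ℝ) (i m : Fin 3) :
    ∑ k, (-(∑ j, eps i j k * a j) + 1 / 2 * (1 - ∑ k, a k ^ 2) * kron i k + a i * a k)
      * triadMat a k m
      = 1 / 2 * (1 + ∑ k, a k ^ 2) * (2 * kron i m - fluxMat a i m + a i * a m) := by
  simp only [eps_sum_mid]
  refine cyclic_cases i ?_ ?_ ?_ m <;>
  simp only [triadMat, fun f : Fin 3 → ℝ => sum_cyclic f i, kron_self, kron_01, kron_02,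
    fluxMat_self, fluxMat_01, fluxMat_02, fluxMat_10, fluxMat_12,
    fluxMat_20, fluxMat_21, add_assoc, Fin.isValue, Fin.reduceAdd, add_zero] <;>
  ring

/-- Under (F) the trace of the curvature in the triad h is thus its trace in e divided by 1 + a²,
which brings `extraConn` to the form occurring in `lapseMat`. -/
theorem sum_triadMat_opMat (a : Fin 3 → ℝ) {w : Fin 3 → Fin 3 → ℝ} (hw : ∀ i j, w i j = w j i) :
    ∑ i, ∑ m, triadMat a i m * opMat (-1) a w i m = ∑ i, opMat (-1) a w i i := by
  simp only [opMat, triadMat, fluxMat, kron, Fin.sum_univ_three, Fin.isValue, Fin.reduceAdd, Fin.reduceEq,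
    if_true, if_false, hw 1 0, hw 2 0, hw 2 1]
  ring

/-- Matrix form of ê × h - α̂ h = e_t × e + e_t dφ - Z_φ e; the normalizations of lapse, shift and
triad absorb the factor 1 + a². -/
theorem shiftMat_cross_triadMat (a t : Fin 3 → ℝ) (z : ℝ) (i m : Fin 3) :
    shiftMat a t z (i + 1) * triadMat a (i + 2) m - shiftMat a t z (i + 2) * triadMat a (i + 1) m
      - (z - ∑ k, t k * a k) * triadMat a i m
      = (1 + ∑ k, a k ^ 2) * (t (i + 1) * kron (i + 2) m - t (i + 2) * kron (i + 1) m + t i * a m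
        - z * kron i m) := by
  refine cyclic_cases i ?_ ?_ ?_ m <;>
  simp only [triadMat, shiftMat, fun f : Fin 3 → ℝ => sum_cyclic f i, kron_self, kron_01, kron_02,
    kron_10, kron_12, kron_20, kron_21, fluxMat_self, fluxMat_01, fluxMat_02, fluxMat_10, fluxMat_12,
    fluxMat_20, fluxMat_21, add_assoc, Fin.isValue, Fin.reduceAdd, add_zero] <;>
  ring

end Matrices

end

/-! ### The evolution of the connection -/

section

section Matrices

theorem opMat_add_mul (s : ℝ) (a : Fin 3 → ℝ) (k : ℝ) (w z : Fin 3 → Fin 3 → ℝ) (i m : Fin 3) :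
    opMat s a (fun i m => k * w i m + z i m) i m = k * opMat s a w i m + opMat s a z i m := by
  simp only [opMat, Finset.sum_add_distrib, ← Finset.mul_sum]
  ring

theorem sum_eps_mul (f t : Fin 3 → ℝ) (m : Fin 3) :
    ∑ p, f p * ∑ l, eps m p l * t l = f (m + 1) * t (m + 2) - f (m + 2) * t (m + 1) := by
  rw [← eps_sum_mul m fun j k => f j * t k]
  refine Finset.sum_congr rfl fun p _ => ?_
  rw [Finset.mul_sum]
  exact Finset.sum_congr rfl fun l _ => by ring

end Matrices

section Pointwise

variable {M : Type*} [TopologicalSpace M] [ChartedSpace E3 M] {e : Fin 3 → Form M 1} {x : M}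
  {v : Frame} (hv : DualFrame v e x) (φ : M → ℝ)
include hv

theorem DualFrame.matOf_hTriad (F : Fin 3 → Form M 2) (i j : Fin 3) :
    matOf F (hTriad e φ) i j x = (1 + ∑ k, comp1 v (dFun φ x) k ^ 2)⁻¹ *
      ∑ p, triadMat (comp1 v (dFun φ x)) j p * comp2 v (F i x) p := by
  rw [matOf_eq_coef2, coef2, ratio_eq v, hv.comp3_volOf_hTriad, comp3_wedge3]
  simp only [hv.comp1_hTriad, mul_assoc, ← Finset.mul_sum]
  have h2 := (sqrt_pos_of (comp1 v (dFun φ x))).ne'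
  have h3 := sqrt_sq_of (comp1 v (dFun φ x))
  set S := Real.sqrt (1 + ∑ k, comp1 v (dFun φ x) k ^ 2)
  rw [← h3]
  field_simp

theorem DualFrame.etAlpha_eq (t : Fin 3 → M → ℝ) :
    etAlpha t e φ x = ∑ k, t k x * comp1 v (dFun φ x) k := by
  simp only [etAlpha, hv.alpha_eq]

theorem DualFrame.lapseHat_eq (t : Fin 3 → M → ℝ) (z : M → ℝ) :
    lapseHat t e φ z x = (z x - ∑ k, t k x * comp1 v (dFun φ x) k)
      / Real.sqrt (1 + ∑ k, comp1 v (dFun φ x) k ^ 2) := by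
  rw [lapseHat, hv.etAlpha_eq, hv.alphaSq_eq]

theorem DualFrame.shiftHat_eq (t : Fin 3 → M → ℝ) (z : M → ℝ) (i : Fin 3) :
    shiftHat t e φ z i x = shiftMat (comp1 v (dFun φ x)) (fun k => t k x) (z x) i
      / Real.sqrt (1 + ∑ k, comp1 v (dFun φ x) k ^ 2) := by
  rw [shiftHat, hv.alphaSq_eq, shiftMat, hv.alpha_eq]
  have := eps_sum_mul i fun j k => t j x * alpha e φ k x
  simp only [← mul_assoc] at this
  rw [this]
  simp only [hv.alpha_eq]

/-- The lapse term of the evolution of the connection. -/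
theorem DualFrame.comp1_lapseTerm (F : Fin 3 → Form M 2) (t : Fin 3 → M → ℝ) (z : M → ℝ)
    (i m : Fin 3) :
    comp1 v ((∑ j, fmul (fun x => lapseHat t e φ z x * matOf F (hTriad e φ) i j x)
      (hTriad e φ j)) x) m
      = (z x - ∑ k, t k x * comp1 v (dFun φ x) k) / (1 + ∑ k, comp1 v (dFun φ x) k ^ 2) *
        (comp2 v (F i x) m
          + (∑ p, comp2 v (F i x) p * comp1 v (dFun φ x) p) * comp1 v (dFun φ x) m) := by
  rw [Finset.sum_apply, comp1_sum]
  simp only [comp1_fmul, hv.lapseHat_eq, hv.matOf_hTriad, hv.comp1_hTriad]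
  set a := comp1 v (dFun φ x) with ha
  set f := comp2 v (F i x) with hf
  have h2 := (sqrt_pos_of a).ne'
  have h3 := sqrt_sq_of a
  have h4 := (one_add_sum_sq_pos a).ne'
  set S := Real.sqrt (1 + ∑ k, a k ^ 2)
  set n := 1 + ∑ k, a k ^ 2 with hn
  calc _ = (z x - ∑ k, t k x * a k) / n ^ 2 * ∑ p, f p * ∑ j, triadMat a j p * triadMat a j m := by
        have : ∀ j, (z x - ∑ k, t k x * a k) / S * (n⁻¹ * ∑ p, triadMat a j p * f p)
            * (S⁻¹ * triadMat a j m)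
            = (z x - ∑ k, t k x * a k) / n ^ 2 * ∑ p, f p * (triadMat a j p * triadMat a j m) := by
          intro j
          have h5 : ∑ p, f p * (triadMat a j p * triadMat a j m)
            = (∑ p, triadMat a j p * f p) * triadMat a j m := by
            rw [Finset.sum_mul]; exact Finset.sum_congr rfl fun p _ => by ring
          rw [h5]
          field_simp
          rw [h3]
        rw [Finset.sum_congr rfl fun j _ => this j, ← Finset.mul_sum, Finset.sum_comm]
        simp only [← Finset.mul_sum]
    _ = _ := by
        simp only [sum_triadMat_mul]
        rw [← hn]
        have : ∑ p, f p * (n * (kron p m + a p * a m)) = n * (f m + (∑ p, f p * a p) * a m) := by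
          rw [sum_cyclic _ m, sum_cyclic _ m, kron_self, kron_10, kron_20]; ring
        rw [this]
        field_simp

/-- The shift term of the evolution of the connection. -/
theorem DualFrame.comp1_shiftTerm (F : Fin 3 → Form M 2) (t : Fin 3 → M → ℝ) (z : M → ℝ)
    (i m : Fin 3) :
    comp1 v ((∑ j, ∑ k, ∑ l, eps k j l • fmul (fun x => matOf F (hTriad e φ) i j x
      * shiftHat t e φ z l x) (hTriad e φ k)) x) m
      = (z x - ∑ k, t k x * comp1 v (dFun φ x) k) / (1 + ∑ k, comp1 v (dFun φ x) k ^ 2) *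
        (comp2 v (F i x) (m + 1) * comp1 v (dFun φ x) (m + 2)
          - comp2 v (F i x) (m + 2) * comp1 v (dFun φ x) (m + 1))
        + (comp2 v (F i x) (m + 1) * t (m + 2) x - comp2 v (F i x) (m + 2) * t (m + 1) x) := by
  simp only [Finset.sum_apply, comp1_sum, Pi.smul_apply, comp1_smul]
  simp only [comp1_fmul, hv.shiftHat_eq, hv.matOf_hTriad, hv.comp1_hTriad]
  set a := comp1 v (dFun φ x) with ha
  set f := comp2 v (F i x) with hf
  have h2 := (sqrt_pos_of a).ne'
  have h3 := sqrt_sq_of a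
  have h4 := (one_add_sum_sq_pos a).ne'
  have h5 := eps_triadMat_shiftMat a (fun k => t k x) (z x)
  set S := Real.sqrt (1 + ∑ k, a k ^ 2)
  set n := 1 + ∑ k, a k ^ 2 with hn
  set y := shiftMat a (fun k => t k x) (z x)
  calc _ = 1 / n ^ 2 * ∑ p, f p * ∑ j, ∑ k, ∑ l, eps k j l * (triadMat a j p * triadMat a k m * y l) := by
        have : ∀ j k l, eps k j l * (n⁻¹ * (∑ p, triadMat a j p * f p) * (y l / S) * (S⁻¹ * triadMat a k m))
            = 1 / n ^ 2 * ∑ p, f p * (eps k j l * (triadMat a j p * triadMat a k m * y l)) := by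
          intro j k l
          have h5 : ∑ p, f p * (eps k j l * (triadMat a j p * triadMat a k m * y l))
            = (∑ p, triadMat a j p * f p) * (eps k j l * (triadMat a k m * y l)) := by
            rw [Finset.sum_mul]; exact Finset.sum_congr rfl fun p _ => by ring
          rw [h5]
          field_simp
          rw [h3]
          ring
        simp only [this, ← Finset.mul_sum]
        congr 1
        simp only [Fin.sum_univ_three]
        ring
    _ = 1 / n ^ 2 * ∑ p, f p * (n * ∑ l, eps m p l * (n * t l x + (z x - ∑ k, t k x * a k) * a l)) := by
        simp only [h5]
    _ = 1 / n * ∑ p, f p * ∑ l, eps m p l * (n * t l x + (z x - ∑ k, t k x * a k) * a l) := by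
        have : ∀ g : Fin 3 → ℝ, ∑ p, f p * (n * g p) = n * ∑ p, f p * g p := fun g => by
          rw [Finset.mul_sum]; exact Finset.sum_congr rfl fun p _ => by ring
        rw [this]
        field_simp
    _ = _ := by
        rw [sum_eps_mul f fun l => n * t l x + (z x - ∑ k, t k x * a k) * a l]
        field_simp
        ring

/-- The term of the evolution of the connection which is absent in general relativity. -/
theorem DualFrame.comp1_extraConn (A : Fin 3 → Form M 1) (t : Fin 3 → M → ℝ) (z : M → ℝ)
    (hf : ∑ i, ∑ m, triadMat (comp1 v (dFun φ x)) i m * comp2 v (curv A i x) m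
      = ∑ i, comp2 v (curv A i x) i) (i m : Fin 3) :
    comp1 v (extraConn e A φ (lapseHat t e φ z) i x) m
      = (z x - ∑ k, t k x * comp1 v (dFun φ x) k) / (1 + ∑ k, comp1 v (dFun φ x) k ^ 2) *
        (1 / 2 * (∑ k, comp2 v (curv A k x) k) * (2 * kron i m - fluxMat (comp1 v (dFun φ x)) i m
          + comp1 v (dFun φ x) i * comp1 v (dFun φ x) m)) := by
  rw [extraConn, comp1_sum]
  simp only [comp1_smul, hv.lapseHat_eq, curvTrace, hv.matOf_hTriad, hv.comp1_hTriad, hv.alpha_eq,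
    hv.alphaSq_eq, ← Finset.mul_sum, hf]
  set a := comp1 v (dFun φ x) with ha
  have h1 := sum_extra_triadMat a i m
  have h2 := (sqrt_pos_of a).ne'
  have h3 := sqrt_sq_of a
  have h4 := (one_add_sum_sq_pos a).ne'
  set S := Real.sqrt (1 + ∑ k, a k ^ 2)
  set n := 1 + ∑ k, a k ^ 2 with hn
  set T := ∑ k : Fin 3, comp2 v (curv A k x) k
  calc _ = (z x - ∑ k, t k x * a k) / n ^ 2 * T * ∑ k, (-(∑ j, eps i j k * a j)
        + 1 / 2 * (1 - ∑ k, a k ^ 2) * kron i k + a i * a k) * triadMat a k m := by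
        refine Eq.trans (Finset.sum_congr rfl fun k _ => ?_) (Finset.mul_sum _ _ _).symm
        field_simp
        rw [h3]
    _ = _ := by
        rw [h1]
        field_simp

theorem DualFrame.comp1_flux_diff (t : Fin 3 → M → ℝ) (z : M → ℝ) (i m : Fin 3) :
    comp1 v (crossFun (shiftHat t e φ z) (hTriad e φ) i x - fmul (lapseHat t e φ z) (hTriad e φ i) x) m
      = t (i + 1) x * kron (i + 2) m - t (i + 2) x * kron (i + 1) m
        + t i x * comp1 v (dFun φ x) m - z x * kron i m := by
  simp only [crossFun, Pi.sub_apply, comp1_sub, comp1_fmul, hv.shiftHat_eq, hv.lapseHat_eq,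
    hv.comp1_hTriad]
  set a := comp1 v (dFun φ x) with ha
  have h1 := shiftMat_cross_triadMat a (fun k => t k x) (z x) i m
  have h2 := (sqrt_pos_of a).ne'
  have h3 := sqrt_sq_of a
  have h4 := (one_add_sum_sq_pos a).ne'
  rw [← h3] at h1
  set S := Real.sqrt (1 + ∑ k, a k ^ 2)
  field_simp
  linear_combination h1

end Pointwise

section Evolution

variable {M : Type*} [TopologicalSpace M] [ChartedSpace E3 M] {q : Fields M}

/-- The evolution of the connection, as the solution of the equation obtained by varying the
triad. -/
theorem opL_grConn (he : ∀ x, volOf q.e x ≠ 0) (hF : ∀ i, constrF q i = 0) (z : M → ℝ) (i : Fin 3) :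
    opL (-1) q.e (dFun q.φ) (fun i => grConn (hTriad q.e q.φ) q.A q.At (lapseHat q.et q.e q.φ z)
        (shiftHat q.et q.e q.φ z) i + extraConn q.e q.A q.φ (lapseHat q.et q.e q.φ z) i
        - covFun q.A q.At i) i
      = fmul z (curv q.A i) + crossFun q.et (curv q.A) i := by
  have hw := opL_invL (s := -1) (by norm_num) he (dFun q.φ) (curv q.A)
  generalize invL (-1) q.e (dFun q.φ) (curv q.A) = w at hw
  funext x
  obtain ⟨v, hv⟩ := exists_dualFrame (he x)
  have hs := hv.symm_of_opL (s := -1) (by norm_num) (p := dFun q.φ) (w := w) fun i => by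
    rw [← hF i, funext hw, constrF, ← neg_eq_smul, sub_neg_eq_add]
  have hf : ∀ i m, comp2 v (curv q.A i x) m
      = opMat (-1) (comp1 v (dFun q.φ x)) (fun i j => comp1 v (w i x) j) i m := fun i m => by
    rw [← hw, hv.comp2_opL]
  have htr : ∑ i, ∑ m, triadMat (comp1 v (dFun q.φ x)) i m * comp2 v (curv q.A i x) m
      = ∑ i, comp2 v (curv q.A i x) i := by
    simp only [hf]
    exact sum_triadMat_opMat _ hs
  refine ext_comp2 v fun m => ?_
  rw [hv.comp2_opL]
  -- Lapse term, shift term and extra term regroup into the two matrices on which opMat(-1) has been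
  -- computed.
  have hU : ∀ i m, comp1 v ((grConn (hTriad q.e q.φ) q.A q.At (lapseHat q.et q.e q.φ z)
        (shiftHat q.et q.e q.φ z) i + extraConn q.e q.A q.φ (lapseHat q.et q.e q.φ z) i
        - covFun q.A q.At i) x) m
      = (z x - ∑ k, q.et k x * comp1 v (dFun q.φ x) k) / (1 + ∑ k, comp1 v (dFun q.φ x) k ^ 2) *
          lapseMat (comp1 v (dFun q.φ x)) (opMat (-1) (comp1 v (dFun q.φ x))
            (fun i j => comp1 v (w i x) j)) i m
        + (opMat (-1) (comp1 v (dFun q.φ x)) (fun i j => comp1 v (w i x) j) i (m + 1) * q.et (m + 2) x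
          - opMat (-1) (comp1 v (dFun q.φ x)) (fun i j => comp1 v (w i x) j) i (m + 2)
            * q.et (m + 1) x) := fun i m => by
    simp only [grConn, Pi.add_apply, Pi.sub_apply, comp1_add, comp1_sub, hv.comp1_lapseTerm,
      hv.comp1_shiftTerm, hv.comp1_extraConn q.φ q.A q.et z htr, hf, lapseMat]
    ring
  simp only [hU]
  rw [opMat_add_mul, opMat_lapseMat _ hs, opMat_shift _ (fun k => q.et k x) hs]
  simp only [Pi.add_apply, crossFun, Pi.sub_apply, comp2_add, comp2_sub, comp2_fmul, hf]
  have h4 := (one_add_sum_sq_pos (comp1 v (dFun q.φ x))).ne'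
  field_simp
  ring

/-- DA_t enters exactly as Z_A does and is absorbed in the unknown. The value s = -1 arises from dφ
∧ w = -w ∧ dφ. -/
theorem eqE_eq_hamE_iff {Z : Fields M} (i : Fin 3) : eqE q Z i = hamE q i ↔
    opL (-1) q.e (dFun q.φ) (fun i => Z.A i - covFun q.A q.At i) i
      = fmul Z.φ (curv q.A i) + crossFun q.et (curv q.A) i := by
  have h : eqE q Z i - hamE q i
      = opL (-1) q.e (dFun q.φ) (fun i => Z.A i - covFun q.A q.At i) i
        - (fmul Z.φ (curv q.A i) + crossFun q.et (curv q.A) i) := by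
    funext x
    refine ext_comp2 stdFrame fun m => ?_
    simp only [eqE, hamE, opL, cross2, Pi.add_apply, Pi.sub_apply, Pi.smul_apply, comp2_add,
      comp2_sub, comp2_smul, comp2_wedge2, comp1_sub]
    ring
  rw [← sub_eq_zero, h, sub_eq_zero]

theorem eqE_eq_hamE_iff_grConn (he : ∀ x, volOf q.e x ≠ 0) (hF : ∀ i, constrF q i = 0)
    {Z : Fields M} : (∀ i, eqE q Z i = hamE q i) ↔
      ∀ i, Z.A i = grConn (hTriad q.e q.φ) q.A q.At (lapseHat q.et q.e q.φ Z.φ)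
        (shiftHat q.et q.e q.φ Z.φ) i + extraConn q.e q.A q.φ (lapseHat q.et q.e q.φ Z.φ) i := by
  simp only [eqE_eq_hamE_iff, ← opL_grConn he hF]
  constructor
  · intro h i
    exact sub_left_injective (opL_injective (by norm_num) he h i)
  · intro h i
    rw [funext h]

end Evolution

end

/-! ### The evolution of H, and existence and uniqueness of Hamiltonian vectors -/

section

variable {M : Type*} [TopologicalSpace M] [ChartedSpace E3 M] [IsManifold (𝓡 3) ∞ M]

section Smooth

variable {q : Fields M} (hq : q.Smooth) (he : ∀ x, volOf q.e x ≠ 0)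
include hq he

theorem SmoothFun.alpha (i : Fin 3) : SmoothFun (alpha q.e q.φ i) := by
  rw [alpha_eq_coef]; exact SmoothFun.coef hq.e he (SmoothForm.dFun hq.φ) i

theorem SmoothFun.sqrt_alphaSq : SmoothFun fun x => Real.sqrt (1 + alphaSq q.e q.φ x) := by
  refine SmoothFun.sqrt ((SmoothFun.const 1).add (SmoothFun.sum fun k _ => ?_)) fun x => ?_
  · simpa only [pow_two] using (SmoothFun.alpha hq he k).mul (SmoothFun.alpha hq he k)
  · exact one_add_sum_sq_pos fun i => HK.alpha q.e q.φ i x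

omit hq he [TopologicalSpace M] [ChartedSpace E3 M] [IsManifold (𝓡 3) ∞ M] in
theorem sqrt_alphaSq_ne_zero [TopologicalSpace M] [ChartedSpace E3 M] (e : Fin 3 → Form M 1)
    (φ : M → ℝ) (x : M) : Real.sqrt (1 + alphaSq e φ x) ≠ 0 :=
  (Real.sqrt_pos.2 (one_add_sum_sq_pos fun i => HK.alpha e φ i x)).ne'

theorem SmoothFun.lapseHat {z : M → ℝ} (hz : SmoothFun z) : SmoothFun (lapseHat q.et q.e q.φ z) :=
  (hz.sub (SmoothFun.sum fun i _ => (hq.et i).mul (SmoothFun.alpha hq he i))).div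
    (SmoothFun.sqrt_alphaSq hq he) (sqrt_alphaSq_ne_zero _ _)

theorem SmoothFun.shiftHat {z : M → ℝ} (hz : SmoothFun z) (i : Fin 3) :
    SmoothFun (shiftHat q.et q.e q.φ z i) :=
  (((hq.et i).add (hz.mul (SmoothFun.alpha hq he i))).sub (SmoothFun.sum fun j _ =>
    SmoothFun.sum fun k _ => ((SmoothFun.const (eps i j k)).mul (hq.et j)).mul
      (SmoothFun.alpha hq he k))).div (SmoothFun.sqrt_alphaSq hq he) (sqrt_alphaSq_ne_zero _ _)

theorem SmoothForm.hTriad (i : Fin 3) : SmoothForm (hTriad q.e q.φ i) := by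
  have h : HK.hTriad q.e q.φ i = HK.fmul (fun x => (Real.sqrt (1 + alphaSq q.e q.φ x))⁻¹)
      (∑ k, HK.fmul (fun x => kron i k + HK.alpha q.e q.φ i x * HK.alpha q.e q.φ k x
        + ∑ j, eps i j k * HK.alpha q.e q.φ j x) (q.e k)) := by
    funext x
    rw [HK.fmul, Finset.sum_apply]
    rfl
  rw [h]
  refine SmoothForm.fmul ((SmoothFun.sqrt_alphaSq hq he).inv (sqrt_alphaSq_ne_zero _ _))
    (SmoothForm.sum fun k _ => SmoothForm.fmul ?_ (hq.e k))
  exact ((SmoothFun.const (kron i k)).add ((SmoothFun.alpha hq he i).mul (SmoothFun.alpha hq he k))).add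
    (SmoothFun.sum fun j _ => (SmoothFun.const (eps i j k)).mul (SmoothFun.alpha hq he j))

end Smooth

section Flux

variable {q : Fields M} (hq : q.Smooth) (he : ∀ x, volOf q.e x ≠ 0)
include he

omit [IsManifold (𝓡 3) ∞ M] in
-- The 1-forms whose covariant differential drives H are the same whether written with e_t, Z_φ and
-- e or with the redefined shift, lapse and triad. This identity is the reason for the
-- redefinitions.
theorem crossFun_shiftHat_sub (z : M → ℝ) (i : Fin 3) :
    crossFun (shiftHat q.et q.e q.φ z) (hTriad q.e q.φ) i
      - fmul (lapseHat q.et q.e q.φ z) (hTriad q.e q.φ i) = shiftForm q i - fmul z (q.e i) := by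
  funext x
  obtain ⟨v, hv⟩ := exists_dualFrame (he x)
  refine ext_comp1 v fun m => ?_
  rw [Pi.sub_apply, hv.comp1_flux_diff]
  simp only [shiftForm, crossFun, Pi.add_apply, Pi.sub_apply, comp1_add, comp1_sub, comp1_fmul, hv _ _]

include hq

omit hq [IsManifold (𝓡 3) ∞ M] in
theorem grFlux_eq_cov1 (N : M → ℝ) (ν : Fin 3 → M → ℝ) (i : Fin 3) :
    grFlux (hTriad q.e q.φ) q.A q.At N ν i
      = cov1 q.A (crossFun ν (hTriad q.e q.φ)) i - cov1 q.A (fun i => fmul N (hTriad q.e q.φ i)) i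
        - crossFun q.At (HForm q.e q.φ) i := by
  have h1 : (fun i => ∑ j, ∑ k, eps i j k • fmul (ν j) (hTriad q.e q.φ k))
      = crossFun ν (hTriad q.e q.φ) := funext fun i => eps_fmul _ _ i
  have h2 : ∑ j, ∑ k, eps i j k • fmul (q.At j) (dual2 (hTriad q.e q.φ) k)
      = crossFun q.At (HForm q.e q.φ) i := by
    simp only [← HForm_eq_dual2 he]
    exact eps_fmul q.At (HForm q.e q.φ) i
  rw [grFlux, h1, h2]; rfl

theorem grFlux_eq {z : M → ℝ} (hz : SmoothFun z) (i : Fin 3) :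
    grFlux (hTriad q.e q.φ) q.A q.At (lapseHat q.et q.e q.φ z) (shiftHat q.et q.e q.φ z) i
      = cov1 q.A (shiftForm q) i - cov1 q.A (fun i => fmul z (q.e i)) i
        - crossFun q.At (HForm q.e q.φ) i := by
  have hh := SmoothForm.hTriad hq he
  rw [grFlux_eq_cov1 he, ← cov1_sub (SmoothForm.crossFun (SmoothFun.shiftHat hq he hz) hh)
      fun i => SmoothForm.fmul (SmoothFun.lapseHat hq he hz) (hh i),
    ← cov1_sub (SmoothForm.shiftForm hq) fun i => SmoothForm.fmul hz (hq.e i),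
    funext (crossFun_shiftHat_sub he z)]

omit he in
-- The algebraic part of this equation together with the term in dZ_φ contained in D(Z_φ e) is the
-- variation of H. The evolution of H is thus obtained without inverting any operator.
theorem eqA_eq_hamA_iff {Z : Fields M} (hZ : SmoothFun Z.φ) (i : Fin 3) : eqA q Z i = hamA q i ↔
    varH q Z i = cov1 q.A (shiftForm q) i - cov1 q.A (fun i => fmul Z.φ (q.e i)) i
        - crossFun q.At (HForm q.e q.φ) i := by
  have h : -(eqA q Z i - hamA q i) = varH q Z i - (cov1 q.A (shiftForm q) i
      - cov1 q.A (fun i => fmul Z.φ (q.e i)) i - crossFun q.At (HForm q.e q.φ) i) := by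
    rw [cov1_fmul hq.e hZ]
    funext x
    refine ext_comp2 stdFrame fun m => ?_
    simp only [eqA, hamA, varH, cross2, Pi.add_apply, Pi.sub_apply, Pi.neg_apply, comp2_add,
      comp2_sub, comp2_neg, comp2_wedge2]
    ring
  rw [← sub_eq_zero, ← neg_eq_zero, h, sub_eq_zero]

omit hq he [IsManifold (𝓡 3) ∞ M] in
theorem eqA_eq_opL (Z : Fields M) (i : Fin 3) :
    eqA q Z i = -opL 1 q.e (dFun q.φ) Z.e i - fmul Z.φ (cov1 q.A q.e i) := by
  rw [eqA, opL, one_smul, wedge2_comm (dFun q.φ), neg_add]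

end Flux

section Main

variable [T2Space M] [CompactSpace M] {vol0 : Form M 3} (hvol : SmoothForm vol0)
  (hv : ∀ x, vol0 x ≠ 0) {q : Fields M} (hq : q.Smooth) (he : ∀ x, volOf q.e x ≠ 0)
include hvol hv hq he

theorem isHamiltonianAt_iff_gr {Z : Fields M} (hZ : Z.Smooth) : IsHamiltonianAt vol0 q Z ↔
    SecondaryF q ∧ SecondaryT q ∧
      (∀ i, Z.A i = grConn (hTriad q.e q.φ) q.A q.At (lapseHat q.et q.e q.φ Z.φ)
          (shiftHat q.et q.e q.φ Z.φ) i + extraConn q.e q.A q.φ (lapseHat q.et q.e q.φ Z.φ) i) ∧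
      (∀ i, vary (fun p => HForm p.e p.φ i) q Z =
        grFlux (hTriad q.e q.φ) q.A q.At (lapseHat q.et q.e q.φ Z.φ)
          (shiftHat q.et q.e q.φ Z.φ) i) := by
  rw [isHamiltonianAt_iff hvol hv hq he hZ]
  refine and_congr_right fun hF => and_congr_right fun _ => and_congr ?_ ?_
  · exact eqE_eq_hamE_iff_grConn he ((secondaryF_iff q).1 hF)
  · refine forall_congr' fun i => ?_
    rw [vary_HForm hq hZ, grFlux_eq hq he hZ.φ, eqA_eq_hamA_iff hq hZ.φ]

/-- Z_{e_t} and Z_{A_t} do not occur in the equations, and Z_φ occurs only in the sources. Z_A and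
Z_e are then the unique preimages under opL(-1) and opL(1), smooth because the inverse preserves
smoothness. -/
theorem existsUnique_isHamiltonianAt (hF : SecondaryF q) (hT : SecondaryT q)
    {zet zAt : Fin 3 → M → ℝ} {zφ : M → ℝ} (hzet : ∀ i, SmoothFun (zet i))
    (hzAt : ∀ i, SmoothFun (zAt i)) (hzφ : SmoothFun zφ) :
    ∃! Z : Fields M, Z.Smooth ∧ Z.et = zet ∧ Z.At = zAt ∧ Z.φ = zφ ∧ IsHamiltonianAt vol0 q Z := by
  have hFs := SmoothForm.curv hq.A
  have h1 : ∀ i, SmoothForm (fmul zφ (curv q.A i) + crossFun q.et (curv q.A) i) := fun i =>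
    (SmoothForm.fmul hzφ (hFs i)).add (SmoothForm.crossFun hq.et hFs i)
  have h2 : ∀ i, SmoothForm (-hamA q i - fmul zφ (cov1 q.A q.e i)) := fun i =>
    (SmoothForm.hamA hq i).neg.sub (SmoothForm.fmul hzφ (SmoothForm.cov1 hq.A hq.e i))
  have hA : ∀ (Z : Fields M), Z.φ = zφ → ((∀ i, eqA q Z i = hamA q i) ↔
      ∀ i, opL 1 q.e (dFun q.φ) Z.e i = -hamA q i - fmul zφ (cov1 q.A q.e i)) := fun Z hZ =>
    forall_congr' fun i => by
      rw [eqA_eq_opL, hZ]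
      constructor
      · intro h; rw [← h]; abel
      · intro h; rw [h]; abel
  let Z0 : Fields M := ⟨zet, invL 1 q.e (dFun q.φ) fun i => -hamA q i - fmul zφ (cov1 q.A q.e i), zAt,
    fun i => covFun q.A q.At i + invL (-1) q.e (dFun q.φ)
      (fun i => fmul zφ (curv q.A i) + crossFun q.et (curv q.A) i) i, zφ⟩
  have hZ0 : Z0.Smooth :=
    ⟨hzet, SmoothForm.invL hq.e he 1 (SmoothForm.dFun hq.φ) h2, hzAt, fun i =>
      (SmoothForm.covFun hq.A hq.At i).add
        (SmoothForm.invL hq.e he (-1) (SmoothForm.dFun hq.φ) h1 i), hzφ⟩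
  have hE0 : ∀ i, eqE q Z0 i = hamE q i := fun i => by
    rw [eqE_eq_hamE_iff]
    simp only [Z0, add_sub_cancel_left]
    exact opL_invL (by norm_num) he _ _ i
  have hA0 : ∀ i, eqA q Z0 i = hamA q i := (hA Z0 rfl).2 fun i => opL_invL (by norm_num) he _ _ i
  refine ⟨Z0, ⟨hZ0, rfl, rfl, rfl, (isHamiltonianAt_iff hvol hv hq he hZ0).2 ⟨hF, hT, hE0, hA0⟩⟩, ?_⟩
  rintro Z ⟨hZ, het, hAt, hφ, hH⟩
  obtain ⟨-, -, hE1, hA1⟩ := (isHamiltonianAt_iff hvol hv hq he hZ).1 hH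
  have k1 : Z.A = Z0.A := funext fun i => by
    refine sub_left_injective (opL_injective (s := -1) (by norm_num) he (p := dFun q.φ)
      (w := fun i => Z.A i - covFun q.A q.At i) (z := fun i => Z0.A i - covFun q.A q.At i)
      (fun i => ?_) i)
    rw [(eqE_eq_hamE_iff i).1 (hE1 i), (eqE_eq_hamE_iff i).1 (hE0 i), hφ]
  have k2 : Z.e = Z0.e := funext fun i => by
    refine opL_injective (s := 1) (by norm_num) he (p := dFun q.φ) (fun i => ?_) i
    rw [(hA Z hφ).1 hA1 i, (hA Z0 rfl).1 hA0 i]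
  cases Z
  simp only at het hAt hφ k1 k2
  subst het hAt hφ
  rw [k1, k2]

end Main

end

/-! ### Contractions, covariant Cartan formulas and vector fields from coframes -/

section

section Inner

variable {M : Type*} (ξ : VF M)

theorem inner1_add2 (a b : Form M 2) : inner1 ξ (a + b) = inner1 ξ a + inner1 ξ b := by
  funext x
  refine ext_comp1 stdFrame fun m => ?_
  simp only [Pi.add_apply, comp1_add, comp1_inner1, comp2_add]
  ring

theorem inner1_sub2 (a b : Form M 2) : inner1 ξ (a - b) = inner1 ξ a - inner1 ξ b := by
  funext x
  refine ext_comp1 stdFrame fun m => ?_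
  simp only [Pi.sub_apply, comp1_sub, comp1_inner1, comp2_sub]
  ring

theorem inner1_wedge2 (a b : Form M 1) :
    inner1 ξ (wedge2 a b) = fmul (ev ξ a) b - fmul (ev ξ b) a := by
  funext x
  refine ext_comp1 stdFrame fun m => ?_
  rw [comp1_inner1, Pi.sub_apply, comp1_sub, comp1_fmul, comp1_fmul, ev_eq stdFrame, ev_eq stdFrame,
    comp2_wedge2, comp2_wedge2, sum_cyclic _ m, sum_cyclic _ m]
  simp only [add_assoc, Fin.isValue, Fin.reduceAdd, add_zero]
  ring

theorem inner1_wedge3 (a : Form M 1) (B : Form M 2) :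
    inner1 ξ (wedge3 a B) = fmul (ev ξ a) B - wedge2 a (inner1 ξ B) := by
  funext x
  refine ext_comp2 stdFrame fun m => ?_
  rw [comp2_inner1, Pi.sub_apply, comp2_sub, comp2_fmul, ev_eq stdFrame,
    comp2_wedge2, comp1_inner1, comp1_inner1, comp3_wedge3, sum_cyclic _ m, sum_cyclic _ m]
  simp only [add_assoc, Fin.isValue, Fin.reduceAdd, add_zero]
  ring

theorem inner1_add3 (a b : Form M 3) : inner1 ξ (a + b) = inner1 ξ a + inner1 ξ b := by
  funext x
  refine ext_comp2 stdFrame fun m => ?_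
  simp only [Pi.add_apply, comp2_add, comp2_inner1, comp3_add]
  ring

theorem inner1_sub3 (a b : Form M 3) : inner1 ξ (a - b) = inner1 ξ a - inner1 ξ b := by
  funext x
  refine ext_comp2 stdFrame fun m => ?_
  simp only [Pi.sub_apply, comp2_sub, comp2_inner1, comp3_sub]
  ring

theorem inner1_zero3 : inner1 ξ (0 : Form M 3) = 0 := by
  funext x
  refine ext_comp2 stdFrame fun m => ?_
  rw [comp2_inner1, Pi.zero_apply, Pi.zero_apply, comp3_zero, comp2_zero, mul_zero]

variable {ξ} in
theorem eq_of_inner1_vol {X : VF M} {vol0 : Form M 3} (hv : ∀ x, vol0 x ≠ 0)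
    (h : inner1 ξ vol0 = inner1 X vol0) : ξ = X := by
  funext x
  refine stdFrame.ext_elem fun i => ?_
  have h1 := congrArg (fun b => comp2 stdFrame b i) (congrFun h x)
  simp only [comp2_inner1] at h1
  exact mul_right_cancel₀ (comp3_ne_zero stdFrame (hv x)) h1

end Inner

section Cartan

variable {M : Type*} [TopologicalSpace M] [ChartedSpace E3 M] [IsManifold (𝓡 3) ∞ M]
  {ξ : VF M} (hξ : SmoothVF ξ) {A : Fin 3 → Form M 1} (hA : ∀ i, SmoothForm (A i))
  {At : Fin 3 → M → ℝ}
include hξ hA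

/-- The differential of ξ ⌟ A from Cartan's formula cancels that of the gauge parameter, and the
remaining terms quadratic in A complete ξ ⌟ dA to ξ ⌟ F. -/
theorem hkConn_eq (hAt : ∀ i, SmoothFun (At i)) (i : Fin 3) :
    hkConn ξ A At i = covFun A At i + inner1 ξ (curv A i) := by
  have h1 : lieForm ξ (A i) = dFun (ev ξ (A i)) + inner1 ξ (d1 (A i)) := lieForm1 hξ (hA i)
  have h2 : dFun (gaugePar ξ A At i) = dFun (At i) - dFun (ev ξ (A i)) :=
    dFun_sub (hAt i) (SmoothFun.ev hξ (hA i))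
  rw [hkConn, h1, covFun_eq, h2, covFun_eq, curv_eq, inner1_add2, inner1_wedge2]
  funext x
  refine ext_comp1 stdFrame fun m => ?_
  simp only [crossFun, gaugePar, Pi.add_apply, Pi.sub_apply, comp1_add, comp1_sub, comp1_fmul]
  ring

omit hA in
-- Cartan's formula with D in place of d: the part of the gauge rotation with parameter ξ ⌟ A
-- supplies the connection terms. `hkForm_eq2` is its analogue for 2-forms.
theorem hkForm_eq1 {b : Fin 3 → Form M 1} (hb : ∀ i, SmoothForm (b i)) (i : Fin 3) :
    hkForm ξ A At b i = covFun A (fun i => ev ξ (b i)) i + inner1 ξ (cov1 A b i) - crossFun At b i := by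
  have h1 : lieForm ξ (b i) = dFun (ev ξ (b i)) + inner1 ξ (d1 (b i)) := lieForm1 hξ (hb i)
  rw [hkForm, eps_fmul, h1, covFun_eq, cov1_eq, inner1_add2, cross2, inner1_sub2, inner1_wedge2,
    inner1_wedge2]
  funext x
  refine ext_comp1 stdFrame fun m => ?_
  simp only [crossFun, gaugePar, Pi.add_apply, Pi.sub_apply, comp1_add, comp1_sub, comp1_fmul]
  ring

omit hA in
theorem hkForm_eq2 {B : Fin 3 → Form M 2} (hB : ∀ i, SmoothForm (B i)) (i : Fin 3) :
    hkForm ξ A At B i = cov1 A (fun i => inner1 ξ (B i)) i + inner1 ξ (cov2 A B i)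
      - crossFun At B i := by
  have h1 : lieForm ξ (B i) = d1 (inner1 ξ (B i)) + inner1 ξ (d2 (B i)) := lieForm2 hξ (hB i)
  rw [hkForm, eps_fmul, h1, cov1_eq, cov2_eq, inner1_add3, cross3, inner1_sub3, inner1_wedge3,
    inner1_wedge3]
  funext x
  refine ext_comp2 stdFrame fun m => ?_
  simp only [crossFun, cross2, gaugePar, Pi.add_apply, Pi.sub_apply, comp2_add, comp2_sub, comp2_fmul,
    comp2_wedge2]
  ring

end Cartan

section Vector

variable {M : Type*} {e : Fin 3 → Form M 1}

/-- The vector field with given components in the frame dual to a coframe. -/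
def vecOf (e : Fin 3 → Form M 1) (g : Fin 3 → M → ℝ) : VF M :=
  dualVec (volOf e) (∑ i, fmul (g i) (wedge2 (e (i + 1)) (e (i + 2))))

theorem DualFrame.ev_coframe {x : M} {v : Frame} (hv : DualFrame v e x) (ξ : VF M) (i : Fin 3) :
    ev ξ (e i) x = v.repr (ξ x) i := by
  rw [ev_eq v, sum_cyclic _ i]
  simp only [hv _ _, kron_self, kron_01, kron_02]
  ring

theorem DualFrame.repr_vecOf {x : M} {v : Frame} (hv : DualFrame v e x) (g : Fin 3 → M → ℝ)
    (i : Fin 3) : v.repr (vecOf e g x) i = g i x := by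
  rw [vecOf, repr_dualVec, hv.comp3_volOf, Finset.sum_apply, comp2_sum, sum_cyclic _ i]
  simp only [comp2_fmul, comp2_wedge2, hv _ _, kron_self, kron_01, kron_02, kron_10, kron_12,
    kron_20, kron_21, add_assoc, Fin.isValue, Fin.reduceAdd, add_zero]
  ring

theorem ev_vecOf (he : ∀ x, volOf e x ≠ 0) (g : Fin 3 → M → ℝ) (i : Fin 3) :
    ev (vecOf e g) (e i) = g i := by
  funext x
  obtain ⟨v, hv⟩ := exists_dualFrame (he x)
  rw [hv.ev_coframe, hv.repr_vecOf]

theorem eq_of_ev_coframe (he : ∀ x, volOf e x ≠ 0) {ξ X : VF M}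
    (h : ∀ i, ev ξ (e i) = ev X (e i)) : ξ = X := by
  funext x
  obtain ⟨v, hv⟩ := exists_dualFrame (he x)
  refine v.ext_elem fun i => ?_
  rw [← hv.ev_coframe, h, hv.ev_coframe]

theorem existsUnique_ev_coframe [TopologicalSpace M] [ChartedSpace E3 M] [IsManifold (𝓡 3) ∞ M]
    (hes : ∀ i, SmoothForm (e i)) (he : ∀ x, volOf e x ≠ 0) {g : Fin 3 → M → ℝ}
    (hg : ∀ i, SmoothFun (g i)) : ∃! ξ : VF M, SmoothVF ξ ∧ ∀ i, ev ξ (e i) = g i :=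
  ⟨vecOf e g, ⟨SmoothVF.dualVec (smooth_volOf hes) he (SmoothForm.sum fun i _ =>
    SmoothForm.fmul (hg i) ((hes _).wedge2 (hes _))), ev_vecOf he g⟩,
    fun _ h => eq_of_ev_coframe he fun i => (h.2 i).trans (ev_vecOf he g i).symm⟩

theorem inner1_dual2 (ξ : VF M) (e : Fin 3 → Form M 1) (i : Fin 3) :
    inner1 ξ (dual2 e i) = crossFun (fun i => ev ξ (e i)) e i := by
  rw [dual2_eq, inner1_wedge2, crossFun]

/-- Expanded in the coframe, ξ ⌟ F is the cross product of the components of F and ξ; this removes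
the shift in favour of ξ. -/
theorem shiftTerm_eq_inner1 (he : ∀ x, volOf e x ≠ 0) (F : Fin 3 → Form M 2) (ξ : VF M)
    {ν : Fin 3 → M → ℝ} (h : ∀ i, ev ξ (e i) = ν i) (i : Fin 3) :
    ∑ j, ∑ k, ∑ l, eps k j l • fmul (fun x => matOf F e i j x * ν l x) (e k) = inner1 ξ (F i) := by
  funext x
  obtain ⟨v, hv⟩ := exists_dualFrame (he x)
  refine ext_comp1 v fun m => ?_
  simp only [Finset.sum_apply, comp1_sum, Pi.smul_apply, comp1_smul, comp1_fmul, ← h, hv.ev_coframe,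
    matOf_eq_coef2, hv.coef2_eq, hv _ _]
  rw [comp1_inner1]
  have h1 := sum_eps_mul (comp2 v (F i x)) (fun l => v.repr (ξ x) l) m
  have h2 : ∀ j, ∑ k, ∑ l, eps k j l * (comp2 v (F i x) j * v.repr (ξ x) l * kron k m)
      = comp2 v (F i x) j * ∑ l, eps m j l * v.repr (ξ x) l := fun j => by
    rw [sum_cyclic _ m]
    simp only [kron_self, kron_10, kron_20, Fin.sum_univ_three]
    ring
  rw [Finset.sum_congr rfl fun j _ => h2 j, h1]
  ring

end Vector

section Ashtekar

variable {M : Type*} [TopologicalSpace M] [ChartedSpace E3 M] [IsManifold (𝓡 3) ∞ M]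
  {q : Fields M} (hq : q.Smooth) (he : ∀ x, volOf q.e x ≠ 0) {ξ : VF M} (hξ : SmoothVF ξ)
  {ν : Fin 3 → M → ℝ} (hν : ∀ i, ev ξ (hTriad q.e q.φ i) = ν i) (N : M → ℝ) (i : Fin 3)
include hq he hξ hν

theorem grConn_eq_hkConn :
    grConn (hTriad q.e q.φ) q.A q.At N ν i = hkConn ξ q.A q.At i
      - ∑ j, fmul (fun x => N x * matOf (curv q.A) (hTriad q.e q.φ) i j x) (hTriad q.e q.φ j) := by
  rw [grConn, shiftTerm_eq_inner1 (fun x => volOf_hTriad_ne_zero q.φ (he x)) (curv q.A) ξ hν,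
    hkConn_eq hξ hq.A hq.At]
  abel

/-- The shift term is D(ξ ⌟ H). Cartan's formula adds ξ ⌟ DH, which is zero by (T). -/
theorem grFlux_eq_hkForm (hT : SecondaryT q) :
    grFlux (hTriad q.e q.φ) q.A q.At N ν i = hkForm ξ q.A q.At (HForm q.e q.φ) i
      - cov q.A (fun j => fmul N (hTriad q.e q.φ j)) i := by
  have h1 : (fun i => inner1 ξ (HForm q.e q.φ i)) = crossFun ν (hTriad q.e q.φ) := by
    funext i
    rw [HForm_eq_dual2 he, inner1_dual2, funext hν]
  rw [grFlux_eq_cov1 he, hkForm_eq2 hξ (SmoothForm.HForm hq.e hq.φ), h1, cov2_HForm hq,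
    (secondaryT_iff q).1 hT i, neg_zero, inner1_zero3, add_zero]
  show _ = _ - cov1 q.A (fun j => fmul N (hTriad q.e q.φ j)) i
  abel

end Ashtekar

end

/-! ### Recovering e from h and dφ; the case Z_φ = e_t · α -/

section

section Matrices

/-- For Z_φ = e_t · α the redefined shift is the matrix of h applied to e_t, so one vector field has
components e_t in e and ê in h. -/
theorem shiftMat_eq_sum (a t : Fin 3 → ℝ) (i : Fin 3) :
    shiftMat a t (∑ k, t k * a k) i = ∑ m, t m * triadMat a i m := by
  rw [sum_cyclic _ i, sum_cyclic _ i]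
  simp only [shiftMat, triadMat, fluxMat_self, fluxMat_01, fluxMat_02]
  ring

theorem sum_fluxMat_triadMat (a : Fin 3 → ℝ) (i m : Fin 3) :
    triadMat a i m + a (i + 2) * triadMat a (i + 1) m - a (i + 1) * triadMat a (i + 2) m
      = (1 + ∑ k, a k ^ 2) * kron i m := by
  refine cyclic_cases i ?_ ?_ ?_ m <;>
  simp only [triadMat, fun f : Fin 3 → ℝ => sum_cyclic f i, kron_self, kron_01, kron_02,
    fluxMat_self, fluxMat_01, fluxMat_02, fluxMat_10, fluxMat_12,
    fluxMat_20, fluxMat_21, add_assoc, Fin.isValue, Fin.reduceAdd, add_zero] <;>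
  ring

end Matrices

section Inverse

variable {M : Type*} [TopologicalSpace M] [ChartedSpace E3 M]

/-- The coframe written in terms of the auxiliary triad `h` and `dφ`. -/
def coframeOf (h : Fin 3 → Form M 1) (p : Form M 1) (i : Fin 3) : Form M 1 := fun x =>
  Real.sqrt (1 - ∑ k, coef h p k x ^ 2) • h i x
    + (coef h p (i + 2) x • h (i + 1) x - coef h p (i + 1) x • h (i + 2) x)

/-- The 2-forms built from h are H, whose matrix fixes the vector a, and vol_h supplies the
denominator. -/
theorem DualFrame.coef_hTriad {e : Fin 3 → Form M 1} {x : M} {v : Frame} (hv : DualFrame v e x)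
    (he : ∀ x, volOf e x ≠ 0) (φ : M → ℝ) (k : Fin 3) :
    coef (hTriad e φ) (dFun φ) k x
      = comp1 v (dFun φ x) k / Real.sqrt (1 + ∑ k, comp1 v (dFun φ x) k ^ 2) := by
  rw [coef, ← dual2_eq, ← HForm_eq_dual2 he, ratio_eq v, hv.comp3_volOf_hTriad, comp3_wedge3]
  simp only [hv.comp2_HForm]
  rw [← sum_fluxMat_mul (comp1 v (dFun φ x)) k]
  congr 1
  exact Finset.sum_congr rfl fun m _ => mul_comm _ _

/-- With c = a/√(1 + a²) one has 1 - c² = 1/(1 + a²), so √(1 + a²), and with it the matrix inverse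
to that of h, can be expressed by quantities known from h and dφ. -/
theorem coframe_eq {e : Fin 3 → Form M 1} (he : ∀ x, volOf e x ≠ 0) (φ : M → ℝ) (i : Fin 3) :
    e i = coframeOf (hTriad e φ) (dFun φ) i := by
  funext x
  obtain ⟨v, hv⟩ := exists_dualFrame (he x)
  refine ext_comp1 v fun m => ?_
  rw [coframeOf, comp1_add, comp1_sub, comp1_smul, comp1_smul, comp1_smul]
  simp only [hv.coef_hTriad he, hv.comp1_hTriad, hv _ _]
  have h1 := sum_fluxMat_triadMat (comp1 v (dFun φ x)) i m
  set a := comp1 v (dFun φ x)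
  have h2 := sqrt_pos_of a
  have h3 := sqrt_sq_of a
  have h4 : 1 - ∑ k, (a k / Real.sqrt (1 + ∑ k, a k ^ 2)) ^ 2
      = (Real.sqrt (1 + ∑ k, a k ^ 2))⁻¹ ^ 2 := by
    simp only [div_pow, ← Finset.sum_div]
    rw [h3, inv_pow, h3]
    have := (one_add_sum_sq_pos a).ne'
    field_simp
    ring
  rw [h4, Real.sqrt_sq (inv_pos.2 h2).le]
  rw [← h3] at h1
  set S := Real.sqrt (1 + ∑ k, a k ^ 2)
  have := h2.ne'
  field_simp
  linear_combination -h1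

/-- H̃ determines h, and h with dφ determines e; the other fields are components of J. -/
theorem injOn_J [IsManifold (𝓡 3) ∞ M] (vol0 : Form M 3) : Set.InjOn (J vol0) (M0 vol0) := by
  intro q hq p hp h
  have he := fun x => volOf_ne_zero_of_ratio (hq.2 x).ne'
  have he' := fun x => volOf_ne_zero_of_ratio (hp.2 x).ne'
  have hφ : q.φ = p.φ := congrArg CanFields.φ h
  have hH : (J vol0 q).Ht = (J vol0 p).Ht := congrArg CanFields.Ht h
  have ht : hTriad q.e q.φ = hTriad p.e p.φ := funext fun i => by
    rw [hTriad_eq_triadOfHt he q.φ hq.2, hTriad_eq_triadOfHt he' p.φ hp.2]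
    exact congrArg (fun X => triadOfHt vol0 X i) hH
  have hee : q.e = p.e := funext fun i => by
    rw [coframe_eq he q.φ i, coframe_eq he' p.φ i, ht, hφ]
  have h1 : q.et = p.et := congrArg CanFields.et h
  have h2 : q.At = p.At := congrArg CanFields.At h
  have h3 : q.A = p.A := congrArg CanFields.A h
  cases q
  cases p
  simp only at h1 h2 h3 hee hφ
  rw [h1, h2, h3, hee, hφ]

end Inverse

section Standard

variable {M : Type*} [TopologicalSpace M] [ChartedSpace E3 M]
  {q : Fields M} (he : ∀ x, volOf q.e x ≠ 0) {ξ : VF M}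

theorem lapseHat_etAlpha (q : Fields M) : lapseHat q.et q.e q.φ (etAlpha q.et q.e q.φ) = 0 := by
  funext x
  rw [lapseHat, sub_self, zero_div]
  rfl

include he

theorem etAlpha_eq_ev (hξ : ∀ i, ev ξ (q.e i) = q.et i) : etAlpha q.et q.e q.φ = ev ξ (dFun q.φ) := by
  funext x
  obtain ⟨v, hv⟩ := exists_dualFrame (he x)
  rw [hv.etAlpha_eq, ev_eq v]
  simp only [← hξ, hv.ev_coframe]

theorem ev_hTriad_of_ev (hξ : ∀ i, ev ξ (q.e i) = q.et i) (i : Fin 3) :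
    ev ξ (hTriad q.e q.φ i) = shiftHat q.et q.e q.φ (etAlpha q.et q.e q.φ) i := by
  funext x
  obtain ⟨v, hv⟩ := exists_dualFrame (he x)
  rw [hv.shiftHat_eq, hv.etAlpha_eq, shiftMat_eq_sum, ev_eq v, Finset.sum_div]
  refine Finset.sum_congr rfl fun m _ => ?_
  rw [hv.comp1_hTriad, ← hv.ev_coframe, hξ]
  ring

/-- For the converse, the vector field with components e_t in e also has components ê in h, and a
vector field is determined by its values on the coframe h. -/
theorem ev_iff_ev_hTriad : (∀ i, ev ξ (q.e i) = q.et i) ↔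
    ∀ i, ev ξ (hTriad q.e q.φ i) = shiftHat q.et q.e q.φ (etAlpha q.et q.e q.φ) i := by
  refine ⟨ev_hTriad_of_ev he, fun h => ?_⟩
  have h1 : ξ = vecOf q.e q.et := eq_of_ev_coframe (fun x => volOf_hTriad_ne_zero q.φ (he x)) fun i =>
    (h i).trans (ev_hTriad_of_ev he (ev_vecOf he q.et) i).symm
  rw [h1]
  exact ev_vecOf he q.et

variable [IsManifold (𝓡 3) ∞ M] (hq : q.Smooth) (hξs : SmoothVF ξ)
  (hξ : ∀ i, ev ξ (q.e i) = q.et i)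
include hq hξs hξ

/-- The Lie-dragged, rotated coframe solves the equation for Z_e with Z_φ = ξ ⌟ dφ. Injectivity of
opL(1) then identifies it with the actual Z_e. -/
theorem opL_hkForm (hT : SecondaryT q) (i : Fin 3) :
    opL 1 q.e (dFun q.φ) (hkForm ξ q.A q.At q.e) i
      = -hamA q i - fmul (ev ξ (dFun q.φ)) (cov1 q.A q.e i) := by
  have h1 : cov1 q.A (shiftForm q) i = cross2 (covFun q.A q.et) q.e i
      + crossFun q.et (cov1 q.A q.e) i + wedge2 (covFun q.A q.et i) (dFun q.φ) := by
    have h2 : shiftForm q = fun i => crossFun q.et q.e i + fmul (q.et i) (dFun q.φ) := rfl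
    have h3 : ∀ i, SmoothForm (fmul (q.et i) (dFun q.φ)) := fun i =>
      SmoothForm.fmul (hq.et i) (SmoothForm.dFun hq.φ)
    rw [h2, cov1_add (SmoothForm.crossFun hq.et hq.e) h3, cov1_crossFun hq.A hq.e hq.et]
    congr 1
    rw [cov1_eq, d1_fmul (hq.et i) (SmoothForm.dFun hq.φ), d1_dFun hq.φ, covFun_eq]
    funext x
    refine ext_comp2 stdFrame fun m => ?_
    simp only [cross2, crossFun, Pi.add_apply, Pi.sub_apply, comp2_add, comp2_sub, comp2_fmul,
      comp2_wedge2, comp1_sub, comp1_fmul, Pi.zero_apply, comp2_zero]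
    ring
  -- The contraction of (T) with ξ, where ξ ⌟ e = e_t. This is the only use of the constraint.
  have h4 : crossFun q.et (cov1 q.A q.e) i - cross2 q.e (fun i => inner1 ξ (cov1 q.A q.e i)) i
      - (fmul (ev ξ (dFun q.φ)) (cov1 q.A q.e i)
        - wedge2 (dFun q.φ) (inner1 ξ (cov1 q.A q.e i))) = 0 := by
    have h5 := congrArg (inner1 ξ) ((secondaryT_iff q).1 hT i)
    rw [constrT, inner1_sub3, cross3, inner1_sub3, inner1_wedge3, inner1_wedge3, inner1_wedge3,
      hξ, hξ, inner1_zero3] at h5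
    rw [← h5, crossFun, cross2]
    abel
  have h6 : hkForm ξ q.A q.At q.e = fun i => covFun q.A q.et i + inner1 ξ (cov1 q.A q.e i)
      - crossFun q.At q.e i := funext fun i => by
    rw [hkForm_eq1 hξs hq.e, funext hξ]
  rw [hamA, h1, h6]
  funext x
  refine ext_comp2 stdFrame fun m => ?_
  have h7 := congrArg (fun b => comp2 stdFrame b m) (congrFun h4 x)
  simp only [opL, cross2, crossFun, HForm_eq, one_smul, Pi.add_apply, Pi.sub_apply, Pi.neg_apply,
    Pi.zero_apply, comp2_zero, comp2_add, comp2_sub, comp2_neg, comp2_fmul, comp2_wedge2, comp1_add,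
    comp1_sub, comp1_fmul, add_assoc, Fin.isValue, Fin.reduceAdd, add_zero] at h7 ⊢
  linear_combination -h7

end Standard

end

/-! ### Dynamics in terms of ξ, and the standard Husain–Kuchař model -/

section

section Standard

variable {M : Type*} [TopologicalSpace M] [ChartedSpace E3 M]

theorem zero_fmul {k : ℕ} (b : Form M k) : fmul (0 : M → ℝ) b = 0 := by
  funext x; exact zero_smul ℝ (b x)

theorem extraConn_zero (e A : Fin 3 → Form M 1) (φ : M → ℝ) (i : Fin 3) :
    extraConn e A φ 0 i = 0 := by
  funext x
  refine ext_comp1 stdFrame fun m => ?_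
  simp only [extraConn, Pi.zero_apply, zero_mul, zero_smul, Finset.sum_const_zero]

theorem lapseTerm_zero (F : Fin 3 → Form M 2) (h : Fin 3 → Form M 1) (i : Fin 3) :
    ∑ j, fmul (fun x => (0 : M → ℝ) x * matOf F h i j x) (h j) = 0 := by
  have : ∀ j, (fun x => (0 : M → ℝ) x * matOf F h i j x) = 0 := fun j =>
    funext fun x => zero_mul _
  simp only [this, zero_fmul, Finset.sum_const_zero]

variable [IsManifold (𝓡 3) ∞ M]

theorem cov_zero_fmul (A h : Fin 3 → Form M 1) (hh : ∀ i, SmoothForm (h i)) (i : Fin 3) :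
    cov A (fun j => fmul (0 : M → ℝ) (h j)) i = 0 := by
  -- Writing 0 as h_j - h_j turns the claim into additivity of D.
  have h1 : (fun j => fmul (0 : M → ℝ) (h j)) = fun j => h j - h j :=
    funext fun j => by rw [zero_fmul, sub_self]
  rw [h1]
  exact (cov1_sub hh hh i).trans (sub_self _)

variable {vol0 : Form M 3} (hvol : SmoothForm vol0) (hv : ∀ x, vol0 x ≠ 0)
include hvol hv

/-- Contraction with the volume form turns the law for vector fields into the law for 2-forms. The
divergence term is the effect of the Lie derivative on the volume form itself. -/
theorem inner1_hkVec {ξ : VF M} (hξ : SmoothVF ξ) (A : Fin 3 → Form M 1) (At : Fin 3 → M → ℝ)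
    {B : Fin 3 → Form M 2} (hB : ∀ i, SmoothForm (B i)) (i : Fin 3) :
    inner1 (hkVec vol0 ξ A At (fun i => dualVec vol0 (B i)) i) vol0 = hkForm ξ A At B i := by
  have h1 := lieForm_inner1_vol hξ (SmoothVF.dualVec hvol hv (hB i)) hvol hv
  rw [inner1_dualVec hv] at h1
  rw [hkForm, eps_fmul, h1]
  funext x
  refine ext_comp2 stdFrame fun m => ?_
  have h0 := comp3_ne_zero stdFrame (hv x)
  have h2 := eps_sum i fun j k => gaugePar ξ A At j x • dualVec vol0 (B k) x
  simp only [smul_smul] at h2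
  simp only [hkVec, crossFun, Pi.sub_apply, comp2_sub, comp2_fmul, comp2_inner1, h2, map_sub, map_smul,
    Finsupp.sub_apply, Finsupp.smul_apply, repr_dualVec, smul_eq_mul]
  field_simp

variable [T2Space M] [CompactSpace M] {q : Fields M} (hq : q.Smooth) (he : ∀ x, volOf q.e x ≠ 0)
  {Z : Fields M} (hZ : Z.Smooth) (hH : IsHamiltonianAt vol0 q Z)
include hq he hZ hH

theorem vary_HForm_eq_inner1 (i : Fin 3) :
    vary (fun p => HForm p.e p.φ i) q Z = inner1 ((TJ vol0 q Z).Ht i) vol0 := by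
  rw [vary_HForm hq hZ, TJ_eq vol0 hq hZ, inner1_dualVec hv]

variable {ξ : VF M} (hξs : SmoothVF ξ)
include hξs

theorem hamiltonian_eq_hk (hξ : ∀ i, ev ξ (hTriad q.e q.φ i) = shiftHat q.et q.e q.φ Z.φ i) :
    (∀ i, Z.A i = hkConn ξ q.A q.At i
      - (∑ j, fmul (fun x => lapseHat q.et q.e q.φ Z.φ x *
          matOf (curv q.A) (hTriad q.e q.φ) i j x) (hTriad q.e q.φ j))
      + extraConn q.e q.A q.φ (lapseHat q.et q.e q.φ Z.φ) i) ∧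
    (∀ i, vary (fun p => HForm p.e p.φ i) q Z = hkForm ξ q.A q.At (HForm q.e q.φ) i
        - cov q.A (fun j => fmul (lapseHat q.et q.e q.φ Z.φ) (hTriad q.e q.φ j)) i) := by
  obtain ⟨-, hT, h1, h2⟩ := (isHamiltonianAt_iff_gr hvol hv hq he hZ).1 hH
  refine ⟨fun i => ?_, fun i => ?_⟩
  · rw [h1, grConn_eq_hkConn hq he hξs hξ]
  · rw [h2, grFlux_eq_hkForm hq he hξs hξ _ _ hT]

theorem hamiltonian_eq_standard (hφ : Z.φ = etAlpha q.et q.e q.φ)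
    (hξ : ∀ i, ev ξ (q.e i) = q.et i) :
    (∀ i, Z.A i = hkConn ξ q.A q.At i) ∧
    (∀ i, vary (fun p => HForm p.e p.φ i) q Z = hkForm ξ q.A q.At (HForm q.e q.φ) i) ∧
    (∀ i, (TJ vol0 q Z).Ht i = hkVec vol0 ξ q.A q.At (J vol0 q).Ht i) ∧
    (∀ i, Z.e i = hkForm ξ q.A q.At q.e i) ∧
    Z.φ = ev ξ (dFun q.φ) := by
  obtain ⟨-, hT, -, h2⟩ := (isHamiltonianAt_iff hvol hv hq he hZ).1 hH
  have hφ' := hφ.trans (etAlpha_eq_ev he hξ)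
  obtain ⟨h3, h4⟩ := hamiltonian_eq_hk hvol hv hq he hZ hH hξs (by
    rw [hφ]; exact ev_hTriad_of_ev he hξ)
  have h5 : ∀ i, vary (fun p => HForm p.e p.φ i) q Z = hkForm ξ q.A q.At (HForm q.e q.φ) i :=
    fun i => by
      rw [h4, hφ, lapseHat_etAlpha, cov_zero_fmul _ _ (SmoothForm.hTriad hq he), sub_zero]
  refine ⟨fun i => ?_, h5, fun i => ?_, fun i => ?_, hφ'⟩
  · rw [h3, hφ, lapseHat_etAlpha, lapseTerm_zero, extraConn_zero, sub_zero, add_zero]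
  -- A vector field is determined by its contraction with the volume form, so the law for H̃ follows
  -- from the one for H.
  · refine eq_of_inner1_vol hv ?_
    rw [← vary_HForm_eq_inner1 hvol hv hq he hZ hH, h5]
    exact (inner1_hkVec hvol hv hξs q.A q.At (SmoothForm.HForm hq.e hq.φ) i).symm
  -- Z_e solves the same linear equation as the proposed expression, and that equation has a unique
  -- solution.
  · refine opL_injective (s := 1) (by norm_num) he (p := dFun q.φ) (fun i => ?_) i
    rw [opL_hkForm he hq hξs hξ hT, ← h2, eqA_eq_opL, hφ']
    abel

end Standard

end

end HK
end

theorem mainTheorem2 {M : Type*} [TopologicalSpace M] [ChartedSpace E3 M] [T2Space M]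
    [CompactSpace M] [IsManifold (𝓡 3) ∞ M]
    (vol0 : Form M 3) (hvol0 : SmoothForm vol0) (hvol0_ne : ∀ x, vol0 x ≠ 0) :
    -- `J` embeds `M₀` into `Γ̃`
    (∀ q ∈ M0 vol0, (J vol0 q).Smooth) ∧
    Set.InjOn (J vol0) (M0 vol0) ∧
    -- the presymplectic form takes canonical form
    (∀ q ∈ M0 vol0, ∀ Z Y : Fields M, Z.Smooth → Y.Smooth →
      omega vol0 q Z Y = omegaExpanded vol0 q Z Y ∧
      omega vol0 q Z Y = omegaCan vol0 (TJ vol0 q Z) (TJ vol0 q Y)) ∧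
    -- the constraints
    (∀ q ∈ M0 vol0, ∀ p : M → ℝ, SmoothFun p →
      ((p = piTilde vol0 q ∧ SecondaryF q ∧ SecondaryT q) ↔
        (ScalarConstraint vol0 { J vol0 q with pit := p } ∧
          VectorConstraint { J vol0 q with pit := p } ∧
          GaussConstraint vol0 { J vol0 q with pit := p })) ∧
      (SecondaryF q →
        (p = piTilde vol0 q ↔ ScalarConstraint vol0 { J vol0 q with pit := p })) ∧
      (p = piTilde vol0 q →
        (SecondaryF q ↔ VectorConstraint { J vol0 q with pit := p })) ∧
      (SecondaryT q ↔ GaussConstraint vol0 { J vol0 q with pit := p })) ∧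
    -- the auxiliary triad `h`, and its expression in terms of `H̃`
    (∀ q ∈ M0 vol0,
      dFun q.φ = ∑ i, fmul (alpha q.e q.φ i) (q.e i) ∧
      (∀ i, HForm q.e q.φ i = dual2 (hTriad q.e q.φ) i) ∧
      (∀ x, 0 < ratio (volOf (hTriad q.e q.φ)) vol0 x ∧
        ratio (volOf (hTriad q.e q.φ)) vol0 x ^ 2 = detHSq vol0 (J vol0 q).Ht x) ∧
      (∀ i, hTriad q.e q.φ i = triadOfHt vol0 (J vol0 q).Ht i)) ∧
    -- the Hamiltonian vectors: Euclidean general relativity plus an extra term in `Z_A`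
    (∀ q ∈ M0 vol0, ∀ Z : Fields M, Z.Smooth →
      (IsHamiltonianAt vol0 q Z ↔
        SecondaryF q ∧ SecondaryT q ∧
        (∀ i, Z.A i =
          grConn (hTriad q.e q.φ) q.A q.At (lapseHat q.et q.e q.φ Z.φ)
              (shiftHat q.et q.e q.φ Z.φ) i
            + extraConn q.e q.A q.φ (lapseHat q.et q.e q.φ Z.φ) i) ∧
        (∀ i, vary (fun p => HForm p.e p.φ i) q Z =
          grFlux (hTriad q.e q.φ) q.A q.At (lapseHat q.et q.e q.φ Z.φ)
            (shiftHat q.et q.e q.φ Z.φ) i))) ∧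
    -- `Z_{e_t}`, `Z_{A_t}` and `Z_φ` are arbitrary, and determine the other components
    (∀ q ∈ M0 vol0, SecondaryF q → SecondaryT q →
      ∀ (zet zAt : Fin 3 → M → ℝ) (zφ : M → ℝ),
        (∀ i, SmoothFun (zet i)) → (∀ i, SmoothFun (zAt i)) → SmoothFun zφ →
        ∃! Z : Fields M, Z.Smooth ∧ Z.et = zet ∧ Z.At = zAt ∧ Z.φ = zφ ∧
          IsHamiltonianAt vol0 q Z) ∧
    -- the same evolution in terms of the vector field `ξ` determined by the redefined shift
    (∀ q ∈ M0 vol0, ∀ Z : Fields M, Z.Smooth → IsHamiltonianAt vol0 q Z →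
      (∀ i, vary (fun p => HForm p.e p.φ i) q Z = inner1 ((TJ vol0 q Z).Ht i) vol0) ∧
      (∃! ξ : VF M, SmoothVF ξ ∧
        ∀ i, ev ξ (hTriad q.e q.φ i) = shiftHat q.et q.e q.φ Z.φ i) ∧
      ∀ ξ : VF M, SmoothVF ξ →
        (∀ i, ev ξ (hTriad q.e q.φ i) = shiftHat q.et q.e q.φ Z.φ i) →
        (∀ i, Z.A i = hkConn ξ q.A q.At i
          - (∑ j, fmul (fun x => lapseHat q.et q.e q.φ Z.φ x *
              matOf (curv q.A) (hTriad q.e q.φ) i j x) (hTriad q.e q.φ j))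
          + extraConn q.e q.A q.φ (lapseHat q.et q.e q.φ Z.φ) i) ∧
        (∀ i, vary (fun p => HForm p.e p.φ i) q Z =
          hkForm ξ q.A q.At (HForm q.e q.φ) i
            - cov q.A (fun j => fmul (lapseHat q.et q.e q.φ Z.φ) (hTriad q.e q.φ j)) i)) ∧
    -- the choice `Z_φ = e_t · α` gives the dynamics of the standard Husain–Kuchař model
    (∀ q ∈ M0 vol0, ∀ Z : Fields M, Z.Smooth → IsHamiltonianAt vol0 q Z →
      Z.φ = etAlpha q.et q.e q.φ →
      lapseHat q.et q.e q.φ Z.φ = 0 ∧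
      (∃! ξ : VF M, SmoothVF ξ ∧ ∀ i, ev ξ (q.e i) = q.et i) ∧
      (∀ ξ : VF M, (∀ i, ev ξ (q.e i) = q.et i) ↔
        ∀ i, ev ξ (hTriad q.e q.φ i) = shiftHat q.et q.e q.φ Z.φ i) ∧
      ∀ ξ : VF M, SmoothVF ξ → (∀ i, ev ξ (q.e i) = q.et i) →
        (∀ i, Z.A i = hkConn ξ q.A q.At i) ∧
        (∀ i, vary (fun p => HForm p.e p.φ i) q Z = hkForm ξ q.A q.At (HForm q.e q.φ) i) ∧
        (∀ i, (TJ vol0 q Z).Ht i = hkVec vol0 ξ q.A q.At (J vol0 q).Ht i) ∧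
        (∀ i, Z.e i = hkForm ξ q.A q.At q.e i) ∧
        Z.φ = ev ξ (dFun q.φ)) := by
  have he : ∀ q ∈ M0 vol0, ∀ x, volOf q.e x ≠ 0 := fun q hq x =>
    volOf_ne_zero_of_ratio (hq.2 x).ne'
  refine ⟨fun q hq => J_smooth hvol0 hvol0_ne hq.1, injOn_J vol0, ?_, ?_, ?_, ?_, ?_, ?_, ?_⟩
  · exact fun q hq Z Y hZ hY => ⟨omega_eq_omegaExpanded hvol0 hvol0_ne hq.1 hZ hY,
      omega_eq_omegaCan hvol0 hvol0_ne hq.1 hZ hY⟩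
  · intro q hq p _
    have hS := fun hF => scalarConstraint_iff (p := p) (he q hq) hq.2 ((secondaryF_iff q).1 hF)
    have hV := fun hp => vectorConstraint_iff (p := p) (he q hq) hq.2 hp
    have hG := gaussConstraint_iff (p := p) hvol0_ne hq.1
    refine ⟨⟨fun ⟨hp, hF, hT⟩ => ⟨(hS hF).1 hp, (hV hp).1 hF, hG.1 hT⟩, fun ⟨h1, h2, h3⟩ => ?_⟩,
      hS, hV, hG⟩
    -- Equality of p and π̃ must come first: the vector constraint can be exchanged for (F) only
    -- once it is known.
    have hp := scalar_vector_imp (he q hq) hq.2 h1 h2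
    exact ⟨hp, (hV hp).2 h2, hG.2 h3⟩
  · exact fun q hq => ⟨dFun_eq_sum (he q hq) q.φ, HForm_eq_dual2 (he q hq) q.φ,
      fun x => ⟨ratio_volOf_hTriad_pos (he q hq) q.φ hq.2 x,
        ratio_volOf_hTriad_sq (he q hq) q.φ hq.2 x⟩, hTriad_eq_triadOfHt (he q hq) q.φ hq.2⟩
  · exact fun q hq Z hZ => isHamiltonianAt_iff_gr hvol0 hvol0_ne hq.1 (he q hq) hZ
  · exact fun q hq hF hT zet zAt zφ h1 h2 h3 =>
      existsUnique_isHamiltonianAt hvol0 hvol0_ne hq.1 (he q hq) hF hT h1 h2 h3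
  · exact fun q hq Z hZ hH => ⟨vary_HForm_eq_inner1 hvol0 hvol0_ne hq.1 (he q hq) hZ hH,
      existsUnique_ev_coframe (SmoothForm.hTriad hq.1 (he q hq))
        (fun x => volOf_hTriad_ne_zero q.φ (he q hq x)) (SmoothFun.shiftHat hq.1 (he q hq) hZ.φ),
      fun ξ hξ h => hamiltonian_eq_hk hvol0 hvol0_ne hq.1 (he q hq) hZ hH hξ h⟩
  · intro q hq Z hZ hH hφ
    refine ⟨by rw [hφ, lapseHat_etAlpha], existsUnique_ev_coframe hq.1.e (he q hq) hq.1.et,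
      fun ξ => ?_, fun ξ hξs hξ =>
        hamiltonian_eq_standard hvol0 hvol0_ne hq.1 (he q hq) hZ hH hξs hφ hξ⟩
    rw [hφ]
    exact ev_iff_ev_hTriad (he q hq)
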